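/- Let $d\ge 1$, let $A=\Delta^2$ on $\mathbb{R}^d$, and for $t>0$ let $G(t,\cdot)$ be the function on $\mathbb{R}^d$ with Fourier transform $\widehat G(t,\xi)=\int_{\mathbb{R}^d} e^{-i x\cdot\xi}G(t,x)\,dx=e^{-t|\xi|^4}$. For a function $k:\mathbb{R}^d\to\mathbb{R}$ such that for every $t>0$ the convolution $G(t,\cdot)\star k$ converges absolutely at every point, put $e^{-tA}k:=G(t,\cdot)\star k$ and define, with values in $[0,\infty]$, \[ \|k\|_{\mathcal B}:=\sup_{t>0} t^{1/4}\|\nabla e^{-tA}k\|_{L^\infty},\qquad \|k\|_{\mathcal B^0}:=\Bigl(\sup_{x\in\mathbb{R}^d,\,r>0}\frac1{r^{d+2}}\int_0^{r^4}\!\!\int_{B_r(x)}|\nabla e^{-tA}k(y)|^2\,dy\,dt\Bigr)^{1/2}, \] and, for $R>0$, let $\|k\|_{\mathcal B_R}$ and $\|k\|_{\mathcal B^0_R}$ be given by the same formulas with the suprema restricted to $0<t\le R^4$ and to $x\in\mathbb{R}^d$, $0<r\le R$, respectively. Let $\mathcal B^0$ be the space of all such $k$ for which $e^{-tA}k$ is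 differentiable in $x$ for every $t>0$, $|\nabla e^{-tA}k|\in L^2_{\mathrm{loc}}((0,\infty)\times\mathbb{R}^d)$ and $\|k\|_{\mathcal B^0}<\infty$. For $k\in L^1_{\mathrm{loc}}(\mathbb{R}^d)$ let $\|k\|_{BMO}:=\sup_{B}\frac1{|B|}\int_B|k-k_B|\,dy$, where $B$ runs over all balls and $k_B:=\frac1{|B|}\int_B k\,dy$, and let $BMO(\mathbb{R}^d)$ be the space of all $k\in L^1_{\mathrm{loc}}(\mathbb{R}^d)$ with $\|k\|_{BMO}<\infty$. (a) If $d\le 3$, there are constants $c_1,c_2>0$, depending only on $d$, such that for every $k$ as above \[ c_1\|k\|_{\mathcal B}\le\|k\|_{\mathcal B^0}\le c_2\|k\|_{\mathcal B} \qquad\text{and}\qquad c_1\|k\|_{\mathcal B_R}\le\|k\|_{\mathcal B^0_R}\le c_2\|k\|_{\mathcal B_R}\quad\text{for every } R>0. \] (b) For every $d\ge1$ there is a constant $c_3>0$, depending only on $d$, such that $\|k\|_{\mathcal B^0}\le c_3\|k\|_{BMO}$ for every $k\in BMO(\mathbb{R}^d)$. Moreover $BMO(\mathbb{R}^d)\subset\mathcal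 B^0$, and in particular $L^\infty(\mathbb{R}^d)\subset\mathcal B^0$. -/

import Mathlib

open MeasureTheory Set
open scoped ENNReal NNReal FourierTransform

noncomputable section

namespace Bicaloric

/-- The Euclidean space `ℝ^d`. -/
abbrev E (d : ℕ) : Type := EuclideanSpace ℝ (Fin d)

/-- The Green's function of `∂ₜ + Δ²`: the function whose Fourier transform in `x`, with the
convention `∫ exp (-i x·ξ) f x dx`, is `exp (-t |ξ|⁴)`. Mathlib's Fourier transform is
`∫ exp (-2πi x·ξ) f x dx`, hence `2πξ` in place of `ξ`. The inverse transform is real, since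
the symbol is real and even. -/
def green (d : ℕ) (t : ℝ) (x : E d) : ℝ :=
  (𝓕⁻ (fun ξ : E d => ((Real.exp (-t * (2 * Real.pi * ‖ξ‖) ^ 4) : ℝ) : ℂ)) x).re

/-- The bi-caloric extension is defined: for every `t > 0` the convolution `G(t,·) ⋆ k`
converges absolutely at every point. -/
def HasExtension {d : ℕ} (k : E d → ℝ) : Prop :=
  ∀ t : ℝ, 0 < t →
    ConvolutionExists (green d t) k (ContinuousLinearMap.lsmul ℝ ℝ) volume

/-- The bi-caloric extension `(t, x) ↦ (e^{-tA} k)(x) = (G(t,·) ⋆ k)(x)`, `A = Δ²`. -/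
def extension {d : ℕ} (k : E d → ℝ) (t : ℝ) : E d → ℝ :=
  convolution (green d t) k (ContinuousLinearMap.lsmul ℝ ℝ) volume

/-- The quantity `r^{-(d+2)} ∫₀^{r⁴} ∫_{B_r(x)} |∇h|² dy dt`. -/
def energy {d : ℕ} (h : ℝ → E d → ℝ) (x : E d) (r : ℝ) : ℝ≥0∞ :=
  (∫⁻ t in Ioo 0 (r ^ 4), ∫⁻ y in Metric.ball x r, ‖gradient (h t) y‖ₑ ^ 2) /
    ENNReal.ofReal (r ^ (d + 2))

/-- The seminorm of `𝒳⁰`, with values in `[0, ∞]`. -/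
def normX0 {d : ℕ} (h : ℝ → E d → ℝ) : ℝ≥0∞ :=
  (⨆ (x : E d) (r : ℝ) (_ : 0 < r), energy h x r) ^ (1 / 2 : ℝ)

/-- The seminorm of `𝒳⁰_R`. -/
def normX0Loc {d : ℕ} (R : ℝ) (h : ℝ → E d → ℝ) : ℝ≥0∞ :=
  (⨆ (x : E d) (r : ℝ) (_ : 0 < r ∧ r ≤ R), energy h x r) ^ (1 / 2 : ℝ)

/-- The quantity `t^{1/4} ‖∇h(t)‖_∞`. -/
def weightedGrad {d : ℕ} (h : ℝ → E d → ℝ) (t : ℝ) : ℝ≥0∞ :=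
  ENNReal.ofReal (t ^ (1 / 4 : ℝ)) * eLpNorm (fun x => gradient (h t) x) ∞ volume

/-- The seminorm of `𝒳`. -/
def normX {d : ℕ} (h : ℝ → E d → ℝ) : ℝ≥0∞ :=
  ⨆ (t : ℝ) (_ : 0 < t), weightedGrad h t

/-- The seminorm of `𝒳_R`. -/
def normXLoc {d : ℕ} (R : ℝ) (h : ℝ → E d → ℝ) : ℝ≥0∞ :=
  ⨆ (t : ℝ) (_ : 0 < t ∧ t ≤ R ^ 4), weightedGrad h t

/-- `‖k‖_{𝓑⁰}`. -/
def normB0 {d : ℕ} (k : E d → ℝ) : ℝ≥0∞ := normX0 (extension k)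

/-- `‖k‖_{𝓑⁰_R}`. -/
def normB0Loc {d : ℕ} (R : ℝ) (k : E d → ℝ) : ℝ≥0∞ := normX0Loc R (extension k)

/-- `‖k‖_𝓑`. -/
def normB {d : ℕ} (k : E d → ℝ) : ℝ≥0∞ := normX (extension k)

/-- `‖k‖_{𝓑_R}`. -/
def normBLoc {d : ℕ} (R : ℝ) (k : E d → ℝ) : ℝ≥0∞ := normXLoc R (extension k)

/-- `k ∈ 𝓑⁰`: the bi-caloric extension is defined, has (classical) spatial derivatives with
`|∇h| ∈ L²_loc((0,∞) × ℝ^d)`, and its `𝒳⁰` seminorm is finite. -/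
def MemB0 {d : ℕ} (k : E d → ℝ) : Prop :=
  HasExtension k ∧
    (∀ t : ℝ, 0 < t → Differentiable ℝ (extension k t)) ∧
    LocallyIntegrableOn (fun p : ℝ × E d => ‖gradient (extension k p.1) p.2‖ ^ 2)
      (Ioi 0 ×ˢ univ) ∧
    normB0 k < ∞

/-- The `BMO` seminorm of a locally integrable function: the supremum over all balls of the
mean oscillation. -/
def normBMO {d : ℕ} (k : E d → ℝ) : ℝ≥0∞ :=
  ⨆ (x : E d) (r : ℝ) (_ : 0 < r),
    (∫⁻ y in Metric.ball x r, ‖k y - ⨍ z in Metric.ball x r, k z‖ₑ) / volume (Metric.ball x r)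

/-- `k ∈ BMO(ℝ^d)`. -/
def MemBMO {d : ℕ} (k : E d → ℝ) : Prop :=
  LocallyIntegrable k ∧ normBMO k < ∞

end Bicaloric

end

noncomputable section

namespace Bicaloric

section

open scoped SchwartzMap LineDeriv

/-! ### The symbol and the kernel as Schwartz functions -/

/-! The bound of `normB0` by `normB` is an integration: if `t^{1/4} |∇h(t)| ≤ N`, then `|∇h|² ≤ N²
t^{-1/2}`, which integrates over a cylinder of radius `r` to a multiple of `N² r^{d+2}`
(`energy_le`). Conversely, the semigroup property gives `∇h(r⁴) = G(r⁴ - s) ⋆ ∇h(s)` for every `s`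
in `(0, r⁴/2)`, with kernels bounded uniformly in `s` by a multiple of `polyKernel r`. Averaging
over `s`, replacing values by averages over balls of radius `r`, and applying Cauchy–Schwarz on each
cylinder bounds `r |∇h(r⁴)|` by the square means at the single radius `r`
(`ofReal_mul_le_of_le_lintegral`, `exists_enorm_fderiv_extension_le`). Time `t` is thus tied to
radius `t^{1/4}`, so the localised statement holds with the same constants.

The delicate point is that `HasExtension` only asserts absolute convergence, while the semigroup
identity needs Fubini, hence integrability of `k` against every weight `exp (-c |x|^{4/3})`
(`HasExtension.weightIntegrable`). A pointwise lower bound on `|G|` is not at hand, so it is bounded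
below in the mean on small balls (`exists_le_lintegral_green`). On the Fourier side `4 ∇ΔG = x G` at
time `1`; along a ray this is a linear system for `G`, its radial derivative and `ΔG`, whose
weighted energy cannot decay faster than `exp (-K r^{4/3})` (`energy_lower_bound`). If `G` were much
smaller on a whole segment, interpolation would make the energy too small. Baire's theorem and
Tonelli then transfer the mean lower bound to `k`. Matching upper bounds for `G` come from a complex
shift of the frequency variable (`exists_abs_green_one_le`).

For `BMO`, `∫ ∇G = 0` allows the mean of `k` over `B_r(x)`, `r = t^{1/4}`, to be subtracted; a
dyadic decomposition then bounds `normB` (`exists_normB_le_normBMO`), and hence `normB0`. -/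

lemma exists_bound_polynomial_mul_gaussian (p : Polynomial ℝ) (k : ℕ) :
    ∃ C : ℝ, ∀ x : ℝ, |x| ^ k * |p.eval x * Real.exp (-(x ^ 2 / 2))| ≤ C := by
  -- The bounds used are `|x|^m ≤ m! exp |x|` and `|x| - x²/2 ≤ 1/2`. Polynomial factors matter
  -- because the derivatives of the Gaussian are Hermite polynomials times the Gaussian.
  have mono : ∀ m : ℕ, ∀ x : ℝ,
      |x| ^ m * Real.exp (-(x ^ 2 / 2)) ≤ m.factorial * Real.exp (1 / 2) := by
    intro m x
    have h1 := Real.pow_div_factorial_le_exp |x| (abs_nonneg x) m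
    rw [div_le_iff₀ (by positivity)] at h1
    calc |x| ^ m * Real.exp (-(x ^ 2 / 2))
        ≤ Real.exp |x| * m.factorial * Real.exp (-(x ^ 2 / 2)) := by gcongr
      _ = m.factorial * Real.exp (|x| + -(x ^ 2 / 2)) := by rw [Real.exp_add]; ring
      _ ≤ m.factorial * Real.exp (1 / 2) := by
          gcongr
          nlinarith [sq_nonneg (|x| - 1), sq_abs x]
  induction p using Polynomial.induction_on' with
  | add p q hp hq =>
    obtain ⟨C₁, h₁⟩ := hp
    obtain ⟨C₂, h₂⟩ := hq
    refine ⟨C₁ + C₂, fun x => ?_⟩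
    rw [Polynomial.eval_add, add_mul]
    calc _ ≤ |x| ^ k * (|p.eval x * Real.exp (-(x ^ 2 / 2))|
            + |q.eval x * Real.exp (-(x ^ 2 / 2))|) := by gcongr; exact abs_add_le _ _
      _ ≤ _ := by rw [mul_add]; exact add_le_add (h₁ x) (h₂ x)
  | monomial n a =>
    refine ⟨|a| * ((k + n).factorial * Real.exp (1 / 2)), fun x => ?_⟩
    rw [Polynomial.eval_monomial, abs_mul, abs_mul, abs_pow, Real.abs_exp]
    calc _ = |a| * (|x| ^ (k + n) * Real.exp (-(x ^ 2 / 2))) := by rw [pow_add]; ring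
      _ ≤ _ := mul_le_mul_of_nonneg_left (mono _ _) (abs_nonneg a)

/-- The Gaussian `exp (-x²/2)` as a Schwartz function. -/
def gaussianSchwartz : 𝓢(ℝ, ℝ) where
  toFun x := Real.exp (-(x ^ 2 / 2))
  smooth' := by fun_prop
  decay' := by
    intro k n
    obtain ⟨C, hC⟩ := exists_bound_polynomial_mul_gaussian
      ((Polynomial.hermite n).map (Int.castRingHom ℝ)) k
    refine ⟨C, fun x => ?_⟩
    rw [norm_iteratedFDeriv_eq_norm_iteratedDeriv, iteratedDeriv_eq_iterate,
      Polynomial.deriv_gaussian_eq_hermite_mul_gaussian]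
    refine le_trans (le_of_eq ?_) (hC x)
    rw [Real.norm_eq_abs, Real.norm_eq_abs, mul_assoc, abs_mul ((-1) ^ n), abs_pow, abs_neg,
      abs_one, one_pow, one_mul, Polynomial.eval_map, Polynomial.aeval_def]
    rfl

variable {d : ℕ}

/-- `exp (-a ‖ξ‖⁴)` is a Schwartz function. -/
lemma exists_schwartz_exp_neg_mul_norm_pow_four {a : ℝ} (ha : 0 < a) :
    ∃ f : 𝓢(E d, ℂ), ∀ ξ, f ξ = ((Real.exp (-a * ‖ξ‖ ^ 4) : ℝ) : ℂ) := by
  have hs : 0 < √(2 * a) := Real.sqrt_pos.2 (by positivity)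
  -- The quartic exponential is the Gaussian composed with `u = √(2a) ‖ξ‖²`, since `u²/2 = a ‖ξ‖⁴`;
  -- this `u` is smooth at the origin too, and `hu` says that it grows fast enough to preserve
  -- Schwartz decay.
  have hg : (fun ξ : E d => √(2 * a) * ‖ξ‖ ^ 2).HasTemperateGrowth := by fun_prop
  have hu : ∃ (k : ℕ) (C : ℝ), ∀ ξ : E d, ‖ξ‖ ≤ C * (1 + ‖√(2 * a) * ‖ξ‖ ^ 2‖) ^ k := by
    refine ⟨1, 1 + 1 / √(2 * a), fun ξ => ?_⟩
    rw [pow_one, Real.norm_of_nonneg (by positivity)]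
    have : (1 + 1 / √(2 * a)) * (1 + √(2 * a) * ‖ξ‖ ^ 2)
        = 1 + 1 / √(2 * a) + √(2 * a) * ‖ξ‖ ^ 2 + ‖ξ‖ ^ 2 := by field_simp; ring
    rw [this]
    have h1 : 0 < 1 / √(2 * a) := by positivity
    have h2 : 0 ≤ √(2 * a) * ‖ξ‖ ^ 2 := by positivity
    nlinarith [sq_nonneg (‖ξ‖ - 1)]
  refine ⟨(SchwartzMap.compCLM ℝ hg hu gaussianSchwartz).postcompCLM Complex.ofRealCLM,
    fun ξ => ?_⟩
  rw [SchwartzMap.postcompCLM_apply, SchwartzMap.compCLM_apply]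
  change ((Real.exp (-((√(2 * a) * ‖ξ‖ ^ 2) ^ 2 / 2)) : ℝ) : ℂ) = _
  congr 2
  rw [mul_pow, Real.sq_sqrt (by positivity)]
  ring

lemma exists_schwartz_symbol {t : ℝ} (ht : 0 < t) :
    ∃ f : 𝓢(E d, ℂ), ∀ ξ, f ξ = ((Real.exp (-t * (2 * Real.pi * ‖ξ‖) ^ 4) : ℝ) : ℂ) := by
  obtain ⟨f, hf⟩ := exists_schwartz_exp_neg_mul_norm_pow_four (d := d)
    (a := t * (2 * Real.pi) ^ 4) (by positivity)
  refine ⟨f, fun ξ => ?_⟩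
  rw [hf]; congr 2; ring

/-- The Fourier symbol `exp (-t (2π‖ξ‖)⁴)` of `e^{-tΔ²}` as a Schwartz function. -/
def symbol (d : ℕ) {t : ℝ} (ht : 0 < t) : 𝓢(E d, ℂ) := (exists_schwartz_symbol ht).choose

lemma symbol_apply {t : ℝ} (ht : 0 < t) (ξ : E d) :
    symbol d ht ξ = ((Real.exp (-t * (2 * Real.pi * ‖ξ‖) ^ 4) : ℝ) : ℂ) :=
  (exists_schwartz_symbol ht).choose_spec ξ

/-- The kernel `G(t, ·)` as a complex-valued Schwartz function. -/
def greenSchwartz (d : ℕ) {t : ℝ} (ht : 0 < t) : 𝓢(E d, ℂ) := 𝓕⁻ (symbol d ht)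

lemma greenSchwartz_eq_fourierInv {t : ℝ} (ht : 0 < t) (x : E d) :
    greenSchwartz d ht x =
      𝓕⁻ (fun ξ : E d => ((Real.exp (-t * (2 * Real.pi * ‖ξ‖) ^ 4) : ℝ) : ℂ)) x := by
  rw [greenSchwartz, SchwartzMap.fourierInv_coe]
  exact congrArg (fun f : E d → ℂ => 𝓕⁻ f x) (funext fun ξ => symbol_apply ht ξ)

lemma green_eq_re {t : ℝ} (ht : 0 < t) (x : E d) : green d t x = (greenSchwartz d ht x).re := by
  rw [greenSchwartz_eq_fourierInv, green]

/-- The symbol is real and even, so conjugating the inverse transform amounts to substituting `-ξ`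
for `ξ`. -/
lemma greenSchwartz_eq_ofReal {t : ℝ} (ht : 0 < t) (x : E d) :
    greenSchwartz d ht x = (green d t x : ℂ) := by
  rw [green_eq_re ht]
  refine (Complex.conj_eq_iff_re.1 ?_).symm
  rw [greenSchwartz_eq_fourierInv, Real.fourierInv_eq', ← integral_conj,
    ← integral_neg_eq_self]
  congr 1
  ext ξ
  rw [smul_eq_mul, smul_eq_mul, map_mul, Complex.conj_ofReal, ← Complex.exp_conj, norm_neg,
    inner_neg_left]
  congr 2
  rw [map_mul, Complex.conj_ofReal, Complex.conj_I]
  push_cast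
  ring

lemma contDiff_green {t : ℝ} (ht : 0 < t) (n : ℕ∞) : ContDiff ℝ n (green d t) := by
  have : green d t = fun x => Complex.reCLM (greenSchwartz d ht x) := by
    ext x; exact green_eq_re ht x
  rw [this]
  exact Complex.reCLM.contDiff.comp ((greenSchwartz d ht).smooth n)

/-- The substitution `η = l ξ` in the Fourier integral. It reduces every kernel estimate to time
`1`. -/
lemma green_scaling (t : ℝ) {l : ℝ} (hl : 0 < l) (x : E d) :
    green d (l ^ 4 * t) x = (l ^ d)⁻¹ * green d t (l⁻¹ • x) := by
  rw [green, green, ← Complex.re_ofReal_mul]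
  congr 1
  rw [Real.fourierInv_eq', Real.fourierInv_eq']
  have h := Measure.integral_comp_smul (volume : Measure (E d))
    (fun η => Complex.exp (((2 * Real.pi * inner ℝ η (l⁻¹ • x) : ℝ) : ℂ) * Complex.I) •
      ((Real.exp (-t * (2 * Real.pi * ‖η‖) ^ 4) : ℝ) : ℂ)) l
  rw [finrank_euclideanSpace_fin, abs_of_pos (by positivity), Complex.real_smul] at h
  rw [← h]
  congr 1
  ext ξ
  have h1 : inner ℝ (l • ξ) (l⁻¹ • x) = inner ℝ ξ x := by
    rw [real_inner_smul_left, real_inner_smul_right]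
    field_simp
  have h2 : -t * (2 * Real.pi * ‖l • ξ‖) ^ 4 = -(l ^ 4 * t) * (2 * Real.pi * ‖ξ‖) ^ 4 := by
    rw [norm_smul, Real.norm_of_nonneg hl.le]
    ring
  rw [h1, h2]

/-- The semigroup property. -/
lemma green_convolution {s t : ℝ} (hs : 0 < s) (ht : 0 < t) (x : E d) :
    green d (s + t) x = ∫ y, green d s y * green d t (x - y) := by
  have key : greenSchwartz d (add_pos hs ht) =
      SchwartzMap.convolution (ContinuousLinearMap.mul ℂ ℂ) (greenSchwartz d hs)
        (greenSchwartz d ht) := by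
    have : symbol d (add_pos hs ht) = 𝓕 (SchwartzMap.convolution (ContinuousLinearMap.mul ℂ ℂ)
        (greenSchwartz d hs) (greenSchwartz d ht)) := by
      rw [SchwartzMap.fourier_convolution, greenSchwartz, greenSchwartz]
      ext ξ
      rw [SchwartzMap.pairing_apply_apply]
      simp only [FourierTransform.fourier_fourierInv_eq, symbol_apply, ContinuousLinearMap.mul_apply']
      rw [← Complex.ofReal_mul, ← Real.exp_add]
      congr 2; ring
    rw [greenSchwartz, this, FourierTransform.fourierInv_fourier_eq]
  have h2 := congrArg (fun f : 𝓢(E d, ℂ) => f x) key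
  simp only [SchwartzMap.convolution_apply, MeasureTheory.convolution,
    ContinuousLinearMap.mul_apply', greenSchwartz_eq_ofReal] at h2
  apply Complex.ofReal_injective
  rw [h2, ← integral_complex_ofReal]
  congr 1; ext y; push_cast; rfl

/-- The value at the origin is the integral of the positive symbol. It supplies a region of
positivity near `0`, used for local integrability of `k` and as initial datum for the radial system.
-/
lemma green_zero_pos {t : ℝ} (ht : 0 < t) : 0 < green d t 0 := by
  have : (green d t 0 : ℂ) = ((∫ ξ : E d, Real.exp (-t * (2 * Real.pi * ‖ξ‖) ^ 4) : ℝ) : ℂ) := by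
    rw [← greenSchwartz_eq_ofReal ht, greenSchwartz_eq_fourierInv, Real.fourierInv_eq',
      ← integral_complex_ofReal]
    simp
  rw [Complex.ofReal_injective this]
  refine integral_exp_pos ?_
  have h := (symbol d ht).integrable (μ := volume)
  have h2 := h.re
  refine h2.congr (Filter.Eventually.of_forall fun ξ => ?_)
  simp only [symbol_apply]
  exact Complex.ofReal_re _

end

section

open scoped SchwartzMap LineDeriv

variable {d : ℕ}

/-! ### Exponential decay of the kernel, by shifting the contour of integration -/

/-- The integrand of the kernel at time `1`, with the frequency variable shifted by `z • e` for
a complex number `z`. -/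
def shiftedIntegrand (x e ξ : E d) (z : ℂ) : ℂ :=
  Complex.exp (2 * Real.pi * (inner ℝ ξ x + z * inner ℝ e x) * Complex.I -
    (2 * Real.pi) ^ 4 * ((‖ξ‖ : ℂ) ^ 2 + 2 * z * inner ℝ ξ e + z ^ 2) ^ 2)

lemma shiftedIntegrand_ofReal (x : E d) {e : E d} (he : ‖e‖ = 1) (ξ : E d) (s : ℝ) :
    shiftedIntegrand x e ξ s = shiftedIntegrand x e (ξ + s • e) 0 := by
  have h : ((‖ξ + s • e‖ : ℂ)) ^ 2 = (‖ξ‖ : ℂ) ^ 2 + 2 * s * inner ℝ ξ e + s ^ 2 := by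
    have : ‖ξ + s • e‖ ^ 2 = ‖ξ‖ ^ 2 + 2 * s * inner ℝ ξ e + s ^ 2 := by
      rw [norm_add_sq_real, norm_smul, he, real_inner_smul_right, Real.norm_eq_abs, mul_one, sq_abs]
      ring
    exact_mod_cast congrArg (fun r : ℝ => (r : ℂ)) this
  rw [shiftedIntegrand, shiftedIntegrand, h, inner_add_left, real_inner_smul_left]
  push_cast
  ring_nf

/-- With `w = 2 z ⟨ξ, e⟩ + z²`, the real part of `(‖ξ‖² + w)²` is at least `‖ξ‖⁴ - 2 ‖ξ‖² ‖w‖ -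
‖w‖²`. Young's inequality absorbs the mixed terms into half of `‖ξ‖⁴` and a multiple of `‖z‖⁴`. -/
lemma norm_shiftedIntegrand_le (x : E d) {e : E d} (he : ‖e‖ = 1) (ξ : E d) (z : ℂ) :
    ‖shiftedIntegrand x e ξ z‖ ≤ Real.exp (-(2 * Real.pi * (z.im * inner ℝ e x)) +
      (2 * Real.pi) ^ 4 * (-(1 / 2) * ‖ξ‖ ^ 4 + 10000 * ‖z‖ ^ 4)) := by
  rw [shiftedIntegrand, Complex.norm_exp]
  apply Real.exp_le_exp.2
  have hin : |inner ℝ ξ e| ≤ ‖ξ‖ := by simpa [he] using abs_real_inner_le_norm ξ e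
  have h1 : ((2 * Real.pi * (inner ℝ ξ x + z * inner ℝ e x) * Complex.I : ℂ)).re
      = -(2 * Real.pi * (z.im * inner ℝ e x)) := by
    simp [Complex.mul_re, Complex.mul_im]
  have h2 : ((2 * Real.pi : ℂ) ^ 4 *
      ((‖ξ‖ : ℂ) ^ 2 + 2 * z * inner ℝ ξ e + z ^ 2) ^ 2).re
      = (2 * Real.pi) ^ 4 * ((((‖ξ‖ : ℂ) ^ 2 + 2 * z * inner ℝ ξ e + z ^ 2) ^ 2).re) := by
    rw [← Complex.re_ofReal_mul]; push_cast; rfl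
  rw [Complex.sub_re, h1, h2, sub_eq_add_neg]
  refine add_le_add le_rfl ?_
  rw [← mul_neg]
  refine mul_le_mul_of_nonneg_left ?_ (by positivity)
  set a := ‖ξ‖
  have ha : 0 ≤ a := norm_nonneg ξ
  set b := (inner ℝ ξ e : ℝ)
  set w : ℂ := 2 * z * b + z ^ 2
  have hw : ‖w‖ ≤ 2 * ‖z‖ * a + ‖z‖ ^ 2 := by
    refine (norm_add_le _ _).trans ?_
    rw [norm_mul, norm_mul, norm_pow, Complex.norm_real, Real.norm_eq_abs, Complex.norm_ofNat]
    gcongr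
  have h3 : ((((a : ℂ) ^ 2 + 2 * z * b + z ^ 2) ^ 2).re) = a ^ 4 + 2 * a ^ 2 * w.re + (w ^ 2).re := by
    have : ((a : ℂ) ^ 2 + 2 * z * b + z ^ 2) ^ 2
        = ((a ^ 4 : ℝ) : ℂ) + ((2 * a ^ 2 : ℝ) : ℂ) * w + w ^ 2 := by
      simp only [w]; push_cast; ring
    rw [this, Complex.add_re, Complex.add_re, Complex.ofReal_re, Complex.re_ofReal_mul]
  rw [h3]
  have h4 : -‖w‖ ≤ w.re := (abs_le.1 (Complex.abs_re_le_norm w)).1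
  have h5 : -‖w‖ ^ 2 ≤ (w ^ 2).re := by
    rw [← norm_pow]; exact (abs_le.1 (Complex.abs_re_le_norm (w ^ 2))).1
  set n := ‖z‖
  have hn : 0 ≤ n := norm_nonneg z
  have h6 : 2 * a ^ 2 * (-‖w‖) ≤ 2 * a ^ 2 * w.re := by gcongr
  have h7 : ‖w‖ ^ 2 ≤ (2 * n * a + n ^ 2) ^ 2 := by gcongr
  have h8 : 2 * a ^ 2 * ‖w‖ ≤ 2 * a ^ 2 * (2 * n * a + n ^ 2) := by gcongr
  have h9 : 4 * (a ^ 3 * n) ≤ a ^ 4 / 16 + 64 * (a ^ 2 * n ^ 2) := by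
    nlinarith [sq_nonneg (a ^ 2 / 4 - 8 * (a * n))]
  -- Here `72 = 64 + 6 + 2` collects all `a² n²` terms: those from `h9`, from expanding the
  -- products, and from `h11`.
  have h10 : 72 * (a ^ 2 * n ^ 2) ≤ a ^ 4 / 4 + 5184 * n ^ 4 := by
    nlinarith [sq_nonneg (a ^ 2 / 2 - 72 * n ^ 2)]
  have h11 : 4 * (a * n ^ 3) ≤ 2 * (a ^ 2 * n ^ 2) + 2 * n ^ 4 := by
    nlinarith [sq_nonneg (a * n - n ^ 2)]
  have h12 : 0 ≤ n ^ 4 := by positivity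
  have h13 : 0 ≤ a ^ 4 := by positivity
  nlinarith

lemma continuous_shiftedIntegrand (x e : E d) (z : ℂ) :
    Continuous fun ξ => shiftedIntegrand x e ξ z := by
  unfold shiftedIntegrand
  fun_prop

lemma integrable_exp_neg_mul_norm_pow_four {a : ℝ} (ha : 0 < a) :
    Integrable fun ξ : E d => Real.exp (-a * ‖ξ‖ ^ 4) := by
  obtain ⟨f, hf⟩ := exists_schwartz_exp_neg_mul_norm_pow_four (d := d) ha
  refine (f.integrable (μ := volume)).re.congr (Filter.Eventually.of_forall fun ξ => ?_)
  simp only [hf]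
  exact Complex.ofReal_re _

lemma differentiable_shiftedIntegrand (x e ξ : E d) :
    Differentiable ℂ (shiftedIntegrand x e ξ) := by
  unfold shiftedIntegrand
  fun_prop

lemma norm_shiftedIntegrand_le_of_norm_le (x : E d) {e : E d} (he : ‖e‖ = 1) (ξ : E d) {z : ℂ}
    {r : ℝ} (hz : ‖z‖ ≤ r) :
    ‖shiftedIntegrand x e ξ z‖ ≤
      Real.exp (2 * Real.pi * (r * ‖x‖) + (2 * Real.pi) ^ 4 * (10000 * r ^ 4)) *
        Real.exp (-((2 * Real.pi) ^ 4 * (1 / 2)) * ‖ξ‖ ^ 4) := by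
  refine (norm_shiftedIntegrand_le x he ξ z).trans ?_
  rw [← Real.exp_add]
  apply Real.exp_le_exp.2
  have hex : |inner ℝ e x| ≤ ‖x‖ := by simpa [he] using abs_real_inner_le_norm e x
  have h1 : |z.im * inner ℝ e x| ≤ r * ‖x‖ := by
    rw [abs_mul]
    exact mul_le_mul ((Complex.abs_im_le_norm z).trans hz) hex (abs_nonneg _)
      ((norm_nonneg z).trans hz)
  have h2 : -(2 * Real.pi * (z.im * inner ℝ e x)) ≤ 2 * Real.pi * (r * ‖x‖) := by
    rw [← mul_neg]
    exact mul_le_mul_of_nonneg_left ((neg_le_abs _).trans h1) (by positivity)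
  have h3 : (2 * Real.pi) ^ 4 * (10000 * ‖z‖ ^ 4) ≤ (2 * Real.pi) ^ 4 * (10000 * r ^ 4) := by
    gcongr
  linarith

lemma integrable_shiftedIntegrand (x : E d) {e : E d} (he : ‖e‖ = 1) (z : ℂ) :
    Integrable fun ξ => shiftedIntegrand x e ξ z :=
  ((integrable_exp_neg_mul_norm_pow_four (by positivity)).const_mul _).mono'
    (continuous_shiftedIntegrand x e z).aestronglyMeasurable
    (Filter.Eventually.of_forall fun ξ => norm_shiftedIntegrand_le_of_norm_le x he ξ le_rfl)

lemma differentiable_integral_shiftedIntegrand (x : E d) {e : E d} (he : ‖e‖ = 1) :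
    Differentiable ℂ fun z => ∫ ξ, shiftedIntegrand x e ξ z := by
  intro z₀
  -- The derivative is bounded by Cauchy's estimate on the unit circle about a point within `1` of
  -- `z₀`; hence the radius `‖z₀‖ + 2`.
  set C := Real.exp (2 * Real.pi * ((‖z₀‖ + 2) * ‖x‖) +
    (2 * Real.pi) ^ 4 * (10000 * (‖z₀‖ + 2) ^ 4))
  refine (hasDerivAt_integral_of_dominated_loc_of_deriv_le (μ := volume)
    (F := fun z ξ => shiftedIntegrand x e ξ z)
    (F' := fun z ξ => deriv (shiftedIntegrand x e ξ) z)
    (bound := fun ξ => C * Real.exp (-((2 * Real.pi) ^ 4 * (1 / 2)) * ‖ξ‖ ^ 4))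
    (Metric.ball_mem_nhds z₀ one_pos)
    (Filter.Eventually.of_forall fun z => (continuous_shiftedIntegrand x e z).aestronglyMeasurable)
    (integrable_shiftedIntegrand x he z₀) ?_ ?_
    ((integrable_exp_neg_mul_norm_pow_four (by positivity)).const_mul _) ?_).2.differentiableAt
  · have hc : Continuous (Function.uncurry fun ξ z => shiftedIntegrand x e ξ z) := by
      unfold shiftedIntegrand Function.uncurry
      fun_prop
    exact ((measurable_deriv_with_param hc).comp
      (measurable_id.prodMk measurable_const)).aestronglyMeasurable
  · refine Filter.Eventually.of_forall fun ξ z hz => ?_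
    have := Complex.norm_deriv_le_of_forall_mem_sphere_norm_le (c := z) (R := 1)
      (f := shiftedIntegrand x e ξ)
      (C := C * Real.exp (-((2 * Real.pi) ^ 4 * (1 / 2)) * ‖ξ‖ ^ 4)) one_pos
      (differentiable_shiftedIntegrand x e ξ).diffContOnCl fun w hw => ?_
    · simpa using this
    · refine norm_shiftedIntegrand_le_of_norm_le x he ξ ?_
      have h1 : ‖w - z‖ = 1 := by simpa [dist_eq_norm] using hw
      have h2 : ‖z - z₀‖ < 1 := by simpa [dist_eq_norm] using hz
      calc ‖w‖ = ‖(w - z) + (z - z₀) + z₀‖ := by congr 1; ring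
        _ ≤ ‖w - z‖ + ‖z - z₀‖ + ‖z₀‖ := norm_add₃_le
        _ ≤ ‖z₀‖ + 2 := by linarith
  · exact Filter.Eventually.of_forall fun ξ z _ =>
      (differentiable_shiftedIntegrand x e ξ z).hasDerivAt

/-- The integral is entire in `z`, and constant on the real axis because a real shift is a
translation of `ξ`; the identity theorem makes it constant. This replaces moving a contour in
several variables. -/
lemma integral_shiftedIntegrand (x : E d) {e : E d} (he : ‖e‖ = 1) (z : ℂ) :
    ∫ ξ, shiftedIntegrand x e ξ z = ∫ ξ, shiftedIntegrand x e ξ 0 := by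
  have han : AnalyticOnNhd ℂ (fun z => ∫ ξ, shiftedIntegrand x e ξ z) univ :=
    (differentiable_integral_shiftedIntegrand x he).differentiableOn.analyticOnNhd isOpen_univ
  have hreal : ∀ s : ℝ, ∫ ξ, shiftedIntegrand x e ξ s = ∫ ξ, shiftedIntegrand x e ξ 0 := by
    intro s
    simp_rw [shiftedIntegrand_ofReal x he]
    exact integral_add_right_eq_self (fun ξ => shiftedIntegrand x e ξ 0) (s • e)
  refine congrFun (han.eq_of_frequently_eq (z₀ := 0) analyticOnNhd_const ?_) z
  have h0 : Filter.Tendsto (fun n : ℕ => ((1 / (n + 1 : ℝ) : ℝ) : ℂ)) Filter.atTop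
      (nhdsWithin 0 {0}ᶜ) := by
    refine tendsto_nhdsWithin_iff.2 ⟨?_, Filter.Eventually.of_forall fun n => ?_⟩
    · have := tendsto_one_div_add_atTop_nhds_zero_nat (𝕜 := ℝ)
      exact Complex.ofReal_zero ▸ (Complex.continuous_ofReal.tendsto 0).comp this
    · simp only [mem_compl_iff, mem_singleton_iff, Complex.ofReal_eq_zero]
      positivity
  exact h0.frequently (Filter.Frequently.of_forall fun n => hreal _)

/-- The kernel at time `1` is bounded by `C exp (-c |x|^{4/3})`. -/
lemma exists_abs_green_one_le (d : ℕ) :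
    ∃ C c : ℝ, 0 < C ∧ 0 < c ∧ ∀ x : E d,
      |green d 1 x| ≤ C * Real.exp (-c * ‖x‖ ^ (4 / 3 : ℝ)) := by
  set A := ∫ ξ : E d, Real.exp (-((2 * Real.pi) ^ 4 * (1 / 2)) * ‖ξ‖ ^ 4)
  have hA : 0 ≤ A := integral_nonneg fun ξ => (Real.exp_pos _).le
  refine ⟨A + |green d 1 0| + 1, 1 / 1000, by positivity, by norm_num, fun x => ?_⟩
  rcases eq_or_ne x 0 with rfl | hx
  · rw [norm_zero, Real.zero_rpow (by norm_num), mul_zero, Real.exp_zero, mul_one]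
    linarith
  have hx' : 0 < ‖x‖ := norm_pos_iff.2 hx
  set e : E d := ‖x‖⁻¹ • x
  have he : ‖e‖ = 1 := by
    rw [norm_smul, norm_inv, norm_norm, inv_mul_cancel₀ hx'.ne']
  have hex : inner ℝ e x = ‖x‖ := by
    rw [real_inner_smul_left, real_inner_self_eq_norm_sq]; field_simp
  -- Shifting by `i y / 1000` along `x / ‖x‖` gains `2π y⁴ / 1000` in the exponent, as `‖x‖ = y³`,
  -- and costs only `(2π)⁴ · 10⁻⁸ y⁴`.
  set y := ‖x‖ ^ (1 / 3 : ℝ)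
  have hy : 0 < y := Real.rpow_pos_of_pos hx' _
  have hy3 : y ^ 3 = ‖x‖ := by
    rw [← Real.rpow_natCast, ← Real.rpow_mul hx'.le]; norm_num
  have hy4 : ‖x‖ ^ (4 / 3 : ℝ) = y ^ 4 := by
    rw [← Real.rpow_natCast, ← Real.rpow_mul hx'.le]; norm_num
  have h0 : (green d 1 x : ℂ) = ∫ ξ, shiftedIntegrand x e ξ (((1 / 1000 * y : ℝ) : ℂ) * Complex.I) := by
    rw [integral_shiftedIntegrand x he, ← greenSchwartz_eq_ofReal one_pos,
      greenSchwartz_eq_fourierInv, Real.fourierInv_eq']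
    congr 1
    ext ξ
    rw [shiftedIntegrand, smul_eq_mul, Complex.ofReal_exp, ← Complex.exp_add]
    congr 1
    push_cast
    ring
  rw [← Real.norm_eq_abs, ← Complex.norm_real, h0]
  have hb : ∀ ξ : E d, ‖shiftedIntegrand x e ξ (((1 / 1000 * y : ℝ) : ℂ) * Complex.I)‖ ≤
      Real.exp (-(1 / 1000) * y ^ 4) *
        Real.exp (-((2 * Real.pi) ^ 4 * (1 / 2)) * ‖ξ‖ ^ 4) := by
    intro ξ
    refine (norm_shiftedIntegrand_le x he ξ _).trans ?_
    rw [← Real.exp_add]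
    apply Real.exp_le_exp.2
    have h1 : (((1 / 1000 * y : ℝ) : ℂ) * Complex.I).im = 1 / 1000 * y := by
      rw [Complex.im_ofReal_mul, Complex.I_im, mul_one]
    have h2 : ‖((1 / 1000 * y : ℝ) : ℂ) * Complex.I‖ = 1 / 1000 * y := by
      rw [norm_mul, Complex.norm_I, mul_one, Complex.norm_real,
        Real.norm_of_nonneg (by positivity)]
    rw [h1, h2, hex, ← hy3]
    have h3 : (2 * Real.pi) ^ 4 ≤ 8 ^ 4 :=
      pow_le_pow_left₀ (by positivity) (by linarith [Real.pi_le_four]) 4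
    have h4 : (2 * Real.pi) ^ 4 * y ^ 4 ≤ 8 ^ 4 * y ^ 4 := by gcongr
    have h5 : 3 * y ^ 4 ≤ Real.pi * y ^ 4 := by gcongr; exact Real.pi_gt_three.le
    have h6 : 0 < y ^ 4 := by positivity
    nlinarith
  calc _ ≤ ∫ ξ : E d, Real.exp (-(1 / 1000) * y ^ 4) *
        Real.exp (-((2 * Real.pi) ^ 4 * (1 / 2)) * ‖ξ‖ ^ 4) :=
        norm_integral_le_of_norm_le
          ((integrable_exp_neg_mul_norm_pow_four (by positivity)).const_mul _)
          (Filter.Eventually.of_forall hb)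
    _ = A * Real.exp (-(1 / 1000) * y ^ 4) := by rw [integral_const_mul, mul_comm]
    _ ≤ _ := by
        rw [hy4]
        gcongr
        linarith [abs_nonneg (green d 1 0)]

end

section

open scoped SchwartzMap LineDeriv

variable {d : ℕ}

/-! ### Bounds for the derivative of the kernel -/

/-- A Landau-type inequality: a function with Lipschitz derivative that is small at two points has
a small derivative. -/
lemma abs_deriv_le_of_abs_le {f f' : ℝ → ℝ} {a s η M : ℝ} (hs : 0 < s)
    (hf : ∀ u ∈ Icc a (a + s), HasDerivAt f (f' u) u)
    (hM : ∀ u ∈ Icc a (a + s), |f' u - f' a| ≤ M * (u - a)) (hM0 : 0 ≤ M)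
    (h₁ : |f a| ≤ η) (h₂ : |f (a + s)| ≤ η) : |f' a| ≤ 2 * η / s + M * s := by
  obtain ⟨c, hc, hcs⟩ := exists_hasDerivAt_eq_slope f f' (lt_add_of_pos_right a hs)
    (fun u hu => (hf u hu).continuousAt.continuousWithinAt)
    (fun u hu => hf u (Ioo_subset_Icc_self hu))
  have h3 : |f' c| ≤ 2 * η / s := by
    rw [hcs, add_sub_cancel_left, abs_div, abs_of_pos hs]
    gcongr
    calc |f (a + s) - f a| ≤ |f (a + s)| + |f a| := abs_sub _ _
      _ ≤ 2 * η := by linarith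
  have h4 : |f' c - f' a| ≤ M * s := (hM c (Ioo_subset_Icc_self hc)).trans
    (mul_le_mul_of_nonneg_left (by linarith [hc.2]) hM0)
  calc |f' a| = |f' c - (f' c - f' a)| := by rw [sub_sub_cancel]
    _ ≤ |f' c| + |f' c - f' a| := abs_sub _ _
    _ ≤ _ := add_le_add h3 h4

/-- The kernel `G(t, ·)` as a real-valued Schwartz function. -/
def greenReal (d : ℕ) {t : ℝ} (ht : 0 < t) : 𝓢(E d, ℝ) :=
  (greenSchwartz d ht).postcompCLM Complex.reCLM

lemma coe_greenReal {t : ℝ} (ht : 0 < t) : (greenReal d ht : E d → ℝ) = green d t := by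
  ext x
  rw [greenReal, SchwartzMap.postcompCLM_apply, green_eq_re ht]
  rfl

lemma integrable_green {t : ℝ} (ht : 0 < t) : Integrable (green d t) :=
  coe_greenReal ht ▸ (greenReal d ht).integrable

lemma integrable_fderiv_green {t : ℝ} (ht : 0 < t) : Integrable (fderiv ℝ (green d t)) := by
  rw [← coe_greenReal ht]
  exact (SchwartzMap.fderivCLM ℝ (E d) ℝ (greenReal d ht)).integrable

lemma continuous_fderiv_green {t : ℝ} (ht : 0 < t) : Continuous (fderiv ℝ (green d t)) := by
  rw [← coe_greenReal ht]
  exact (SchwartzMap.fderivCLM ℝ (E d) ℝ (greenReal d ht)).continuous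

lemma differentiable_green {t : ℝ} (ht : 0 < t) : Differentiable ℝ (green d t) :=
  (contDiff_green ht 1).differentiable (by norm_num)

lemma exists_lipschitz_schwartz {F : Type*} [NormedAddCommGroup F] [NormedSpace ℝ F]
    (f : 𝓢(E d, F)) : ∃ M : ℝ, 0 ≤ M ∧ ∀ x y, ‖f x - f y‖ ≤ M * ‖x - y‖ := by
  refine ⟨SchwartzMap.seminorm ℝ 0 0 (SchwartzMap.fderivCLM ℝ (E d) F f), apply_nonneg _ _,
    fun x y => ?_⟩
  exact convex_univ.norm_image_sub_le_of_norm_fderiv_le (𝕜 := ℝ)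
    (fun z _ => f.differentiableAt)
    (fun z _ => SchwartzMap.norm_le_seminorm ℝ (SchwartzMap.fderivCLM ℝ (E d) F f) z)
    (mem_univ y) (mem_univ x)

lemma exists_lipschitz_fderiv_green {t : ℝ} (ht : 0 < t) : ∃ M : ℝ, 0 ≤ M ∧ ∀ x y : E d,
    ‖fderiv ℝ (green d t) x - fderiv ℝ (green d t) y‖ ≤ M * ‖x - y‖ := by
  obtain ⟨M, hM, h⟩ := exists_lipschitz_schwartz (SchwartzMap.fderivCLM ℝ (E d) ℝ (greenReal d ht))
  refine ⟨M, hM, fun x y => ?_⟩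
  simpa [SchwartzMap.fderivCLM_apply, coe_greenReal ht] using h x y

lemma exists_lipschitz_green {t : ℝ} (ht : 0 < t) : ∃ M : ℝ, 0 ≤ M ∧ ∀ x y : E d,
    |green d t x - green d t y| ≤ M * ‖x - y‖ := by
  obtain ⟨M, hM, h⟩ := exists_lipschitz_schwartz (greenReal d ht)
  refine ⟨M, hM, fun x y => ?_⟩
  simpa [coe_greenReal ht] using h x y

lemma hasDerivAt_line {f : E d → ℝ} (hf : Differentiable ℝ f) (x v : E d) (u : ℝ) :
    HasDerivAt (fun u : ℝ => f (x + u • v)) (fderiv ℝ f (x + u • v) v) u := by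
  have h1 : HasDerivAt (fun u : ℝ => x + u • v) v u := by
    simpa using ((hasDerivAt_id u).smul_const v).const_add x
  exact (hf _).hasFDerivAt.comp_hasDerivAt u h1

/-- Landau interpolation between the decay of the kernel and the Lipschitz bound on its derivative:
with step `s = exp (-c |x|^{4/3} / 2)` it gives `2 C s² / s + M s`, at the price of halving the
rate. Directions pointing away from the origin are used, so that the decay at `x` persists along the
segment; the others follow by sign change. -/
lemma exists_norm_fderiv_green_one_le (d : ℕ) :
    ∃ C c : ℝ, 0 < C ∧ 0 < c ∧ ∀ x : E d,
      |green d 1 x| ≤ C * Real.exp (-c * ‖x‖ ^ (4 / 3 : ℝ)) ∧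
      ‖fderiv ℝ (green d 1) x‖ ≤ C * Real.exp (-c * ‖x‖ ^ (4 / 3 : ℝ)) := by
  obtain ⟨C, c, hC, hc, hg⟩ := exists_abs_green_one_le d
  obtain ⟨M, hM, hL⟩ := exists_lipschitz_fderiv_green (d := d) one_pos
  refine ⟨2 * C + M, c / 2, by positivity, by positivity, fun x => ?_⟩
  set p : ℝ := ‖x‖ ^ (4 / 3 : ℝ)
  have hp : 0 ≤ p := by positivity
  set s := Real.exp (-(c / 2) * p)
  have hs : 0 < s := Real.exp_pos _
  have hs2 : Real.exp (-c * p) = s * s := by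
    rw [← Real.exp_add]; congr 1; ring
  have hs1 : s ≤ 1 := Real.exp_le_one_iff.2 (by nlinarith)
  constructor
  · refine (hg x).trans ?_
    rw [show Real.exp (-c * ‖x‖ ^ (4 / 3 : ℝ)) = s * s from hs2]
    nlinarith [mul_pos hC hs]
  have key : ∀ v : E d, ‖v‖ = 1 → 0 ≤ inner ℝ x v →
      |fderiv ℝ (green d 1) x v| ≤ (2 * C + M) * s := by
    intro v hv hxv
    have hsmall : ∀ u : ℝ, 0 ≤ u → |green d 1 (x + u • v)| ≤ C * (s * s) := by
      intro u hu
      refine (hg _).trans ?_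
      rw [← hs2]
      have : ‖x‖ ≤ ‖x + u • v‖ := by
        refine le_of_sq_le_sq ?_ (norm_nonneg _)
        rw [norm_add_sq_real, real_inner_smul_right]
        nlinarith [mul_nonneg hu hxv, sq_nonneg ‖u • v‖]
      have h43 := Real.rpow_le_rpow (norm_nonneg x) this (by norm_num : (0 : ℝ) ≤ 4 / 3)
      exact mul_le_mul_of_nonneg_left (Real.exp_le_exp.2
        (mul_le_mul_of_nonpos_left h43 (by linarith))) hC.le
    have h := abs_deriv_le_of_abs_le (f := fun u : ℝ => green d 1 (x + u • v))
      (f' := fun u => fderiv ℝ (green d 1) (x + u • v) v) (a := 0) (s := s) (η := C * (s * s))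
      (M := M) hs (fun u _ => hasDerivAt_line (differentiable_green one_pos) x v u)
      (fun u hu => ?_) hM (hsmall 0 le_rfl) (hsmall _ (by linarith))
    · simp only [zero_smul, add_zero] at h
      refine h.trans (le_of_eq ?_)
      field_simp
    · have h1 := (fderiv ℝ (green d 1) (x + u • v) - fderiv ℝ (green d 1) (x + (0 : ℝ) • v)).le_opNorm v
      rw [hv, mul_one] at h1
      refine h1.trans ((hL _ _).trans (le_of_eq ?_))
      rw [zero_smul, add_zero, add_sub_cancel_left, norm_smul, hv, mul_one, sub_zero,
        Real.norm_of_nonneg hu.1]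
  have hneg : ∀ v : E d, ‖v‖ = 1 → |fderiv ℝ (green d 1) x v| ≤ (2 * C + M) * s := by
    intro v hv
    rcases le_total 0 (inner ℝ x v) with h | h
    · exact key v hv h
    · have := key (-v) (by rwa [norm_neg]) (by rw [inner_neg_right]; linarith)
      rwa [map_neg, abs_neg] at this
  refine ContinuousLinearMap.opNorm_le_of_unit_norm (by positivity) hneg

lemma lineDerivOp_greenSchwartz {t : ℝ} (ht : 0 < t) (m x : E d) :
    ∂_{m} (greenSchwartz d ht) x = (fderiv ℝ (green d t) x m : ℂ) := by
  have : (greenSchwartz d ht : E d → ℂ) = Complex.ofRealCLM ∘ green d t := by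
    ext x; exact greenSchwartz_eq_ofReal ht x
  rw [SchwartzMap.lineDerivOp_apply_eq_fderiv, this,
    (Complex.ofRealCLM.hasFDerivAt.comp x (differentiable_green ht x).hasFDerivAt).fderiv]
  rfl

/-- The Fourier transform of a derivative vanishes at frequency zero. This cancellation makes the
gradient of the extension insensitive to constants. -/
lemma integral_fderiv_green {t : ℝ} (ht : 0 < t) : ∫ x, fderiv ℝ (green d t) x = 0 := by
  ext m
  rw [ContinuousLinearMap.integral_apply (integrable_fderiv_green ht),
    zero_apply]
  have h := congrArg (fun f : 𝓢(E d, ℂ) => f 0)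
    (SchwartzMap.fourier_lineDerivOp_eq (greenSchwartz d ht) m)
  have htg : (fun x : E d => inner ℝ x m).HasTemperateGrowth := by fun_prop
  simp only [smul_apply, SchwartzMap.smulLeftCLM_apply_apply htg, inner_zero_left,
    zero_smul, smul_zero] at h
  rw [SchwartzMap.fourier_coe, Real.fourier_eq'] at h
  simp only [inner_zero_right, mul_zero, Complex.ofReal_zero, zero_mul, Complex.exp_zero,
    one_smul, lineDerivOp_greenSchwartz] at h
  rw [integral_complex_ofReal] at h
  exact_mod_cast h

lemma fderiv_green_convolution {s t : ℝ} (hs : 0 < s) (ht : 0 < t) (x : E d) :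
    fderiv ℝ (green d (s + t)) x = ∫ y, green d s y • fderiv ℝ (green d t) (x - y) := by
  have h0 : green d (s + t) = fun x => ∫ y, green d s y * green d t (x - y) :=
    funext (green_convolution hs ht)
  set F := SchwartzMap.fderivCLM ℝ (E d) ℝ (greenReal d ht)
  have hF : ∀ y, F y = fderiv ℝ (green d t) y := fun y => by
    rw [SchwartzMap.fderivCLM_apply, coe_greenReal]
  have hb : ∀ y, ‖fderiv ℝ (green d t) y‖ ≤ SchwartzMap.seminorm ℝ 0 0 F := fun y => by
    rw [← hF]; exact SchwartzMap.norm_le_seminorm ℝ F y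
  rw [h0]
  refine (hasFDerivAt_integral_of_dominated_of_fderiv_le (𝕜 := ℝ) (μ := volume)
    (F := fun x y => green d s y * green d t (x - y))
    (F' := fun x y => green d s y • fderiv ℝ (green d t) (x - y))
    (bound := fun y => |green d s y| * SchwartzMap.seminorm ℝ 0 0 F)
    (Metric.ball_mem_nhds x one_pos) ?_ ?_ ?_ ?_ ?_ ?_).fderiv
  · refine Filter.Eventually.of_forall fun z => ?_
    exact ((differentiable_green hs).continuous.mul ((differentiable_green ht).continuous.comp
      (continuous_const.sub continuous_id))).aestronglyMeasurable
  · refine ((integrable_green hs).norm.mul_const (SchwartzMap.seminorm ℝ 0 0 (greenReal d ht))).mono'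
      ((differentiable_green hs).continuous.mul ((differentiable_green ht).continuous.comp
      (continuous_const.sub continuous_id))).aestronglyMeasurable
      (Filter.Eventually.of_forall fun y => ?_)
    rw [norm_mul]
    gcongr
    rw [← coe_greenReal ht]
    exact SchwartzMap.norm_le_seminorm ℝ (greenReal d ht) _
  · exact ((differentiable_green hs).continuous.smul ((continuous_fderiv_green ht).comp
      (continuous_const.sub continuous_id))).aestronglyMeasurable
  · refine Filter.Eventually.of_forall fun y z _ => ?_
    rw [norm_smul, Real.norm_eq_abs]
    gcongr
    exact hb _
  · exact (integrable_green hs).abs.mul_const _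
  · refine Filter.Eventually.of_forall fun y z _ => ?_
    have h1 : HasFDerivAt (fun z => green d t (z - y)) (fderiv ℝ (green d t) (z - y)) z :=
      (hasFDerivAt_comp_sub y).2 (differentiable_green ht (z - y)).hasFDerivAt
    exact h1.const_mul (green d s y)

end

section

open scoped SchwartzMap LineDeriv Laplacian

variable {d : ℕ}

/-! ### The radial differential equation satisfied by the kernel -/

lemma hasTemperateGrowth_inner (e : E d) : (fun x : E d => inner ℝ x e).HasTemperateGrowth := by
  fun_prop

lemma lineDerivOp_symbol_one (e : E d) (ξ : E d) :
    ∂_{e} (symbol d one_pos) ξ =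
      -(4 * (2 * Real.pi) ^ 4 * ((‖ξ‖ : ℂ) ^ 2 * (inner ℝ ξ e : ℝ))) * symbol d one_pos ξ := by
  rw [SchwartzMap.lineDerivOp_apply_eq_fderiv]
  have h0 : (symbol d one_pos : E d → ℂ) =
      Complex.ofRealCLM ∘ fun ξ => Real.exp (-(2 * Real.pi) ^ 4 * (‖ξ‖ ^ 2) ^ 2) := by
    ext ξ
    rw [symbol_apply, Function.comp_apply, Complex.ofRealCLM_apply]
    congr 2; ring
  have h1 := (((hasStrictFDerivAt_norm_sq ξ).hasFDerivAt.pow 2).const_mul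
    (-(2 * Real.pi) ^ 4)).exp
  rw [h0, (Complex.ofRealCLM.hasFDerivAt.comp ξ h1).fderiv]
  simp
  ring

/-- The inverse transform of `∇σ = -4 (2π)⁴ |ξ|² ξ σ` for the symbol `σ`: on the left,
differentiation becomes multiplication by `x`; on the right, the cubic factor becomes `∇Δ`. -/
lemma lineDerivOp_laplacian_green (e x : E d) :
    ∂_{e} (Δ (greenSchwartz d one_pos)) x = (inner ℝ x e / 4 : ℝ) * greenSchwartz d one_pos x := by
  have hL : Δ (greenSchwartz d one_pos) =
      𝓕⁻ (-(2 * Real.pi) ^ 2 • SchwartzMap.smulLeftCLM ℂ (fun ξ : E d => ‖ξ‖ ^ 2)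
        (symbol d one_pos)) := by
    rw [SchwartzMap.laplacian_eq_fourierMultiplierCLM, SchwartzMap.fourierMultiplierCLM_apply,
      FourierTransform.fourierInv_smul, greenSchwartz, FourierTransform.fourier_fourierInv_eq]
  have hn : (fun ξ : E d => ‖ξ‖ ^ 2).HasTemperateGrowth := by fun_prop
  have key : ∂_{e} (symbol d one_pos) = (-(8 * Real.pi * Complex.I)) • ((2 * Real.pi * Complex.I) •
      SchwartzMap.smulLeftCLM ℂ (inner ℝ · e) (-(2 * Real.pi) ^ 2 •
        SchwartzMap.smulLeftCLM ℂ (fun ξ : E d => ‖ξ‖ ^ 2) (symbol d one_pos))) := by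
    ext ξ
    rw [lineDerivOp_symbol_one]
    simp only [smul_apply, SchwartzMap.smulLeftCLM_apply_apply (hasTemperateGrowth_inner e),
      SchwartzMap.smulLeftCLM_apply_apply hn, smul_eq_mul, Complex.real_smul]
    push_cast
    linear_combination (-64 * Real.pi ^ 4 * (inner ℝ ξ e : ℝ) * (‖ξ‖ : ℂ) ^ 2 *
      symbol d one_pos ξ) * Complex.I_sq
  have h2 := congrArg (fun f : 𝓢(E d, ℂ) => (𝓕⁻ f) x) key
  simp only [SchwartzMap.fourierInv_lineDerivOp_eq, FourierTransform.fourierInv_smul (R := ℂ)] at h2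
  rw [← FourierTransform.fourierInv_smul, ← SchwartzMap.lineDerivOp_fourierInv_eq, ← hL] at h2
  simp only [smul_apply, SchwartzMap.smulLeftCLM_apply_apply (hasTemperateGrowth_inner e),
    smul_eq_mul, Complex.real_smul] at h2
  change -(2 * Real.pi * Complex.I) * (_ * greenSchwartz d one_pos x) = _ at h2
  have hpi : (Real.pi : ℂ) * Complex.I ≠ 0 := by simp [Real.pi_ne_zero]
  apply mul_left_cancel₀ hpi
  push_cast
  linear_combination (1 / 8 : ℂ) * h2

lemma hasDerivAt_schwartz_line (f : 𝓢(E d, ℂ)) (x v : E d) (u : ℝ) :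
    HasDerivAt (fun u : ℝ => f (x + u • v)) (∂_{v} f (x + u • v)) u := by
  have h1 : HasDerivAt (fun u : ℝ => x + u • v) v u := by
    simpa using ((hasDerivAt_id u).smul_const v).const_add x
  rw [SchwartzMap.lineDerivOp_apply_eq_fderiv]
  exact f.differentiableAt.hasFDerivAt.comp_hasDerivAt u h1

lemma lineDerivOp_smulLeft_inner (f : 𝓢(E d, ℂ)) (e v x : E d) :
    ∂_{v} (SchwartzMap.smulLeftCLM ℂ (inner ℝ · e) f) x =
      (inner ℝ v e : ℝ) * f x + (inner ℝ x e : ℝ) * ∂_{v} f x := by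
  have h1 := hasDerivAt_schwartz_line (SchwartzMap.smulLeftCLM ℂ (inner ℝ · e) f) x v 0
  have h2 : HasDerivAt (fun u : ℝ => ((inner ℝ (x + u • v) e : ℝ) : ℂ)) (inner ℝ v e : ℝ) 0 := by
    have h3 : HasDerivAt (fun u : ℝ => inner ℝ (x + u • v) e) (inner ℝ v e : ℝ) 0 := by
      simp only [inner_add_left, real_inner_smul_left]
      simpa using ((hasDerivAt_id (0 : ℝ)).mul_const (inner ℝ v e : ℝ)).const_add (inner ℝ x e : ℝ)
    exact h3.ofReal_comp
  have h4 := h2.mul (hasDerivAt_schwartz_line f x v 0)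
  simp only [SchwartzMap.smulLeftCLM_apply_apply (hasTemperateGrowth_inner e),
    Complex.real_smul, zero_smul, add_zero] at h1 h4
  exact h1.unique h4

/-- Infinitesimal rotation invariance. It is evident for the symbol, whose gradient is parallel to
`ξ`, and passes through the Fourier transform because the two product-rule terms `⟨v, e⟩ G` cancel.
-/
lemma inner_mul_lineDerivOp_green_comm (e v x : E d) :
    (inner ℝ x e : ℝ) * ∂_{v} (greenSchwartz d one_pos) x =
      (inner ℝ x v : ℝ) * ∂_{e} (greenSchwartz d one_pos) x := by
  have key : (2 * Real.pi * Complex.I) •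
        SchwartzMap.smulLeftCLM ℂ (inner ℝ · v) (∂_{e} (symbol d one_pos)) =
      (2 * Real.pi * Complex.I) •
        SchwartzMap.smulLeftCLM ℂ (inner ℝ · e) (∂_{v} (symbol d one_pos)) := by
    ext ξ
    simp only [smul_apply, SchwartzMap.smulLeftCLM_apply_apply (hasTemperateGrowth_inner e),
      SchwartzMap.smulLeftCLM_apply_apply (hasTemperateGrowth_inner v), smul_eq_mul,
      Complex.real_smul, lineDerivOp_symbol_one]
    ring
  have h2 := congrArg (fun f : 𝓢(E d, ℂ) => (𝓕⁻ f) x) key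
  simp only [← SchwartzMap.lineDerivOp_fourierInv_eq, SchwartzMap.fourierInv_lineDerivOp_eq] at h2
  simp only [LineDeriv.lineDerivOp_smul, smul_apply, lineDerivOp_smulLeft_inner, smul_eq_mul] at h2
  have hpi : -(2 * Real.pi * Complex.I) ≠ 0 := by simp [Real.pi_ne_zero]
  have h3 := mul_left_cancel₀ hpi h2
  rw [real_inner_comm] at h3
  exact add_left_cancel h3

/-- Rotation invariance, differentiated at `r e` in the tangential direction `v`. Each of the `d -
1` tangential directions thus adds one radial derivative over `r` to the Laplacian. -/
lemma lineDerivOp_lineDerivOp_green_of_orthogonal {e v : E d} (he : ‖e‖ = 1) (hv : ‖v‖ = 1)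
    (hev : inner ℝ e v = 0) (r : ℝ) :
    r * ∂_{v} (∂_{v} (greenSchwartz d one_pos)) (r • e) =
      ∂_{e} (greenSchwartz d one_pos) (r • e) := by
  have h : ∀ u : ℝ, (r : ℂ) * ∂_{v} (greenSchwartz d one_pos) (r • e + u • v) =
      (u : ℂ) * ∂_{e} (greenSchwartz d one_pos) (r • e + u • v) := by
    intro u
    have := inner_mul_lineDerivOp_green_comm e v (r • e + u • v)
    simpa [inner_add_left, real_inner_smul_left, hev, real_inner_comm e v, he, hv] using this
  have h1 := (hasDerivAt_schwartz_line (∂_{v} (greenSchwartz d one_pos)) (r • e) v 0).const_mul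
    (r : ℂ)
  have h2 := (Complex.ofRealCLM.hasDerivAt (x := (0 : ℝ))).mul
    (hasDerivAt_schwartz_line (∂_{e} (greenSchwartz d one_pos)) (r • e) v 0)
  simp only [h] at h1
  have := h1.unique h2
  simpa using this

lemma laplacian_green_line (hd : 1 ≤ d) {e : E d} (he : ‖e‖ = 1) (r : ℝ) :
    r * Δ (greenSchwartz d one_pos) (r • e) =
      r * ∂_{e} (∂_{e} (greenSchwartz d one_pos)) (r • e) +
        (d - 1) * ∂_{e} (greenSchwartz d one_pos) (r • e) := by
  let i₀ : Fin d := ⟨0, hd⟩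
  have hon : Orthonormal ℝ (({i₀} : Set (Fin d)).domRestrict fun _ => e) := by
    refine ⟨fun _ => he, fun i j hij => (hij (Subsingleton.elim i j)).elim⟩
  obtain ⟨b, hb⟩ := hon.exists_orthonormalBasis_extension_of_card_eq
    (by simp)
  have hb0 : b i₀ = e := hb i₀ rfl
  rw [SchwartzMap.laplacian_eq_sum b, sum_apply,
    ← Finset.add_sum_erase _ _ (Finset.mem_univ i₀), hb0, mul_add, Finset.mul_sum,
    Finset.sum_congr rfl (g := fun _ => ∂_{e} (greenSchwartz d one_pos) (r • e))]
  · simp [hd]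
  · intro i hi
    refine lineDerivOp_lineDerivOp_green_of_orthogonal he (b.norm_eq_one i) ?_ r
    rw [← hb0]
    exact b.inner_eq_zero (Finset.ne_of_mem_erase hi).symm

end

section

open scoped SchwartzMap LineDeriv Laplacian

variable {d : ℕ}

/-! ### Lower bound for the kernel -/

/-- A lower bound for the solutions of the radial form of `4 ∇Δu = x u`. -/
lemma energy_lower_bound {A B D : ℝ → ℝ} {n r₀ : ℝ} (hn : 0 ≤ n) (hr₀ : 0 < r₀)
    (hA : ∀ r, r₀ ≤ r → HasDerivAt A (B r) r)
    (hB : ∀ r, r₀ ≤ r → HasDerivAt B (D r - n / r * B r) r)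
    (hD : ∀ r, r₀ ≤ r → HasDerivAt D (r / 4 * A r) r) {r : ℝ} (hr : r₀ ≤ r) :
    r₀ ^ (4 / 3 : ℝ) * A r₀ ^ 2 *
        Real.exp (-((3 + 2 * n * (r₀ ^ (4 / 3 : ℝ))⁻¹) * r ^ (4 / 3 : ℝ))) ≤
      r ^ (4 / 3 : ℝ) * A r ^ 2 + r ^ (2 / 3 : ℝ) * B r ^ 2 + D r ^ 2 := by
  set K := 3 + 2 * n * (r₀ ^ (4 / 3 : ℝ))⁻¹
  have hK : 0 ≤ K := by positivity
  -- With `l = r^{1/3}`, the quantities `l² A`, `l B`, `D` are coupled with coefficients of order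
  -- `l`, which is `3/4` of the derivative of `r^{4/3}`. Differentiating the weights only adds terms
  -- of favourable sign. The damping `n / r` is at most `n r₀^{-4/3} l`, whence the second term of
  -- `K`.
  set En : ℝ → ℝ := fun r => r ^ (4 / 3 : ℝ) * A r ^ 2 + r ^ (2 / 3 : ℝ) * B r ^ 2 + D r ^ 2
  have hderiv : ∀ r, r₀ ≤ r → HasDerivAt (fun r => En r * Real.exp (K * r ^ (4 / 3 : ℝ)))
      (((4 / 3 * r ^ (4 / 3 - 1 : ℝ) * A r ^ 2 + r ^ (4 / 3 : ℝ) * (2 * A r * B r)) +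
        (2 / 3 * r ^ (2 / 3 - 1 : ℝ) * B r ^ 2 +
          r ^ (2 / 3 : ℝ) * (2 * B r * (D r - n / r * B r))) +
        2 * D r * (r / 4 * A r)) * Real.exp (K * r ^ (4 / 3 : ℝ)) +
      En r * (Real.exp (K * r ^ (4 / 3 : ℝ)) * (K * (4 / 3 * r ^ (4 / 3 - 1 : ℝ))))) r := by
    intro r hr
    have hr0 : r ≠ 0 := (hr₀.trans_le hr).ne'
    have h43 := Real.hasDerivAt_rpow_const (x := r) (p := 4 / 3) (Or.inl hr0)
    have h23 := Real.hasDerivAt_rpow_const (x := r) (p := 2 / 3) (Or.inl hr0)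
    have h := (((h43.mul ((hA r hr).pow 2)).add (h23.mul ((hB r hr).pow 2))).add
      ((hD r hr).pow 2)).mul (h43.const_mul K).exp
    refine h.congr_deriv ?_
    simp only [En, Pi.add_apply, Pi.mul_apply, Pi.pow_apply, Nat.cast_ofNat, Nat.add_one_sub_one,
      pow_one]
  have hmono : MonotoneOn (fun r => En r * Real.exp (K * r ^ (4 / 3 : ℝ))) (Ici r₀) := by
    refine monotoneOn_of_deriv_nonneg (convex_Ici r₀)
      (fun r hr => (hderiv r hr).continuousAt.continuousWithinAt)
      (fun r hr => (hderiv r (interior_subset hr)).differentiableAt.differentiableWithinAt) ?_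
    intro r hr'
    have hr : r₀ ≤ r := interior_subset hr'
    have hrpos : 0 < r := hr₀.trans_le hr
    rw [(hderiv r hr).deriv]
    set l := r ^ (1 / 3 : ℝ)
    have hl : 0 < l := Real.rpow_pos_of_pos hrpos _
    have hl1 : r ^ (4 / 3 - 1 : ℝ) = l := by congr 1; norm_num
    have hl4 : r ^ (4 / 3 : ℝ) = l ^ 4 := by
      rw [← Real.rpow_natCast, ← Real.rpow_mul hrpos.le]; norm_num
    have hl2 : r ^ (2 / 3 : ℝ) = l ^ 2 := by
      rw [← Real.rpow_natCast, ← Real.rpow_mul hrpos.le]; norm_num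
    have hl3 : r = l ^ 3 := by
      rw [← Real.rpow_natCast, ← Real.rpow_mul hrpos.le]; norm_num
    have hnr : n / r * l ^ 2 ≤ n * (r₀ ^ (4 / 3 : ℝ))⁻¹ * l * l ^ 2 := by
      have h1 : r₀ ^ (4 / 3 : ℝ) ≤ l ^ 4 := by
        rw [← hl4]; exact Real.rpow_le_rpow hr₀.le hr (by norm_num)
      have h2 : (l ^ 4)⁻¹ ≤ (r₀ ^ (4 / 3 : ℝ))⁻¹ := inv_anti₀ (by positivity) h1
      have h3 : n / r = n * (l ^ 4)⁻¹ * l := by rw [hl3]; field_simp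
      rw [h3]
      gcongr
    have hEn : En r = l ^ 4 * A r ^ 2 + l ^ 2 * B r ^ 2 + D r ^ 2 := by simp only [En, hl4, hl2]
    rw [hEn, hl1, hl4, hl2]
    set q := n * (r₀ ^ (4 / 3 : ℝ))⁻¹
    have hq : 0 ≤ q := by positivity
    have hKq : K = 3 + 2 * q := by simp only [K, q]; ring
    have h23 : 0 ≤ 2 / 3 * r ^ (2 / 3 - 1 : ℝ) * B r ^ 2 := by positivity
    have hmain : 0 ≤ (4 / 3 * l * A r ^ 2 + l ^ 4 * (2 * A r * B r)) +
        (2 / 3 * r ^ (2 / 3 - 1 : ℝ) * B r ^ 2 + l ^ 2 * (2 * B r * (D r - n / r * B r))) +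
        2 * D r * (r / 4 * A r) +
        (l ^ 4 * A r ^ 2 + l ^ 2 * B r ^ 2 + D r ^ 2) * (K * (4 / 3 * l)) := by
      have e1 : l ^ 2 * (2 * B r * (D r - n / r * B r)) =
          2 * l ^ 2 * B r * D r - 2 * (n / r * l ^ 2) * B r ^ 2 := by ring
      have e2 : 2 * (n / r * l ^ 2) * B r ^ 2 ≤ 2 * (q * l * l ^ 2) * B r ^ 2 := by gcongr
      have e3 : 2 * D r * (r / 4 * A r) = l * (D r * (l ^ 2 * A r)) / 2 := by rw [hl3]; ring
      have f1 : 0 ≤ l * (l ^ 2 * A r + l * B r) ^ 2 := by positivity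
      have f2 : 0 ≤ l * (l * B r + D r) ^ 2 := by positivity
      have f3 : 0 ≤ l * (l ^ 2 * A r + D r) ^ 2 := by positivity
      have f4 : 0 ≤ 4 / 3 * l * A r ^ 2 := by positivity
      have g1 : 0 ≤ l * (l ^ 2 * A r) ^ 2 := by positivity
      have g2 : 0 ≤ l * (l * B r) ^ 2 := by positivity
      have g3 : 0 ≤ l * D r ^ 2 := by positivity
      have g4 : 0 ≤ q * (l * (l ^ 2 * A r) ^ 2) := by positivity
      have g5 : 0 ≤ q * (l * (l * B r) ^ 2) := by positivity
      have g6 : 0 ≤ q * (l * D r ^ 2) := by positivity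
      rw [e1, e3, hKq]
      nlinarith
    have := mul_nonneg hmain (Real.exp_pos (K * l ^ 4)).le
    linarith
  have h := hmono self_mem_Ici hr hr
  simp only at h
  have h1 : r₀ ^ (4 / 3 : ℝ) * A r₀ ^ 2 ≤ En r * Real.exp (K * r ^ (4 / 3 : ℝ)) := by
    refine le_trans ?_ h
    have h2 : r₀ ^ (4 / 3 : ℝ) * A r₀ ^ 2 ≤ En r₀ := by
      simp only [En]
      have : 0 ≤ r₀ ^ (2 / 3 : ℝ) * B r₀ ^ 2 := by positivity
      nlinarith [sq_nonneg (D r₀)]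
    have h3 : 1 ≤ Real.exp (K * r₀ ^ (4 / 3 : ℝ)) := Real.one_le_exp (by positivity)
    exact h2.trans (le_mul_of_one_le_right (by simp only [En]; positivity) h3)
  calc _ ≤ En r * Real.exp (K * r ^ (4 / 3 : ℝ)) * Real.exp (-(K * r ^ (4 / 3 : ℝ))) := by
        gcongr
    _ = En r := by rw [mul_assoc, ← Real.exp_add, add_neg_cancel, Real.exp_zero, mul_one]

/-- Smallness passes up the system with a square root lost at each stage: `δ⁴` for `A` gives order
`δ²` for `B` by Landau interpolation with step `δ²`, and then order `δ` for `D` by the mean value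
theorem for `B` with step `δ`. The condition `δ ≤ ε / 2` makes both steps fit into the segment. -/
lemma energy_upper_bound {A B D : ℝ → ℝ} {n M₁ M₂ r δ ε : ℝ} (hn : 0 ≤ n) (hM₁ : 0 ≤ M₁)
    (hM₂ : 0 ≤ M₂) (hr : 1 ≤ r) (hδ : 0 < δ) (hδ1 : δ ≤ 1) (hδε : δ ≤ ε / 2)
    (hA : ∀ u, r ≤ u → HasDerivAt A (B u) u)
    (hB : ∀ u, r ≤ u → HasDerivAt B (D u - n / u * B u) u)
    (hLB : ∀ u v, u ≤ v → |B v - B u| ≤ M₁ * (v - u))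
    (hLD : ∀ u v, u ≤ v → |D v - D u| ≤ M₂ * (v - u))
    (hsmall : ∀ u ∈ Icc r (r + ε), |A u| ≤ δ ^ 4) :
    r ^ (4 / 3 : ℝ) * A r ^ 2 + r ^ (2 / 3 : ℝ) * B r ^ 2 + D r ^ 2 ≤
      r ^ (4 / 3 : ℝ) *
        ((1 + (2 + M₁) ^ 2 + (2 * (2 + M₁) + n * (2 + M₁) + M₂) ^ 2) * δ ^ 2) := by
  have hδδ : δ ^ 2 ≤ δ := by nlinarith
  have hBs : ∀ u ∈ Icc r (r + ε / 2), |B u| ≤ (2 + M₁) * δ ^ 2 := by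
    intro u hu
    have h := abs_deriv_le_of_abs_le (f := A) (f' := B) (a := u) (s := δ ^ 2) (η := δ ^ 4)
      (M := M₁) (by positivity) (fun w hw => hA w (hu.1.trans hw.1)) (fun w hw => hLB u w hw.1) hM₁
      (hsmall u ⟨hu.1, by linarith [hu.2]⟩)
      (hsmall (u + δ ^ 2) ⟨by nlinarith [hu.1], by linarith [hu.2]⟩)
    refine h.trans (le_of_eq ?_)
    field_simp
  have hDs : |D r| ≤ (2 * (2 + M₁) + n * (2 + M₁) + M₂) * δ := by
    obtain ⟨w, hw, hslope⟩ := exists_hasDerivAt_eq_slope B (fun u => D u - n / u * B u)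
      (lt_add_of_pos_right r hδ)
      (fun u hu => (hB u hu.1).continuousAt.continuousWithinAt)
      (fun u hu => hB u hu.1.le)
    rw [add_sub_cancel_left] at hslope
    have h1 := hBs (r + δ) ⟨by linarith, by linarith⟩
    have h2 := hBs r ⟨le_rfl, by linarith⟩
    have h3 := hBs w ⟨hw.1.le, by linarith [hw.2]⟩
    have h4 : |(B (r + δ) - B r) / δ| ≤ 2 * (2 + M₁) * δ := by
      rw [abs_div, abs_of_pos hδ, div_le_iff₀ hδ]
      refine (abs_sub _ _).trans ?_
      linarith
    rw [← hslope] at h4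
    have hwr : 1 ≤ w := hr.trans hw.1.le
    have h5 : |n / w * B w| ≤ n * (2 + M₁) * δ := by
      rw [abs_mul, abs_of_nonneg (by positivity)]
      calc n / w * |B w| ≤ n * ((2 + M₁) * δ ^ 2) := by
            gcongr
            exact div_le_self hn hwr
        _ ≤ n * ((2 + M₁) * δ) := by gcongr
        _ = _ := by ring
    have h6 : |D w - D r| ≤ M₂ * δ := (hLD r w hw.1.le).trans
      (mul_le_mul_of_nonneg_left (by linarith [hw.2]) hM₂)
    rw [abs_le] at h4 h5 h6 ⊢
    constructor <;> linarith [h4.1, h4.2, h5.1, h5.2, h6.1, h6.2]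
  set p := r ^ (4 / 3 : ℝ)
  have hp : 1 ≤ p := Real.one_le_rpow hr (by norm_num)
  have hp2 : r ^ (2 / 3 : ℝ) ≤ p := Real.rpow_le_rpow_of_exponent_le hr (by norm_num)
  have a1 : A r ^ 2 ≤ δ ^ 2 := by
    rw [← sq_abs]
    exact pow_le_pow_left₀ (abs_nonneg _)
      ((hsmall r ⟨le_rfl, by linarith⟩).trans (by nlinarith [pow_pos hδ 2])) 2
  have a2 : B r ^ 2 ≤ (2 + M₁) ^ 2 * δ ^ 2 := by
    rw [← sq_abs, ← mul_pow]
    refine pow_le_pow_left₀ (abs_nonneg _) ((hBs r ⟨le_rfl, by linarith⟩).trans ?_) 2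
    gcongr
  have a3 : D r ^ 2 ≤ (2 * (2 + M₁) + n * (2 + M₁) + M₂) ^ 2 * δ ^ 2 := by
    rw [← sq_abs, ← mul_pow]
    exact pow_le_pow_left₀ (abs_nonneg _) hDs 2
  calc _ ≤ p * δ ^ 2 + p * ((2 + M₁) ^ 2 * δ ^ 2) +
        p * ((2 * (2 + M₁) + n * (2 + M₁) + M₂) ^ 2 * δ ^ 2) := by
        gcongr
        exact a3.trans (le_mul_of_one_le_left (by positivity) hp)
    _ = _ := by ring

/-- A solution of the radial form of `4 ∇Δu = x u` that is at least `m` at `r₀` cannot be smaller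
than `c exp (-K r^{4/3})` on a segment of length `ε`, where `K` does not depend on `ε`. -/
lemma exists_le_abs_of_radial {n M₁ M₂ r₀ m : ℝ} (hn : 0 ≤ n) (hM₁ : 0 ≤ M₁) (hM₂ : 0 ≤ M₂)
    (hr₀ : 0 < r₀) (hr₀1 : r₀ ≤ 1) (hm : 0 < m) : ∃ K : ℝ, 0 < K ∧ ∀ ε : ℝ, 0 < ε →
    ∃ c : ℝ, 0 < c ∧ ∀ A B D : ℝ → ℝ, m ≤ A r₀ →
      (∀ u, r₀ ≤ u → HasDerivAt A (B u) u) →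
      (∀ u, r₀ ≤ u → HasDerivAt B (D u - n / u * B u) u) →
      (∀ u, r₀ ≤ u → HasDerivAt D (u / 4 * A u) u) →
      (∀ u v, u ≤ v → |B v - B u| ≤ M₁ * (v - u)) →
      (∀ u v, u ≤ v → |D v - D u| ≤ M₂ * (v - u)) →
      ∀ r, 1 ≤ r → ∃ u ∈ Icc r (r + ε), c * Real.exp (-K * r ^ (4 / 3 : ℝ)) ≤ |A u| := by
  obtain ⟨m', hm'⟩ : ∃ m', m' = r₀ ^ (4 / 3 : ℝ) * m ^ 2 := ⟨_, rfl⟩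
  have hm'0 : 0 < m' := by rw [hm']; positivity
  obtain ⟨K, hKdef⟩ : ∃ K, K = 3 + 2 * n * (r₀ ^ (4 / 3 : ℝ))⁻¹ := ⟨_, rfl⟩
  have hK : 0 < K := by rw [hKdef]; positivity
  obtain ⟨N, hNdef⟩ : ∃ N, N = 1 + (2 + M₁) ^ 2 + (2 * (2 + M₁) + n * (2 + M₁) + M₂) ^ 2 :=
    ⟨_, rfl⟩
  have hN : 0 < N := by rw [hNdef]; positivity
  -- The choice is `δ = κ exp (-(K + 1) r^{4/3})`: the factor `4` comes from `δ⁴`, and the extra `1`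
  -- absorbs the prefactor `r^{4/3} ≤ exp (r^{4/3})` of the upper bound.
  refine ⟨4 * (K + 1), by positivity, fun ε hε => ?_⟩
  -- The bound by `m' / (2 N)` makes the upper bound of the energy at most half of its lower bound.
  obtain ⟨κ, hκ, hκ1, hκε, hκm⟩ : ∃ κ : ℝ, 0 < κ ∧ κ ≤ 1 ∧ κ ≤ ε / 2 ∧ κ ≤ m' / (2 * N) :=
    ⟨min 1 (min (ε / 2) (m' / (2 * N))), by positivity, min_le_left _ _,
      (min_le_right _ _).trans (min_le_left _ _), (min_le_right _ _).trans (min_le_right _ _)⟩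
  refine ⟨κ ^ 4, by positivity, fun A B D hmA hA hB hD hLB hLD r hr => ?_⟩
  by_contra! hcon
  have hlow := energy_lower_bound hn hr₀ hA hB hD (hr₀1.trans hr)
  have hp : 1 ≤ r ^ (4 / 3 : ℝ) := Real.one_le_rpow hr (by norm_num)
  have hexp1 : Real.exp (-(K + 1) * r ^ (4 / 3 : ℝ)) ≤ 1 := Real.exp_le_one_iff.2 (by nlinarith)
  obtain ⟨δ, hδdef⟩ : ∃ δ, δ = κ * Real.exp (-(K + 1) * r ^ (4 / 3 : ℝ)) := ⟨_, rfl⟩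
  have hδ : 0 < δ := by rw [hδdef]; positivity
  have hδ1 : δ ≤ κ := hδdef ▸ mul_le_of_le_one_right hκ.le hexp1
  have hδ4 : κ ^ 4 * Real.exp (-(4 * (K + 1)) * r ^ (4 / 3 : ℝ)) = δ ^ 4 := by
    rw [hδdef, mul_pow, ← Real.exp_nat_mul]; congr 2; push_cast; ring
  rw [hδ4] at hcon
  have hup := energy_upper_bound hn hM₁ hM₂ hr hδ (hδ1.trans hκ1) (hδ1.trans hκε)
    (fun u hu => hA u (hr₀1.trans (hr.trans hu))) (fun u hu => hB u (hr₀1.trans (hr.trans hu)))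
    hLB hLD (fun u hu => (hcon u hu).le)
  rw [← hNdef] at hup
  rw [← hKdef] at hlow
  have hmle : m' ≤ r₀ ^ (4 / 3 : ℝ) * A r₀ ^ 2 := by
    rw [hm']
    gcongr
  generalize r ^ (4 / 3 : ℝ) = p at *
  have h1 : m' * Real.exp (-(K * p)) ≤ p * (N * δ ^ 2) :=
    (mul_le_mul_of_nonneg_right hmle (Real.exp_pos _).le).trans (hlow.trans hup)
  have h2 : p ≤ Real.exp p := by linarith [Real.add_one_le_exp p]
  have h3 : p * (N * δ ^ 2) ≤ N * κ * Real.exp (-(K * p)) := by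
    have e1 : Real.exp (-(K + 1) * p) * Real.exp p = Real.exp (-(K * p)) := by
      rw [← Real.exp_add]; congr 1; ring
    calc p * (N * δ ^ 2) ≤ Real.exp p * (N * δ) := by
          gcongr
          nlinarith [hδ1.trans hκ1]
      _ = N * κ * Real.exp (-(K * p)) := by rw [← e1, hδdef]; ring
  have h4 : N * κ ≤ m' / 2 := by
    calc N * κ ≤ N * (m' / (2 * N)) := by gcongr
      _ = m' / 2 := by field_simp
  have h5 : N * κ * Real.exp (-(K * p)) ≤ m' / 2 * Real.exp (-(K * p)) := by gcongr
  nlinarith [mul_pos hm'0 (Real.exp_pos (-(K * p)))]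

lemma hasDerivAt_green_ray (e : E d) (r : ℝ) :
    HasDerivAt (fun r : ℝ => green d 1 (r • e)) (fderiv ℝ (green d 1) (r • e) e) r := by
  simpa using hasDerivAt_line (differentiable_green (d := d) one_pos) 0 e r

lemma hasDerivAt_laplacian_green_ray {e : E d} (he : ‖e‖ = 1) (r : ℝ) :
    HasDerivAt (fun r : ℝ => (Δ (greenSchwartz d one_pos) (r • e)).re)
      (r / 4 * green d 1 (r • e)) r := by
  have h := hasDerivAt_schwartz_line (Δ (greenSchwartz d one_pos)) 0 e r
  simp only [zero_add, lineDerivOp_laplacian_green] at h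
  have h2 := Complex.reCLM.hasFDerivAt.comp_hasDerivAt r h
  refine h2.congr_deriv ?_
  simp only [Complex.reCLM_apply, Complex.re_ofReal_mul, ← green_eq_re one_pos,
    real_inner_smul_left, real_inner_self_eq_norm_sq, he]
  ring

lemma hasDerivAt_fderiv_green_ray (hd : 1 ≤ d) {e : E d} (he : ‖e‖ = 1) {r : ℝ} (hr : 0 < r) :
    HasDerivAt (fun r : ℝ => fderiv ℝ (green d 1) (r • e) e)
      ((Δ (greenSchwartz d one_pos) (r • e)).re -
        (d - 1 : ℝ) / r * fderiv ℝ (green d 1) (r • e) e) r := by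
  have h := hasDerivAt_schwartz_line (∂_{e} (greenSchwartz d one_pos)) 0 e r
  simp only [zero_add] at h
  have h2 := Complex.reCLM.hasFDerivAt.comp_hasDerivAt r h
  have h3 := congrArg Complex.re (laplacian_green_line hd he r)
  rw [lineDerivOp_greenSchwartz, Complex.re_ofReal_mul, Complex.add_re, Complex.re_ofReal_mul,
    ← Complex.ofReal_natCast, ← Complex.ofReal_one, ← Complex.ofReal_sub, ← Complex.ofReal_mul,
    Complex.ofReal_re] at h3
  have h4 : (fun r : ℝ => fderiv ℝ (green d 1) (r • e) e) =
      Complex.reCLM ∘ fun r : ℝ => ∂_{e} (greenSchwartz d one_pos) (r • e) := by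
    ext r
    rw [Function.comp_apply, lineDerivOp_greenSchwartz]
    exact (Complex.ofReal_re _).symm
  rw [h4]
  refine h2.congr_deriv ?_
  rw [Complex.reCLM_apply]
  field_simp
  linarith

/-- On every segment of length `ε` of a ray, far from the origin, the kernel is at some point at
least `c exp (-K r^{4/3})`, where `K` does not depend on `ε`. -/
lemma exists_le_abs_green_one_ray (hd : 1 ≤ d) : ∃ K : ℝ, 0 < K ∧ ∀ ε : ℝ, 0 < ε →
    ∃ c : ℝ, 0 < c ∧ ∀ e : E d, ‖e‖ = 1 → ∀ r : ℝ, 1 ≤ r →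
      ∃ u ∈ Icc r (r + ε), c * Real.exp (-K * r ^ (4 / 3 : ℝ)) ≤ |green d 1 (u • e)| := by
  obtain ⟨M₁, hM₁, hL₁⟩ := exists_lipschitz_fderiv_green (d := d) one_pos
  obtain ⟨M₂, hM₂, hL₂⟩ := exists_lipschitz_schwartz (Δ (greenSchwartz d one_pos))
  have hn : (0 : ℝ) ≤ d - 1 := by
    have : (1 : ℝ) ≤ d := by exact_mod_cast hd
    linarith
  have hg0 : 0 < green d 1 (0 : E d) := green_zero_pos one_pos
  obtain ⟨δ₀, hδ₀, hball⟩ : ∃ δ > 0, ∀ x : E d, ‖x‖ < δ → green d 1 0 / 2 < green d 1 x := by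
    have hc := (differentiable_green (d := d) one_pos).continuous.tendsto 0
    have := hc.eventually (lt_mem_nhds (half_lt_self hg0))
    obtain ⟨δ, hδ, h⟩ := Metric.eventually_nhds_iff.1 this
    exact ⟨δ, hδ, fun x hx => h (by simpa using hx)⟩
  -- The system is singular at `r = 0`, so it is started at a radius where the kernel still exceeds
  -- half of its value at the origin.
  have hr₀ : 0 < min 1 (δ₀ / 2) := by positivity
  obtain ⟨K, hK, h⟩ := exists_le_abs_of_radial hn hM₁ hM₂ hr₀ (min_le_left _ _) (half_pos hg0)
  refine ⟨K, hK, fun ε hε => ?_⟩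
  obtain ⟨c, hc, h⟩ := h ε hε
  refine ⟨c, hc, fun e he => h (fun r => green d 1 (r • e))
    (fun r => fderiv ℝ (green d 1) (r • e) e)
    (fun r => (Δ (greenSchwartz d one_pos) (r • e)).re) ?_
    (fun u _ => hasDerivAt_green_ray e u)
    (fun u hu => hasDerivAt_fderiv_green_ray hd he (hr₀.trans_le hu))
    (fun u _ => hasDerivAt_laplacian_green_ray he u) ?_ ?_⟩
  · refine (hball _ ?_).le
    rw [norm_smul, he, mul_one, Real.norm_of_nonneg hr₀.le]
    exact (min_le_right _ _).trans_lt (by linarith)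
  · intro u v huv
    have h1 := (fderiv ℝ (green d 1) (v • e) - fderiv ℝ (green d 1) (u • e)).le_opNorm e
    rw [he, mul_one] at h1
    refine h1.trans ((hL₁ _ _).trans (le_of_eq ?_))
    rw [← sub_smul, norm_smul, he, mul_one, Real.norm_of_nonneg (by linarith)]
  · intro u v huv
    rw [← Complex.sub_re]
    refine (Complex.abs_re_le_norm _).trans ((hL₂ _ _).trans (le_of_eq ?_))
    rw [← sub_smul, norm_smul, he, mul_one, Real.norm_of_nonneg (by linarith)]

/-! ### Scaling, and the mass of the kernel in small balls. -/

lemma green_pow_four {l : ℝ} (hl : 0 < l) (x : E d) :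
    green d (l ^ 4) x = (l ^ d)⁻¹ * green d 1 (l⁻¹ • x) := by
  simpa using green_scaling 1 hl x

/-- The kernel has mass at least `c exp (-K |z/l|^{4/3})` in the ball `B_ε(z)`, where `K` does not
depend on `l` and `ε`. -/
lemma exists_le_lintegral_green (hd : 1 ≤ d) : ∃ K : ℝ, 0 < K ∧ ∀ l : ℝ, 0 < l → ∀ ε : ℝ, 0 < ε →
    ∃ c : ℝ, 0 < c ∧ ∀ z : E d, l ≤ ‖z‖ →
      ENNReal.ofReal (c * Real.exp (-K * (‖z‖ / l) ^ (4 / 3 : ℝ))) ≤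
        ∫⁻ w in Metric.ball z ε, ‖green d (l ^ 4) w‖ₑ := by
  obtain ⟨K, hK, h⟩ := exists_le_abs_green_one_ray hd
  -- A value of size `x` at one point persists, by the Lipschitz bound, on a ball of radius
  -- comparable to `x`; the mass there is of order `x^{d+1}`.
  refine ⟨(d + 1) * K, by positivity, fun l hl ε hε => ?_⟩
  obtain ⟨L, hL, hLip⟩ := exists_lipschitz_green (d := d) (pow_pos hl 4)
  obtain ⟨c₁, hc₁, hc⟩ := h (ε / 2 / l) (by positivity)
  set c₀ := (l ^ d)⁻¹ * c₁
  have hc₀ : 0 < c₀ := by positivity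
  set ω := (volume (Metric.ball (0 : E d) 1)).toReal
  have hω : 0 < ω := ENNReal.toReal_pos (Metric.measure_ball_pos _ _ one_pos).ne'
    measure_ball_lt_top.ne
  -- The second entry ensures `ρ ≤ ε / 2`. The good point lies within `ε / 2` of `z`, so its ball
  -- stays in `B_ε(z)`.
  set b := min c₀ (ε * (L + 1))
  have hb : 0 < b := by positivity
  refine ⟨b / 2 * ((b / (2 * (L + 1))) ^ d * ω), by positivity, fun z hz => ?_⟩
  have hz0 : 0 < ‖z‖ := by linarith
  obtain ⟨v, hv, hvg⟩ := hc (‖z‖⁻¹ • z)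
    (by rw [norm_smul, norm_inv, norm_norm, inv_mul_cancel₀ hz0.ne']) (‖z‖ / l)
    ((one_le_div hl).2 hz)
  set u := l * v
  have hu : u ∈ Icc ‖z‖ (‖z‖ + ε / 2) := by
    rw [← add_div] at hv
    constructor
    · have := (div_le_iff₀ hl).1 hv.1
      simp only [u]; linarith
    · have := (le_div_iff₀ hl).1 hv.2
      simp only [u]; linarith
  set x := Real.exp (-K * (‖z‖ / l) ^ (4 / 3 : ℝ))
  have hx : 0 < x := Real.exp_pos _
  have hx1 : x ≤ 1 := Real.exp_le_one_iff.2 (by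
    have : 0 ≤ (‖z‖ / l) ^ (4 / 3 : ℝ) := by positivity
    nlinarith)
  set z' := u • ‖z‖⁻¹ • z
  have hug : c₀ * x ≤ |green d (l ^ 4) z'| := by
    have hz' : l⁻¹ • z' = v • ‖z‖⁻¹ • z := by
      simp only [z', u]
      rw [smul_smul, inv_mul_cancel_left₀ hl.ne']
    rw [green_pow_four hl, hz', abs_mul, abs_of_pos (by positivity : 0 < (l ^ d)⁻¹)]
    simp only [c₀]
    rw [mul_assoc]
    gcongr
  have hzz : dist z' z ≤ ε / 2 := by
    have : z' - z = ((u - ‖z‖) * ‖z‖⁻¹) • z := by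
      rw [sub_mul, mul_inv_cancel₀ hz0.ne', sub_smul, one_smul, mul_smul]
    rw [dist_eq_norm, this, norm_smul, norm_mul, norm_inv, norm_norm, mul_assoc,
      inv_mul_cancel₀ hz0.ne', mul_one, Real.norm_of_nonneg (by linarith [hu.1])]
    linarith [hu.2]
  set ρ := b * x / (2 * (L + 1))
  have hρ : 0 < ρ := by positivity
  have hρε : ρ ≤ ε / 2 := by
    rw [div_le_iff₀ (by positivity)]
    calc b * x ≤ b := mul_le_of_le_one_right hb.le hx1
      _ ≤ ε * (L + 1) := min_le_right _ _
      _ = _ := by ring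
  have hsub : Metric.ball z' ρ ⊆ Metric.ball z ε := fun w hw => by
    have := dist_triangle w z' z
    rw [Metric.mem_ball] at hw ⊢
    linarith
  have hlow : ∀ w ∈ Metric.ball z' ρ, b * x / 2 ≤ |green d (l ^ 4) w| := by
    intro w hw
    have h1 := hLip z' w
    have h2 : ‖z' - w‖ ≤ ρ := by
      rw [← dist_eq_norm, dist_comm]; exact (Metric.mem_ball.1 hw).le
    have h3 : b * x ≤ |green d (l ^ 4) z'| := (mul_le_mul_of_nonneg_right (min_le_left _ _) hx.le).trans hug
    have h4 : L * ‖z' - w‖ ≤ b * x / 2 := by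
      calc L * ‖z' - w‖ ≤ (L + 1) * ρ := by gcongr; linarith
        _ = b * x / 2 := by simp only [ρ]; field_simp
    have h5 := abs_sub_abs_le_abs_sub (green d (l ^ 4) z') (green d (l ^ 4) w)
    linarith
  calc ENNReal.ofReal (b / 2 * ((b / (2 * (L + 1))) ^ d * ω) *
        Real.exp (-((d + 1) * K) * (‖z‖ / l) ^ (4 / 3 : ℝ)))
      = ENNReal.ofReal (b * x / 2) * volume (Metric.ball z' ρ) := by
        rw [Measure.addHaar_ball_of_pos volume z' hρ, finrank_euclideanSpace_fin,
          ← ENNReal.ofReal_toReal (measure_ball_lt_top (μ := (volume : Measure (E d)))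
            (x := 0) (r := 1)).ne,
          ← ENNReal.ofReal_mul (by positivity), ← ENNReal.ofReal_mul (by positivity)]
        congr 1
        have : Real.exp (-((d + 1) * K) * (‖z‖ / l) ^ (4 / 3 : ℝ)) = x ^ (d + 1) := by
          rw [← Real.exp_nat_mul]; congr 1; push_cast; ring
        rw [this]
        simp only [ρ]
        rw [div_pow, div_pow, mul_pow]
        ring
    _ = ∫⁻ _ in Metric.ball z' ρ, ENNReal.ofReal (b * x / 2) := by rw [setLIntegral_const]
    _ ≤ ∫⁻ w in Metric.ball z' ρ, ‖green d (l ^ 4) w‖ₑ := by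
        refine setLIntegral_mono' measurableSet_ball fun w hw => ?_
        rw [← ofReal_norm]
        exact ENNReal.ofReal_le_ofReal (hlow w hw)
    _ ≤ _ := lintegral_mono_set hsub

end

section

variable {d : ℕ}

/-! ### Functions with a bi-caloric extension -/

/-- The weight `exp (-c |x|^{4/3})`. -/
def weight (c : ℝ) (x : E d) : ℝ := Real.exp (-c * ‖x‖ ^ (4 / 3 : ℝ))

lemma weight_pos (c : ℝ) (x : E d) : 0 < weight c x := Real.exp_pos _

lemma continuous_weight (c : ℝ) : Continuous (weight c : E d → ℝ) := by
  unfold weight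
  exact Real.continuous_exp.comp (continuous_const.mul
    (continuous_norm.rpow_const fun _ => Or.inr (by norm_num)))

lemma weight_le_one {c : ℝ} (hc : 0 ≤ c) (x : E d) : weight c x ≤ 1 :=
  Real.exp_le_one_iff.2 (by
    have : 0 ≤ ‖x‖ ^ (4 / 3 : ℝ) := by positivity
    nlinarith)

lemma weight_anti {c c' : ℝ} (h : c ≤ c') (x : E d) : weight c' x ≤ weight c x :=
  Real.exp_le_exp.2 (mul_le_mul_of_nonneg_right (neg_le_neg h) (by positivity))

lemma rpow_norm_add_le (x y : E d) :
    ‖x + y‖ ^ (4 / 3 : ℝ) ≤ 4 * (‖x‖ ^ (4 / 3 : ℝ) + ‖y‖ ^ (4 / 3 : ℝ)) := by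
  have h1 : ‖x + y‖ ≤ 2 * max ‖x‖ ‖y‖ := by
    linarith [norm_add_le x y, le_max_left ‖x‖ ‖y‖, le_max_right ‖x‖ ‖y‖]
  have h2 : (2 : ℝ) ^ (4 / 3 : ℝ) ≤ 4 := by
    calc (2 : ℝ) ^ (4 / 3 : ℝ) ≤ 2 ^ (2 : ℝ) :=
          Real.rpow_le_rpow_of_exponent_le (by norm_num) (by norm_num)
      _ = 4 := by norm_num
  have h3 : (max ‖x‖ ‖y‖) ^ (4 / 3 : ℝ) ≤ ‖x‖ ^ (4 / 3 : ℝ) + ‖y‖ ^ (4 / 3 : ℝ) := by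
    rcases max_choice ‖x‖ ‖y‖ with h | h <;> rw [h]
    · exact le_add_of_nonneg_right (by positivity)
    · exact le_add_of_nonneg_left (by positivity)
  calc ‖x + y‖ ^ (4 / 3 : ℝ) ≤ (2 * max ‖x‖ ‖y‖) ^ (4 / 3 : ℝ) :=
        Real.rpow_le_rpow (norm_nonneg _) h1 (by norm_num)
    _ = 2 ^ (4 / 3 : ℝ) * (max ‖x‖ ‖y‖) ^ (4 / 3 : ℝ) :=
        Real.mul_rpow (by norm_num) (by positivity)
    _ ≤ _ := by gcongr

/-- Moving the centre of a weight. -/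
lemma weight_sub_le {c : ℝ} (hc : 0 ≤ c) (x y : E d) :
    weight c (x - y) ≤ Real.exp (c * ‖x‖ ^ (4 / 3 : ℝ)) * weight (c / 4) y := by
  rw [weight, weight, ← Real.exp_add]
  apply Real.exp_le_exp.2
  have h := rpow_norm_add_le x (y - x)
  rw [add_sub_cancel, norm_sub_rev y x] at h
  nlinarith

lemma fderiv_green_pow_four {l : ℝ} (hl : 0 < l) (x : E d) :
    fderiv ℝ (green d (l ^ 4)) x = (l ^ (d + 1))⁻¹ • fderiv ℝ (green d 1) (l⁻¹ • x) := by
  have h0 : green d (l ^ 4) = fun x => (l ^ d)⁻¹ * green d 1 (l⁻¹ • x) :=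
    funext (green_pow_four hl)
  have h1 : HasFDerivAt (fun x : E d => l⁻¹ • x) (l⁻¹ • ContinuousLinearMap.id ℝ (E d)) x :=
    (hasFDerivAt_id x).const_smul l⁻¹
  have h2 := ((differentiable_green (d := d) one_pos (l⁻¹ • x)).hasFDerivAt.comp x h1).const_mul
    (l ^ d)⁻¹
  have h3 : HasFDerivAt (green d (l ^ 4)) ((l ^ d)⁻¹ • (fderiv ℝ (green d 1) (l⁻¹ • x)).comp
    (l⁻¹ • ContinuousLinearMap.id ℝ (E d))) x := h0 ▸ h2
  rw [h3.fderiv]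
  ext v
  simp only [smul_apply, ContinuousLinearMap.comp_apply, ContinuousLinearMap.id_apply, map_smul,
    smul_eq_mul, pow_succ]
  field_simp

/-- Exponential decay of the kernel, locally uniformly in time. -/
lemma exists_kernel_le_weight (d : ℕ) {a b : ℝ} (ha : 0 < a) :
    ∃ C c : ℝ, 0 < C ∧ 0 < c ∧ ∀ l ∈ Icc a b, ∀ x : E d,
      |green d (l ^ 4) x| ≤ C * weight c x ∧ ‖fderiv ℝ (green d (l ^ 4)) x‖ ≤ C * weight c x := by
  obtain ⟨C, c, hC, hc, h⟩ := exists_norm_fderiv_green_one_le d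
  have hb : 0 < max a b := ha.trans_le (le_max_left _ _)
  refine ⟨((a ^ d)⁻¹ + (a ^ (d + 1))⁻¹) * C, c * ((max a b)⁻¹) ^ (4 / 3 : ℝ), by positivity,
    by positivity, fun l hl x => ?_⟩
  have hl0 : 0 < l := ha.trans_le hl.1
  have hw : Real.exp (-c * ‖l⁻¹ • x‖ ^ (4 / 3 : ℝ)) ≤
      weight (c * ((max a b)⁻¹) ^ (4 / 3 : ℝ)) x := by
    apply Real.exp_le_exp.2
    rw [norm_smul, Real.norm_of_nonneg (by positivity), Real.mul_rpow (by positivity)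
      (norm_nonneg x), neg_mul, neg_mul, ← mul_assoc]
    have : ((max a b)⁻¹) ^ (4 / 3 : ℝ) ≤ (l⁻¹) ^ (4 / 3 : ℝ) :=
      Real.rpow_le_rpow (by positivity) (inv_anti₀ hl0 (hl.2.trans (le_max_right _ _)))
        (by norm_num)
    gcongr
  obtain ⟨h1, h2⟩ := h (l⁻¹ • x)
  have i1 : (l ^ d)⁻¹ ≤ (a ^ d)⁻¹ := inv_anti₀ (by positivity) (by gcongr; exact hl.1)
  have i2 : (l ^ (d + 1))⁻¹ ≤ (a ^ (d + 1))⁻¹ := inv_anti₀ (by positivity) (by gcongr; exact hl.1)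
  have j1 : 0 < (a ^ d)⁻¹ := by positivity
  have j2 : 0 < (a ^ (d + 1))⁻¹ := by positivity
  constructor
  · rw [green_pow_four hl0, abs_mul, abs_of_pos (by positivity), mul_assoc]
    exact mul_le_mul (i1.trans (by linarith)) (h1.trans (by gcongr)) (abs_nonneg _) (by positivity)
  · rw [fderiv_green_pow_four hl0, norm_smul, Real.norm_of_nonneg (by positivity), mul_assoc]
    exact mul_le_mul (i2.trans (by linarith)) (h2.trans (by gcongr)) (norm_nonneg _) (by positivity)

/-- `k` is integrable against every weight `exp (-c |x|^{4/3})`. -/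
def WeightIntegrable (k : E d → ℝ) : Prop := ∀ c : ℝ, 0 < c → Integrable fun y => weight c y * k y

lemma WeightIntegrable.aestronglyMeasurable {k : E d → ℝ} (hk : WeightIntegrable k) :
    AEStronglyMeasurable k := by
  have h := (hk 1 one_pos).aestronglyMeasurable
  have h2 := ((continuous_weight (d := d) 1).inv₀
    fun x => (weight_pos 1 x).ne').aestronglyMeasurable (μ := volume) |>.mul h
  refine h2.congr (Filter.Eventually.of_forall fun x => ?_)
  simp only [Pi.mul_apply]
  exact inv_mul_cancel_left₀ (weight_pos 1 x).ne' _

/-! ### From absolute convergence to weighted integrability. -/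

lemma HasExtension.integrable {k : E d → ℝ} (hk : HasExtension k) {t : ℝ} (ht : 0 < t) (x : E d) :
    Integrable fun y => green d t (x - y) * k y :=
  (hk t ht x).integrable_swap

/-- Near `x₀` the kernel `G(1, x₀ - ·)` is bounded below by a positive constant, so the convergent
integrand at `x₀` can be divided by it. -/
lemma HasExtension.locallyIntegrable {k : E d → ℝ} (hk : HasExtension k) : LocallyIntegrable k := by
  have hg0 : 0 < green d 1 (0 : E d) := green_zero_pos one_pos
  obtain ⟨δ, hδ, hball⟩ : ∃ δ > 0, ∀ x : E d, ‖x‖ < δ → green d 1 0 / 2 < green d 1 x := by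
    have hc := (differentiable_green (d := d) one_pos).continuous.tendsto 0
    have := hc.eventually (lt_mem_nhds (half_lt_self hg0))
    obtain ⟨δ, hδ, h⟩ := Metric.eventually_nhds_iff.1 this
    exact ⟨δ, hδ, fun x hx => h (by simpa using hx)⟩
  intro x₀
  refine ⟨Metric.ball x₀ δ, Metric.ball_mem_nhds x₀ hδ, ?_⟩
  have hint := (hk.integrable one_pos x₀).integrableOn (s := Metric.ball x₀ δ)
  have hcont := (differentiable_green (d := d) one_pos).continuous
  have hmeas : AEStronglyMeasurable (fun y => (green d 1 (x₀ - y))⁻¹)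
      (volume.restrict (Metric.ball x₀ δ)) :=
    ((hcont.comp (continuous_const.sub continuous_id)).measurable.inv).aestronglyMeasurable
  have hlow : ∀ y ∈ Metric.ball x₀ δ, green d 1 0 / 2 < green d 1 (x₀ - y) := fun y hy =>
    hball _ (by rwa [← dist_eq_norm, dist_comm])
  have h := hint.bdd_mul (c := (green d 1 (0 : E d) / 2)⁻¹) hmeas
    ((ae_restrict_iff' measurableSet_ball).2 (Filter.Eventually.of_forall fun y hy => by
      rw [norm_inv, Real.norm_of_nonneg ((half_pos hg0).trans (hlow y hy)).le]
      exact inv_anti₀ (half_pos hg0) (hlow y hy).le))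
  refine IntegrableOn.congr_fun h (fun y hy => ?_) measurableSet_ball
  exact inv_mul_cancel_left₀ ((half_pos hg0).trans (hlow y hy)).ne' _

/-- The absolute convergence of the convolutions forces a uniform bound on some ball. -/
lemma HasExtension.exists_ball_bound {k : E d → ℝ} (hk : HasExtension k) {t : ℝ} (ht : 0 < t) :
    ∃ (x₀ : E d) (ε : ℝ) (n : ℕ), 0 < ε ∧ ∀ x ∈ Metric.ball x₀ ε,
      ∫⁻ y, ‖green d t (x - y)‖ₑ * ‖k y‖ₑ ≤ n := by
  have hcont := (differentiable_green (d := d) ht).continuous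
  have hkm := hk.locallyIntegrable.aestronglyMeasurable
  set F : E d → ℝ≥0∞ := fun x => ∫⁻ y, ‖green d t (x - y)‖ₑ * ‖k y‖ₑ
  have hfin : ∀ x, F x < ∞ := fun x => by
    have := (hk.integrable ht x).hasFiniteIntegral
    simpa only [HasFiniteIntegral, enorm_mul] using this
  -- By Fatou, `F` is lower semicontinuous. Its closed sublevel sets cover the space, so Baire's
  -- theorem gives one of them an interior point.
  have hclosed : ∀ n : ℕ, IsClosed {x | F x ≤ n} := by
    intro n
    refine IsSeqClosed.isClosed fun u x hu hux => ?_
    have hlim : ∀ y, Filter.liminf (fun i => ‖green d t (u i - y)‖ₑ * ‖k y‖ₑ) Filter.atTop =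
        ‖green d t (x - y)‖ₑ * ‖k y‖ₑ := by
      intro y
      refine Filter.Tendsto.liminf_eq (ENNReal.Tendsto.mul_const ?_ (Or.inr enorm_ne_top))
      exact (continuous_enorm.comp (hcont.comp (continuous_id.sub continuous_const))).tendsto x
        |>.comp hux
    calc F x = ∫⁻ y, Filter.liminf (fun i => ‖green d t (u i - y)‖ₑ * ‖k y‖ₑ) Filter.atTop := by
          simp only [hlim, F]
      _ ≤ Filter.liminf (fun i => F (u i)) Filter.atTop :=
          lintegral_liminf_le' fun i => ((hcont.comp
            (continuous_const.sub continuous_id)).enorm.aemeasurable).mul hkm.enorm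
      _ ≤ Filter.liminf (fun _ : ℕ => (n : ℝ≥0∞)) Filter.atTop :=
          Filter.liminf_le_liminf (Filter.Eventually.of_forall hu)
      _ = n := Filter.liminf_const _
  have hunion : ⋃ n : ℕ, {x | F x ≤ n} = univ := by
    refine eq_univ_of_forall fun x => mem_iUnion.2 ?_
    obtain ⟨n, hn⟩ := ENNReal.exists_nat_gt (hfin x).ne
    exact ⟨n, hn.le⟩
  obtain ⟨n, x₀, hx₀⟩ := nonempty_interior_of_iUnion_of_closed hclosed hunion
  obtain ⟨ε, hε, hsub⟩ := Metric.isOpen_iff.1 isOpen_interior x₀ hx₀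
  exact ⟨x₀, ε, n, hε, fun x hx => (interior_subset (hsub hx) : x ∈ {x | F x ≤ n})⟩

/-- If all the convolutions with the kernels converge absolutely, then `k` grows slower than
`exp (c |x|^{4/3})` for every `c > 0`, in the mean. -/
lemma HasExtension.weightIntegrable (hd : 1 ≤ d) {k : E d → ℝ} (hk : HasExtension k) :
    WeightIntegrable k := by
  intro c hc
  have hkl := hk.locallyIntegrable
  have hkm := hkl.aestronglyMeasurable
  obtain ⟨K, hK, hlow⟩ := exists_le_lintegral_green hd
  -- At a late time `l⁴` the lower bound of the kernel decays slower than the given weight; the `4`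
  -- is the loss in `rpow_norm_add_le` from recentring at `x₀`.
  obtain ⟨l, hl, hlK⟩ : ∃ l : ℝ, 0 < l ∧ 4 * (K * (l⁻¹) ^ (4 / 3 : ℝ)) ≤ c := by
    refine ⟨((c / (4 * K)) ^ (3 / 4 : ℝ))⁻¹, by positivity, le_of_eq ?_⟩
    rw [inv_inv, ← Real.rpow_mul (by positivity)]
    norm_num
    field_simp
  have hl4 : 0 < l ^ 4 := pow_pos hl 4
  obtain ⟨x₀, ε, n, hε, hF⟩ := hk.exists_ball_bound hl4
  obtain ⟨c₀, hc₀, hmass⟩ := hlow l hl ε hε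
  have hcont := (differentiable_green (d := d) hl4).continuous
  -- Integrating the uniform bound over `x` in the ball and exchanging the integrals replaces the
  -- kernel, which may vanish at points, by its mass on small balls.
  have hfin : ∫⁻ y, ‖k y‖ₑ * ∫⁻ w in Metric.ball (x₀ - y) ε, ‖green d (l ^ 4) w‖ₑ < ∞ := by
    have h1 : ∀ y, ∫⁻ w in Metric.ball (x₀ - y) ε, ‖green d (l ^ 4) w‖ₑ =
        ∫⁻ x in Metric.ball x₀ ε, ‖green d (l ^ 4) (x - y)‖ₑ := by
      intro y
      have hmp := (measurePreserving_sub_right (volume : Measure (E d)) y)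
      have := hmp.setLIntegral_comp_preimage (s := Metric.ball (x₀ - y) ε) measurableSet_ball
        (f := fun w => ‖green d (l ^ 4) w‖ₑ) hcont.enorm.measurable
      rw [← this]
      congr 2
      ext x
      simp [dist_eq_norm, sub_sub_sub_cancel_right]
    simp only [h1]
    have h2 : ∀ y, ‖k y‖ₑ * ∫⁻ x in Metric.ball x₀ ε, ‖green d (l ^ 4) (x - y)‖ₑ =
        ∫⁻ x in Metric.ball x₀ ε, ‖green d (l ^ 4) (x - y)‖ₑ * ‖k y‖ₑ := by
      intro y
      rw [lintegral_mul_const' _ _ enorm_ne_top, mul_comm]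
    simp only [h2]
    rw [lintegral_lintegral_swap]
    · calc ∫⁻ x in Metric.ball x₀ ε, ∫⁻ y, ‖green d (l ^ 4) (x - y)‖ₑ * ‖k y‖ₑ
          ≤ ∫⁻ _ in Metric.ball x₀ ε, (n : ℝ≥0∞) := setLIntegral_mono' measurableSet_ball hF
        _ = n * volume (Metric.ball x₀ ε) := setLIntegral_const _ _
        _ < ∞ := ENNReal.mul_lt_top (ENNReal.natCast_lt_top n) measure_ball_lt_top
    · exact ((hcont.comp (continuous_snd.sub continuous_fst)).enorm.aemeasurable).mul
        (hkm.comp_fst.enorm)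
  refine ⟨(continuous_weight c).aestronglyMeasurable.mul hkm, ?_⟩
  -- The mass bound needs distance at least `l` from `x₀`; on the remaining ball local integrability
  -- suffices.
  rw [HasFiniteIntegral, ← lintegral_add_compl _ (measurableSet_ball (x := x₀) (ε := l))]
  refine ENNReal.add_lt_top.2 ⟨?_, ?_⟩
  · refine lt_of_le_of_lt (lintegral_mono fun y => ?_)
      ((hkl.integrableOn_isCompact (isCompact_closedBall x₀ l)).mono_set
        Metric.ball_subset_closedBall).hasFiniteIntegral
    rw [enorm_mul]
    refine mul_le_of_le_one_left zero_le ?_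
    rw [← ofReal_norm, Real.norm_of_nonneg (weight_pos c y).le]
    exact ENNReal.ofReal_le_one.2 (weight_le_one hc.le y)
  · set C := c₀⁻¹ * Real.exp (c * ‖x₀‖ ^ (4 / 3 : ℝ))
    have hC : 0 ≤ C := by positivity
    have hb : ∀ y ∈ (Metric.ball x₀ l)ᶜ, ‖weight c y * k y‖ₑ ≤ ENNReal.ofReal C *
        (‖k y‖ₑ * ∫⁻ w in Metric.ball (x₀ - y) ε, ‖green d (l ^ 4) w‖ₑ) := by
      intro y hy
      have hy' : l ≤ ‖x₀ - y‖ := by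
        rw [← dist_eq_norm, dist_comm]; simpa using hy
      have h1 : weight c y ≤ C * (c₀ * Real.exp (-K * (‖x₀ - y‖ / l) ^ (4 / 3 : ℝ))) := by
        have e1 : C * (c₀ * Real.exp (-K * (‖x₀ - y‖ / l) ^ (4 / 3 : ℝ))) =
            Real.exp (c * ‖x₀‖ ^ (4 / 3 : ℝ) + -K * (‖x₀ - y‖ / l) ^ (4 / 3 : ℝ)) := by
          rw [Real.exp_add]; simp only [C]; field_simp
        rw [e1, weight]
        apply Real.exp_le_exp.2
        have h2 := rpow_norm_add_le x₀ (-y)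
        rw [← sub_eq_add_neg, norm_neg] at h2
        have h3 : K * (‖x₀ - y‖ / l) ^ (4 / 3 : ℝ) ≤
            c * (‖x₀‖ ^ (4 / 3 : ℝ) + ‖y‖ ^ (4 / 3 : ℝ)) := by
          rw [div_eq_mul_inv, Real.mul_rpow (norm_nonneg _) (by positivity)]
          calc K * (‖x₀ - y‖ ^ (4 / 3 : ℝ) * (l⁻¹) ^ (4 / 3 : ℝ))
              = K * (l⁻¹) ^ (4 / 3 : ℝ) * ‖x₀ - y‖ ^ (4 / 3 : ℝ) := by ring
            _ ≤ K * (l⁻¹) ^ (4 / 3 : ℝ) * (4 * (‖x₀‖ ^ (4 / 3 : ℝ) + ‖y‖ ^ (4 / 3 : ℝ))) := by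
                gcongr
            _ = 4 * (K * (l⁻¹) ^ (4 / 3 : ℝ)) * (‖x₀‖ ^ (4 / 3 : ℝ) + ‖y‖ ^ (4 / 3 : ℝ)) := by ring
            _ ≤ _ := by gcongr
        linarith
      rw [enorm_mul, mul_left_comm, mul_comm]
      refine mul_le_mul_right ?_ _
      rw [← ofReal_norm, Real.norm_of_nonneg (weight_pos c y).le]
      refine (ENNReal.ofReal_le_ofReal h1).trans ?_
      rw [ENNReal.ofReal_mul hC]
      exact mul_le_mul_right (hmass _ hy') _
    calc _ ≤ ∫⁻ y in (Metric.ball x₀ l)ᶜ, ENNReal.ofReal C *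
          (‖k y‖ₑ * ∫⁻ w in Metric.ball (x₀ - y) ε, ‖green d (l ^ 4) w‖ₑ) :=
          setLIntegral_mono' measurableSet_ball.compl hb
      _ ≤ ∫⁻ y, ENNReal.ofReal C *
          (‖k y‖ₑ * ∫⁻ w in Metric.ball (x₀ - y) ε, ‖green d (l ^ 4) w‖ₑ) :=
          setLIntegral_le_lintegral _ _
      _ = ENNReal.ofReal C * ∫⁻ y, 
          (‖k y‖ₑ * ∫⁻ w in Metric.ball (x₀ - y) ε, ‖green d (l ^ 4) w‖ₑ) :=
          lintegral_const_mul' _ _ ENNReal.ofReal_ne_top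
      _ < ∞ := ENNReal.mul_lt_top ENNReal.ofReal_lt_top hfin

end

section

variable {d : ℕ}

/-! ### Regularity of the bi-caloric extension -/

lemma rpow_quarter_pow_four {t : ℝ} (ht : 0 ≤ t) : (t ^ (1 / 4 : ℝ)) ^ 4 = t := by
  rw [← Real.rpow_natCast, ← Real.rpow_mul ht]; norm_num

lemma exists_kernel_le_weight_time (d : ℕ) {a b : ℝ} (ha : 0 < a) :
    ∃ C c : ℝ, 0 < C ∧ 0 < c ∧ ∀ t ∈ Icc a b, ∀ x : E d,
      |green d t x| ≤ C * weight c x ∧ ‖fderiv ℝ (green d t) x‖ ≤ C * weight c x := by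
  obtain ⟨C, c, hC, hc, h⟩ := exists_kernel_le_weight d (a := a ^ (1 / 4 : ℝ))
    (b := b ^ (1 / 4 : ℝ)) (by positivity)
  refine ⟨C, c, hC, hc, fun t ht x => ?_⟩
  have := h (t ^ (1 / 4 : ℝ)) ⟨Real.rpow_le_rpow ha.le ht.1 (by norm_num),
    Real.rpow_le_rpow (ha.le.trans ht.1) ht.2 (by norm_num)⟩ x
  rwa [rpow_quarter_pow_four (ha.le.trans ht.1)] at this

lemma WeightIntegrable.integrable_green {k : E d → ℝ} (hk : WeightIntegrable k) {t : ℝ}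
    (ht : 0 < t) (x : E d) : Integrable fun y => green d t (x - y) * k y := by
  obtain ⟨C, c, hC, hc, h⟩ := exists_kernel_le_weight_time d (a := t) (b := t) ht
  refine (((hk (c / 4) (by positivity)).norm.const_mul
    (C * Real.exp (c * ‖x‖ ^ (4 / 3 : ℝ))))).mono'
    (((differentiable_green ht).continuous.comp
      (continuous_const.sub continuous_id)).aestronglyMeasurable.mul hk.aestronglyMeasurable)
    (Filter.Eventually.of_forall fun y => ?_)
  rw [norm_mul, norm_mul, Real.norm_eq_abs, Real.norm_of_nonneg (weight_pos _ _).le,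
    ← mul_assoc, mul_assoc C]
  gcongr
  exact ((h t ⟨le_rfl, le_rfl⟩ (x - y)).1).trans
    (mul_le_mul_of_nonneg_left (weight_sub_le hc.le x y) hC.le)

lemma WeightIntegrable.hasExtension {k : E d → ℝ} (hk : WeightIntegrable k) : HasExtension k :=
  fun _ ht x => convolutionExistsAt_iff_integrable_swap.2 (hk.integrable_green ht x)

lemma extension_apply (k : E d → ℝ) (t : ℝ) (x : E d) :
    extension k t x = ∫ y, green d t (x - y) * k y := by
  rw [extension, convolution_eq_swap]
  rfl

/-- The domination of the differentiated integrand, locally uniformly in time and space. -/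
lemma WeightIntegrable.exists_bound {k : E d → ℝ} (hk : WeightIntegrable k) {a b : ℝ} (ha : 0 < a)
    (R : ℝ) : ∃ B : E d → ℝ, Integrable B ∧ ∀ t ∈ Icc a b, ∀ x : E d, ‖x‖ ≤ R → ∀ y,
      ‖k y • fderiv ℝ (green d t) (x - y)‖ ≤ B y := by
  obtain ⟨C, c, hC, hc, h⟩ := exists_kernel_le_weight_time d (a := a) (b := b) ha
  refine ⟨_, ((hk (c / 4) (by positivity)).norm.const_mul
    (C * Real.exp (c * R ^ (4 / 3 : ℝ)))), fun t ht x hx y => ?_⟩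
  rw [norm_smul, norm_mul, Real.norm_of_nonneg (weight_pos _ _).le, mul_comm ‖k y‖, ← mul_assoc,
    mul_assoc C]
  gcongr
  refine ((h t ht (x - y)).2).trans (mul_le_mul_of_nonneg_left ((weight_sub_le hc.le x y).trans
    (mul_le_mul_of_nonneg_right ?_ (weight_pos _ _).le)) hC.le)
  exact Real.exp_le_exp.2 (mul_le_mul_of_nonneg_left
    (Real.rpow_le_rpow (norm_nonneg x) hx (by norm_num)) hc.le)

lemma WeightIntegrable.aestronglyMeasurable_smul_fderiv {k : E d → ℝ} (hk : WeightIntegrable k)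
    {t : ℝ} (ht : 0 < t) (x : E d) :
    AEStronglyMeasurable (fun y => k y • fderiv ℝ (green d t) (x - y)) :=
  hk.aestronglyMeasurable.smul ((continuous_fderiv_green ht).comp
    (continuous_const.sub continuous_id)).aestronglyMeasurable

lemma WeightIntegrable.hasFDerivAt_extension {k : E d → ℝ} (hk : WeightIntegrable k) {t : ℝ}
    (ht : 0 < t) (x : E d) :
    HasFDerivAt (extension k t) (∫ y, k y • fderiv ℝ (green d t) (x - y)) x := by
  have h0 : extension k t = fun x => ∫ y, green d t (x - y) * k y :=
    funext (extension_apply k t)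
  rw [h0]
  obtain ⟨B, hB, hbound⟩ := hk.exists_bound (a := t) (b := t) ht (‖x‖ + 1)
  refine hasFDerivAt_integral_of_dominated_of_fderiv_le (𝕜 := ℝ) (μ := volume)
    (F := fun x y => green d t (x - y) * k y)
    (F' := fun x y => k y • fderiv ℝ (green d t) (x - y)) (bound := B)
    (Metric.ball_mem_nhds x one_pos) ?_ (hk.integrable_green ht x)
    (hk.aestronglyMeasurable_smul_fderiv ht x) ?_ hB ?_
  · exact Filter.Eventually.of_forall fun z => (hk.integrable_green ht z).aestronglyMeasurable
  · refine Filter.Eventually.of_forall fun y z hz => hbound t ⟨le_rfl, le_rfl⟩ z ?_ y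
    have h1 : ‖z - x‖ < 1 := by rwa [← dist_eq_norm]
    linarith [norm_le_norm_add_norm_sub' z x]
  · refine Filter.Eventually.of_forall fun y z _ => ?_
    have h1 : HasFDerivAt (fun z => green d t (z - y)) (fderiv ℝ (green d t) (z - y)) z :=
      (hasFDerivAt_comp_sub y).2 (differentiable_green ht (z - y)).hasFDerivAt
    exact h1.mul_const (k y)

lemma WeightIntegrable.fderiv_extension {k : E d → ℝ} (hk : WeightIntegrable k) {t : ℝ}
    (ht : 0 < t) (x : E d) :
    fderiv ℝ (extension k t) x = ∫ y, k y • fderiv ℝ (green d t) (x - y) :=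
  (hk.hasFDerivAt_extension ht x).fderiv

lemma continuousOn_fderiv_green_time :
    ContinuousOn (fun p : ℝ × E d => fderiv ℝ (green d p.1) p.2) (Ioi 0 ×ˢ univ) := by
  have h : ContinuousOn (fun p : ℝ × E d => (((p.1 ^ (1 / 4 : ℝ)) ^ (d + 1))⁻¹ : ℝ) •
      fderiv ℝ (green d 1) ((p.1 ^ (1 / 4 : ℝ))⁻¹ • p.2)) (Ioi 0 ×ˢ univ) := by
    have h1 : ContinuousOn (fun p : ℝ × E d => p.1 ^ (1 / 4 : ℝ)) (Ioi 0 ×ˢ univ) :=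
      continuousOn_fst.rpow_const fun p hp => Or.inl (ne_of_gt hp.1)
    have h2 : ∀ p ∈ (Ioi 0 ×ˢ univ : Set (ℝ × E d)), p.1 ^ (1 / 4 : ℝ) ≠ 0 := fun p hp =>
      (Real.rpow_pos_of_pos hp.1 _).ne'
    exact ((h1.pow _).inv₀ fun p hp => pow_ne_zero _ (h2 p hp)).smul
      ((continuous_fderiv_green one_pos).comp_continuousOn ((h1.inv₀ h2).smul continuousOn_snd))
  refine h.congr fun p hp => ?_
  have := fderiv_green_pow_four (Real.rpow_pos_of_pos hp.1 (1 / 4)) p.2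
  rwa [rpow_quarter_pow_four (le_of_lt hp.1)] at this

/-- Joint continuity provides the measurability in `(t, x)` for Tonelli and the local square
integrability required by `MemB0`. -/
lemma WeightIntegrable.continuousOn_fderiv_extension {k : E d → ℝ} (hk : WeightIntegrable k) :
    ContinuousOn (fun p : ℝ × E d => fderiv ℝ (extension k p.1) p.2) (Ioi 0 ×ˢ univ) := by
  have hopen : IsOpen (Ioi 0 ×ˢ univ : Set (ℝ × E d)) := isOpen_Ioi.prod isOpen_univ
  have h : ContinuousOn (fun p : ℝ × E d => ∫ y, k y • fderiv ℝ (green d p.1) (p.2 - y))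
      (Ioi 0 ×ˢ univ) := by
    rintro ⟨t, x⟩ hp
    have ht : 0 < t := hp.1
    obtain ⟨B, hB, hbound⟩ := hk.exists_bound (a := t / 2) (b := 2 * t) (by positivity) (‖x‖ + 1)
    have hnear : ∀ᶠ p : ℝ × E d in nhds (t, x), p.1 ∈ Icc (t / 2) (2 * t) ∧ ‖p.2‖ ≤ ‖x‖ + 1 := by
      refine Filter.Eventually.and (continuousAt_fst.eventually
        (Icc_mem_nhds (by simp only; linarith) (by simp only; linarith))) ?_
      filter_upwards [continuousAt_snd.eventually (Metric.ball_mem_nhds x one_pos)] with p hp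
      have h1 : ‖p.2 - x‖ < 1 := by rwa [← dist_eq_norm]
      linarith [norm_le_norm_add_norm_sub' p.2 x]
    refine (continuousAt_of_dominated (bound := B) ?_ ?_ hB ?_).continuousWithinAt
    · filter_upwards [hnear] with p hp
      exact hk.aestronglyMeasurable_smul_fderiv (by linarith [hp.1.1]) p.2
    · filter_upwards [hnear] with p hp
      exact Filter.Eventually.of_forall fun y => hbound p.1 hp.1 p.2 hp.2 y
    · refine Filter.Eventually.of_forall fun y => ContinuousAt.const_smul ?_ (k y)
      have h1 : ContinuousAt (fun p : ℝ × E d => fderiv ℝ (green d p.1) p.2) (t, x - y) :=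
        continuousOn_fderiv_green_time.continuousAt (hopen.mem_nhds ⟨ht, mem_univ _⟩)
      exact ContinuousAt.comp (f := fun p : ℝ × E d => (p.1, p.2 - y)) (x := (t, x)) h1
        (by fun_prop)
  exact h.congr fun p hp => hk.fderiv_extension hp.1 p.2

lemma exists_weight_le_pow {c : ℝ} (hc : 0 < c) (n : ℕ) :
    ∃ C : ℝ, 0 < C ∧ ∀ x : E d, weight c x ≤ C * ((1 + ‖x‖) ^ n)⁻¹ := by
  refine ⟨Real.exp (2 * c) * n.factorial * (c ^ n)⁻¹, by positivity, fun x => ?_⟩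
  have h1 : ‖x‖ ≤ 1 + ‖x‖ ^ (4 / 3 : ℝ) := by
    rcases le_total ‖x‖ 1 with h | h
    · exact h.trans (le_add_of_nonneg_right (by positivity))
    · have := Real.rpow_le_rpow_of_exponent_le h (by norm_num : (1 : ℝ) ≤ 4 / 3)
      rw [Real.rpow_one] at this
      linarith
  have h2 : weight c x ≤ Real.exp (2 * c) * Real.exp (-(c * (1 + ‖x‖))) := by
    rw [weight, ← Real.exp_add]
    exact Real.exp_le_exp.2 (by nlinarith)
  have h3 := Real.pow_div_factorial_le_exp (c * (1 + ‖x‖)) (by positivity) n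
  have h4 : Real.exp (-(c * (1 + ‖x‖))) ≤ ((c * (1 + ‖x‖)) ^ n / n.factorial)⁻¹ := by
    rw [Real.exp_neg]
    exact inv_anti₀ (by positivity) h3
  refine h2.trans ((mul_le_mul_of_nonneg_left h4 (Real.exp_pos _).le).trans (le_of_eq ?_))
  rw [mul_pow]
  field_simp

lemma integrable_inv_one_add_norm_pow :
    Integrable fun x : E d => ((1 + ‖x‖) ^ (d + 1))⁻¹ := by
  have h := integrable_one_add_norm (E := E d) (μ := volume) (r := (d + 1 : ℕ))
    (by rw [finrank_euclideanSpace_fin]; exact_mod_cast Nat.lt_succ_self d)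
  refine h.congr (Filter.Eventually.of_forall fun x => ?_)
  simp only
  rw [Real.rpow_neg (by positivity), Real.rpow_natCast]

lemma integrable_weight {c : ℝ} (hc : 0 < c) : Integrable (weight c : E d → ℝ) := by
  obtain ⟨C, hC, h⟩ := exists_weight_le_pow (d := d) hc (d + 1)
  refine (integrable_inv_one_add_norm_pow.const_mul C).mono'
    (continuous_weight c).aestronglyMeasurable (Filter.Eventually.of_forall fun x => ?_)
  rw [Real.norm_of_nonneg (weight_pos c x).le]
  exact h x

/-- The semigroup property, differentiated. -/
lemma WeightIntegrable.fderiv_extension_add {k : E d → ℝ} (hk : WeightIntegrable k) {s t : ℝ}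
    (hs : 0 < s) (ht : 0 < t) (x : E d) :
    fderiv ℝ (extension k (s + t)) x =
      ∫ z, green d s z • fderiv ℝ (extension k t) (x - z) := by
  obtain ⟨C, c, hC, hc, h⟩ := exists_kernel_le_weight_time d (a := t) (b := t) ht
  obtain ⟨C', c', hC', hc', h'⟩ := exists_kernel_le_weight_time d (a := s) (b := s) hs
  -- Recentring the weight of the second kernel from `x - y - z` to `y` costs `exp (4 b |z|^{4/3})`.
  -- Since `4 b ≤ c' / 2`, half of the decay of the first kernel absorbs it, and the double
  -- integrand is dominated by a product.
  set b := min c (c' / 8)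
  have hb : 0 < b := by positivity
  have hint : Integrable (Function.uncurry fun (y z : E d) =>
      k y • green d s z • fderiv ℝ (green d t) (x - y - z)) (volume.prod volume) := by
    have hprod := ((hk (b / 4) (by positivity)).norm.mul_prod
      (integrable_weight (d := d) (c := c' / 2) (by positivity))).const_mul
      (C' * C * Real.exp (4 * b * ‖x‖ ^ (4 / 3 : ℝ)))
    refine hprod.mono' ?_ (Filter.Eventually.of_forall fun p => ?_)
    · refine hk.aestronglyMeasurable.comp_fst.smul (Continuous.aestronglyMeasurable ?_)
      exact ((differentiable_green hs).continuous.comp continuous_snd).smul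
        ((continuous_fderiv_green ht).comp
          ((continuous_const.sub continuous_fst).sub continuous_snd))
    · obtain ⟨y, z⟩ := p
      simp only [Function.uncurry_apply_pair]
      rw [norm_smul, norm_smul, norm_mul, Real.norm_of_nonneg (weight_pos _ _).le,
        Real.norm_eq_abs (green d s z)]
      have h1 := (h t ⟨le_rfl, le_rfl⟩ (x - y - z)).2
      have h2 := (h' s ⟨le_rfl, le_rfl⟩ z).1
      have h3 : weight c' z * weight c (x - y - z) ≤
          Real.exp (4 * b * ‖x‖ ^ (4 / 3 : ℝ)) * (weight (b / 4) y * weight (c' / 2) z) := by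
        refine (mul_le_mul_of_nonneg_left ((weight_anti (min_le_left c (c' / 8)) _).trans
          (sub_right_comm x y z ▸ weight_sub_le hb.le (x - z) y)) (weight_pos _ _).le).trans ?_
        have h4 := rpow_norm_add_le x (-z)
        rw [← sub_eq_add_neg, norm_neg] at h4
        have h5 : Real.exp (b * ‖x - z‖ ^ (4 / 3 : ℝ)) * weight c' z ≤
            Real.exp (4 * b * ‖x‖ ^ (4 / 3 : ℝ)) * weight (c' / 2) z := by
          rw [weight, weight, ← Real.exp_add, ← Real.exp_add]
          apply Real.exp_le_exp.2
          have h6 : b ≤ c' / 8 := min_le_right _ _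
          have h7 : 0 ≤ ‖z‖ ^ (4 / 3 : ℝ) := by positivity
          nlinarith [mul_le_mul_of_nonneg_left h4 hb.le, mul_le_mul_of_nonneg_right h6 h7]
        calc _ = (Real.exp (b * ‖x - z‖ ^ (4 / 3 : ℝ)) * weight c' z) * weight (b / 4) y := by ring
          _ ≤ (Real.exp (4 * b * ‖x‖ ^ (4 / 3 : ℝ)) * weight (c' / 2) z) * weight (b / 4) y :=
              mul_le_mul_of_nonneg_right h5 (weight_pos _ _).le
          _ = _ := by ring
      calc ‖k y‖ * (|green d s z| * ‖fderiv ℝ (green d t) (x - y - z)‖)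
          ≤ ‖k y‖ * ((C' * weight c' z) * (C * weight c (x - y - z))) :=
            mul_le_mul_of_nonneg_left (mul_le_mul h2 h1 (norm_nonneg _)
              (mul_nonneg hC'.le (weight_pos _ _).le)) (norm_nonneg _)
        _ = C' * C * ‖k y‖ * (weight c' z * weight c (x - y - z)) := by ring
        _ ≤ C' * C * ‖k y‖ * (Real.exp (4 * b * ‖x‖ ^ (4 / 3 : ℝ)) *
            (weight (b / 4) y * weight (c' / 2) z)) := by gcongr
        _ = _ := by ring
  calc fderiv ℝ (extension k (s + t)) x
      = ∫ y, ∫ z, k y • green d s z • fderiv ℝ (green d t) (x - y - z) := by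
        rw [hk.fderiv_extension (add_pos hs ht)]
        congr 1
        ext1 y
        rw [fderiv_green_convolution hs ht, integral_smul]
    _ = ∫ z, ∫ y, k y • green d s z • fderiv ℝ (green d t) (x - y - z) :=
        integral_integral_swap hint
    _ = _ := by
        congr 1
        ext1 z
        rw [hk.fderiv_extension ht, ← integral_smul]
        congr 1
        ext1 y
        rw [smul_comm, sub_right_comm]

end

section

variable {d : ℕ}

/-! ### The pointwise seminorm controls the square-mean seminorm -/

lemma enorm_gradient (f : E d → ℝ) (x : E d) : ‖gradient f x‖ₑ = ‖fderiv ℝ f x‖ₑ := by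
  rw [← ofReal_norm, ← ofReal_norm, gradient, LinearIsometryEquiv.norm_map]

lemma lintegral_rpow_neg_half {a : ℝ} (ha : 0 < a) :
    ∫⁻ t in Ioo 0 (a ^ 4), ENNReal.ofReal (t ^ (-(1 / 2) : ℝ)) = ENNReal.ofReal (2 * a ^ 2) := by
  have hi : IntegrableOn (fun t : ℝ => t ^ (-(1 / 2) : ℝ)) (Ioo 0 (a ^ 4)) := by
    have := intervalIntegral.intervalIntegrable_rpow' (a := 0) (b := a ^ 4)
      (r := -(1 / 2)) (by norm_num)
    rw [intervalIntegrable_iff_integrableOn_Ioo_of_le (by positivity)] at this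
    exact this
  rw [← ofReal_integral_eq_lintegral_ofReal hi
    ((ae_restrict_iff' measurableSet_Ioo).2 (Filter.Eventually.of_forall fun t ht =>
      Real.rpow_nonneg ht.1.le _)), ← integral_Ioc_eq_integral_Ioo,
    ← intervalIntegral.integral_of_le (by positivity), integral_rpow (Or.inl (by norm_num))]
  congr 1
  have h1 : (a ^ 4) ^ (-(1 / 2) + 1 : ℝ) = a ^ 2 := by
    rw [← Real.rpow_natCast, ← Real.rpow_mul ha.le, ← Real.rpow_natCast]
    norm_num
  rw [h1, Real.zero_rpow (by norm_num)]
  ring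

lemma volume_ball_eq (x : E d) {r : ℝ} (hr : 0 < r) :
    volume (Metric.ball x r) = ENNReal.ofReal (r ^ d) * volume (Metric.ball (0 : E d) 1) := by
  rw [Measure.addHaar_ball_of_pos volume x hr, finrank_euclideanSpace_fin]

/-- The pointwise bound gives `|∇h|² ≤ N² t^{-1/2}`. Its time integral up to `r⁴` is `2 r² N²`, and
the ball contributes `r^d` times the unit volume. Only times up to `r⁴` enter, which also serves the
localised seminorms. -/
lemma energy_le (h : ℝ → E d → ℝ) (x : E d) {r : ℝ} (hr : 0 < r) {N : ℝ≥0∞}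
    (hN : ∀ t, 0 < t → t ≤ r ^ 4 → weightedGrad h t ≤ N) :
    energy h x r ≤ 2 * volume (Metric.ball (0 : E d) 1) * N ^ 2 := by
  have hslice : ∀ t ∈ Ioo 0 (r ^ 4), ∫⁻ y in Metric.ball x r, ‖gradient (h t) y‖ₑ ^ 2 ≤
      N ^ 2 * volume (Metric.ball x r) * ENNReal.ofReal (t ^ (-(1 / 2) : ℝ)) := by
    intro t ht
    have ht0 : 0 < t := ht.1
    have hpos : 0 < t ^ (1 / 4 : ℝ) := Real.rpow_pos_of_pos ht0 _
    have h1 : eLpNorm (fun x => gradient (h t) x) ∞ volume ≤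
        N * ENNReal.ofReal (t ^ (-(1 / 4) : ℝ)) := by
      have h2 := hN t ht0 ht.2.le
      rw [weightedGrad, mul_comm] at h2
      rw [Real.rpow_neg ht0.le, ENNReal.ofReal_inv_of_pos hpos, ← div_eq_mul_inv]
      exact (ENNReal.le_div_iff_mul_le (Or.inl (ENNReal.ofReal_pos.2 hpos).ne')
        (Or.inl ENNReal.ofReal_ne_top)).2 h2
    have h3 : ∀ᵐ y ∂(volume : Measure (E d)), ‖gradient (h t) y‖ₑ ^ 2 ≤
        N ^ 2 * ENNReal.ofReal (t ^ (-(1 / 2) : ℝ)) := by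
      have h4 := ae_le_eLpNormEssSup (f := fun x => gradient (h t) x) (μ := volume)
      filter_upwards [h4] with y hy
      rw [← eLpNorm_exponent_top] at hy
      refine (pow_le_pow_left' (hy.trans h1) 2).trans (le_of_eq ?_)
      rw [mul_pow, ← ENNReal.ofReal_pow (by positivity), ← Real.rpow_natCast,
        ← Real.rpow_mul ht0.le]
      norm_num
    calc _ ≤ ∫⁻ _ in Metric.ball x r, N ^ 2 * ENNReal.ofReal (t ^ (-(1 / 2) : ℝ)) :=
          lintegral_mono_ae (ae_restrict_of_ae h3)
      _ = _ := by rw [setLIntegral_const]; ring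
  rw [energy]
  refine ENNReal.div_le_of_le_mul ?_
  calc _ ≤ ∫⁻ t in Ioo 0 (r ^ 4),
        N ^ 2 * volume (Metric.ball x r) * ENNReal.ofReal (t ^ (-(1 / 2) : ℝ)) :=
        setLIntegral_mono' measurableSet_Ioo hslice
    _ = N ^ 2 * volume (Metric.ball x r) * ENNReal.ofReal (2 * r ^ 2) := by
        rw [lintegral_const_mul _ (by fun_prop), lintegral_rpow_neg_half hr]
    _ = _ := by
        rw [volume_ball_eq x hr, ENNReal.ofReal_mul (by norm_num), pow_add,
          ENNReal.ofReal_mul (by positivity), ENNReal.ofReal_ofNat]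
        ring

/-- The constant in the upper bound. -/
def upperConst (d : ℕ) : ℝ≥0∞ := (2 * volume (Metric.ball (0 : E d) 1)) ^ (1 / 2 : ℝ)

lemma upperConst_pos : 0 < upperConst d :=
  ENNReal.rpow_pos (ENNReal.mul_pos two_ne_zero (Metric.measure_ball_pos _ _ one_pos).ne')
    (ENNReal.mul_ne_top ENNReal.ofNat_ne_top measure_ball_lt_top.ne)

lemma upperConst_ne_top : upperConst d ≠ ∞ :=
  ENNReal.rpow_ne_top_of_nonneg (by norm_num)
    (ENNReal.mul_ne_top ENNReal.ofNat_ne_top measure_ball_lt_top.ne)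

lemma rpow_half_le_of_le {S N : ℝ≥0∞} (h : S ≤ 2 * volume (Metric.ball (0 : E d) 1) * N ^ 2) :
    S ^ (1 / 2 : ℝ) ≤ upperConst d * N := by
  refine (ENNReal.rpow_le_rpow h (by norm_num)).trans (le_of_eq ?_)
  rw [ENNReal.mul_rpow_of_nonneg _ _ (by norm_num), upperConst, ← ENNReal.rpow_natCast,
    ← ENNReal.rpow_mul]
  norm_num

lemma normX0_le (h : ℝ → E d → ℝ) : normX0 h ≤ upperConst d * normX h := by
  refine rpow_half_le_of_le ?_
  refine iSup_le fun x => iSup_le fun r => iSup_le fun hr => energy_le h x hr fun t ht _ => ?_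
  exact le_iSup₂_of_le (f := fun t (_ : 0 < t) => weightedGrad h t) t ht le_rfl

lemma normX0Loc_le (R : ℝ) (h : ℝ → E d → ℝ) : normX0Loc R h ≤ upperConst d * normXLoc R h := by
  refine rpow_half_le_of_le ?_
  refine iSup_le fun x => iSup_le fun r => iSup_le fun hr => energy_le h x hr.1 fun t ht htr => ?_
  exact le_iSup₂_of_le (f := fun t (_ : 0 < t ∧ t ≤ R ^ 4) => weightedGrad h t) t
    ⟨ht, htr.trans (pow_le_pow_left₀ hr.1.le hr.2 4)⟩ le_rfl

/-! ### The square-mean seminorm controls the pointwise seminorm -/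

/-- The kernel `r^{-d} (1 + |w| / r)^{-(d+1)}`. -/
def polyKernel (r : ℝ) (w : E d) : ℝ := (r ^ d)⁻¹ * ((1 + ‖w‖ / r) ^ (d + 1))⁻¹

lemma polyKernel_nonneg {r : ℝ} (hr : 0 < r) (w : E d) : 0 ≤ polyKernel r w := by
  unfold polyKernel; positivity

lemma continuous_polyKernel {r : ℝ} (hr : 0 < r) : Continuous (polyKernel r : E d → ℝ) := by
  unfold polyKernel
  refine continuous_const.mul (Continuous.inv₀ (by fun_prop) fun w => ?_)
  positivity

/-- A Harnack property at scale `r`. It allows point values to be exchanged for averages over balls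
of radius `r`. -/
lemma polyKernel_le_of_dist_lt {r : ℝ} (hr : 0 < r) {x y z : E d} (h : dist y z < r) :
    polyKernel r (x - y) ≤ 2 ^ (d + 1) * polyKernel r (x - z) := by
  have h1 : ‖x - z‖ ≤ ‖x - y‖ + r := by
    rw [dist_eq_norm] at h
    calc ‖x - z‖ = ‖(x - y) + (y - z)‖ := by congr 1; abel
      _ ≤ _ := (norm_add_le _ _).trans (by linarith)
  have h2 : 1 + ‖x - z‖ / r ≤ 2 * (1 + ‖x - y‖ / r) := by
    have : ‖x - z‖ / r ≤ ‖x - y‖ / r + 1 := by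
      rw [div_add_one hr.ne']; gcongr
    have h3 : 0 ≤ ‖x - y‖ / r := by positivity
    linarith
  have h4 : ((2 * (1 + ‖x - y‖ / r)) ^ (d + 1))⁻¹ ≤ ((1 + ‖x - z‖ / r) ^ (d + 1))⁻¹ :=
    inv_anti₀ (by positivity) (pow_le_pow_left₀ (by positivity) h2 _)
  unfold polyKernel
  calc (r ^ d)⁻¹ * ((1 + ‖x - y‖ / r) ^ (d + 1))⁻¹
      = 2 ^ (d + 1) * ((r ^ d)⁻¹ * ((2 * (1 + ‖x - y‖ / r)) ^ (d + 1))⁻¹) := by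
        rw [mul_pow]; field_simp
    _ ≤ _ := by gcongr

/-- The mass of `polyKernel`. -/
def polyMass (d : ℕ) : ℝ≥0∞ := ∫⁻ w : E d, ENNReal.ofReal (polyKernel 1 w)

lemma polyMass_ne_top : polyMass d ≠ ∞ := by
  have h : Integrable (polyKernel 1 : E d → ℝ) := by
    refine integrable_inv_one_add_norm_pow.congr (Filter.Eventually.of_forall fun w => ?_)
    simp [polyKernel]
  have := h.hasFiniteIntegral
  rw [hasFiniteIntegral_iff_ofReal (Filter.Eventually.of_forall
    (polyKernel_nonneg one_pos))] at this
  exact this.ne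

lemma lintegral_polyKernel {r : ℝ} (hr : 0 < r) (x : E d) :
    ∫⁻ z, ENNReal.ofReal (polyKernel r (x - z)) = polyMass d := by
  rw [lintegral_sub_left_eq_self (fun z => ENNReal.ofReal (polyKernel r z)) x, polyMass]
  have hscale : ∀ w : E d, ENNReal.ofReal (polyKernel r w) =
      ENNReal.ofReal (r ^ d)⁻¹ * ENNReal.ofReal (polyKernel 1 (r⁻¹ • w)) := by
    intro w
    rw [← ENNReal.ofReal_mul (by positivity)]
    congr 1
    simp only [polyKernel, norm_smul, Real.norm_of_nonneg (inv_nonneg.2 hr.le), one_pow, inv_one,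
      one_mul, div_one]
    rw [div_eq_inv_mul]
  have hm : Measurable fun w : E d => ENNReal.ofReal (polyKernel 1 w) :=
    (continuous_polyKernel one_pos).measurable.ennreal_ofReal
  simp only [hscale]
  rw [lintegral_const_mul' _ _ ENNReal.ofReal_ne_top,
    ← lintegral_map (f := fun w : E d => ENNReal.ofReal (polyKernel 1 w))
      (g := fun w => r⁻¹ • w) hm (by fun_prop),
    Measure.map_addHaar_smul volume (inv_ne_zero hr.ne'), finrank_euclideanSpace_fin,
    lintegral_smul_measure, smul_eq_mul, ← mul_assoc, ← ENNReal.ofReal_mul (by positivity),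
    abs_of_pos (by positivity), inv_pow, inv_inv, inv_mul_cancel₀ (by positivity),
    ENNReal.ofReal_one, one_mul]

/-- Averages over balls of radius `r` control convolutions with `polyKernel r`. -/
lemma lintegral_polyKernel_mul_le {r : ℝ} (hr : 0 < r) (x : E d) {f : E d → ℝ≥0∞}
    (hf : Measurable f) {S : ℝ≥0∞} (hS : ∀ z, ∫⁻ y in Metric.ball z r, f y ≤ S) :
    (∫⁻ y, ENNReal.ofReal (polyKernel r (x - y)) * f y) *
      (ENNReal.ofReal (r ^ d) * volume (Metric.ball (0 : E d) 1)) ≤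
      2 ^ (d + 1) * (polyMass d * S) := by
  have hPm : Measurable fun y : E d => ENNReal.ofReal (polyKernel r (x - y)) :=
    ((continuous_polyKernel hr).comp (continuous_const.sub continuous_id)).measurable.ennreal_ofReal
  have hind : MeasurableSet {p : E d × E d | dist p.1 p.2 < r} :=
    (isOpen_lt continuous_dist continuous_const).measurableSet
  -- The indicator of `dist y z < r` has mass `|B_r|` in `z`. Inserting it and exchanging the
  -- integrals turns `f` into its integrals over balls.
  obtain ⟨χ, hχ, hχ1, hχ2⟩ : ∃ χ : E d → E d → ℝ≥0∞, Measurable (Function.uncurry χ) ∧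
      (∀ y z, χ y z = (Metric.ball y r).indicator 1 z) ∧
      ∀ y z, χ y z = (Metric.ball z r).indicator 1 y := by
    refine ⟨fun y z => {p : E d × E d | dist p.1 p.2 < r}.indicator 1 (y, z),
      measurable_one.indicator hind, fun y z => ?_, fun y z => ?_⟩
    · simp only [indicator, mem_ofPred_eq, Metric.mem_ball, dist_comm z y, Pi.one_apply]
    · simp only [indicator, mem_ofPred_eq, Metric.mem_ball, Pi.one_apply]
  calc _ = ∫⁻ y, ∫⁻ z, ENNReal.ofReal (polyKernel r (x - y)) * f y * χ y z := by
        rw [← lintegral_mul_const _ (show Measurable (fun y => ENNReal.ofReal (polyKernel r (x - y)) * f y)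
          from hPm.mul hf)]
        congr 1
        ext1 y
        rw [lintegral_const_mul _ (show Measurable (fun z => χ y z) from hχ.comp measurable_prodMk_left)]
        simp only [hχ1]
        rw [lintegral_indicator_one measurableSet_ball, volume_ball_eq y hr]
    _ ≤ ∫⁻ y, ∫⁻ z, 2 ^ (d + 1) * (ENNReal.ofReal (polyKernel r (x - z)) * (f y * χ y z)) := by
        refine lintegral_mono fun y => lintegral_mono fun z => ?_
        by_cases h : dist y z < r
        · have h1 := ENNReal.ofReal_le_ofReal (polyKernel_le_of_dist_lt hr (x := x) h)
          rw [ENNReal.ofReal_mul (by positivity), ENNReal.ofReal_pow (by norm_num),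
            ENNReal.ofReal_ofNat] at h1
          rw [mul_assoc, ← mul_assoc (2 ^ (d + 1))]
          exact mul_le_mul_left h1 _
        · have : χ y z = 0 := by simp [hχ2, h]
          simp [this]
    _ = ∫⁻ z, ∫⁻ y, 2 ^ (d + 1) * (ENNReal.ofReal (polyKernel r (x - z)) * (f y * χ y z)) := by
        refine lintegral_lintegral_swap (Measurable.aemeasurable ?_)
        exact measurable_const.mul ((hPm.comp measurable_snd).mul ((hf.comp measurable_fst).mul hχ))
    _ = ∫⁻ z, 2 ^ (d + 1) * (ENNReal.ofReal (polyKernel r (x - z)) *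
          ∫⁻ y in Metric.ball z r, f y) := by
        congr 1
        ext1 z
        rw [lintegral_const_mul' _ _ (by simp), lintegral_const_mul' _ _ ENNReal.ofReal_ne_top,
          ← lintegral_indicator measurableSet_ball]
        congr 3
        ext1 y
        rw [hχ2]
        by_cases h : y ∈ Metric.ball z r <;> simp [h]
    _ ≤ ∫⁻ z, 2 ^ (d + 1) * (ENNReal.ofReal (polyKernel r (x - z)) * S) := by
        refine lintegral_mono fun z => ?_
        gcongr
        exact hS z
    _ = _ := by
        rw [lintegral_const_mul' _ _ (by simp), lintegral_mul_const _ hPm,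
          lintegral_polyKernel hr]

lemma lintegral_le_sqrt_mul_sqrt {α : Type*} [MeasurableSpace α] (μ : Measure α) {f : α → ℝ≥0∞}
    (hf : AEMeasurable f μ) :
    ∫⁻ a, f a ∂μ ≤ (∫⁻ a, f a ^ 2 ∂μ) ^ (1 / 2 : ℝ) * (μ univ) ^ (1 / 2 : ℝ) := by
  have h := ENNReal.lintegral_mul_le_Lp_mul_Lq μ Real.HolderConjugate.two_two hf
    (aemeasurable_const (b := (1 : ℝ≥0∞)))
  simpa using h

/-- The constant in the lower bound. -/
def lowerConst (d : ℕ) : ℝ≥0∞ :=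
  2 * (2 ^ (d + 1) * (polyMass d * (volume (Metric.ball (0 : E d) 1)) ^ (1 / 2 : ℝ))) /
    volume (Metric.ball (0 : E d) 1)

lemma lowerConst_ne_top : lowerConst d ≠ ∞ := by
  refine ENNReal.div_ne_top ?_ (Metric.measure_ball_pos _ _ one_pos).ne'
  refine ENNReal.mul_ne_top (by simp) (ENNReal.mul_ne_top (by simp)
    (ENNReal.mul_ne_top polyMass_ne_top
      (ENNReal.rpow_ne_top_of_nonneg (by norm_num) measure_ball_lt_top.ne)))

/-- If `a` is at most the convolution of `φ s` with `polyKernel r` for every `s ∈ (0, r⁴/2)`,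
then the square means of `φ` over parabolic cylinders of radius `r` control `a`. -/
lemma ofReal_mul_le_of_le_lintegral {φ : ℝ → E d → ℝ≥0∞} (hφ : Measurable (Function.uncurry φ))
    {r : ℝ} (hr : 0 < r) (x : E d) {a N : ℝ≥0∞}
    (ha : ∀ s ∈ Ioo 0 (r ^ 4 / 2), a ≤ ∫⁻ y, ENNReal.ofReal (polyKernel r (x - y)) * φ s y)
    (hN : ∀ z, ∫⁻ s in Ioo 0 (r ^ 4), ∫⁻ y in Metric.ball z r, φ s y ^ 2 ≤
      N ^ 2 * ENNReal.ofReal (r ^ (d + 2))) :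
    ENNReal.ofReal r * a ≤ lowerConst d * N := by
  set ω := volume (Metric.ball (0 : E d) 1)
  have hω0 : ω ≠ 0 := (Metric.measure_ball_pos _ _ one_pos).ne'
  have hωt : ω ≠ ∞ := measure_ball_lt_top.ne
  have hPm : Measurable fun y : E d => ENNReal.ofReal (polyKernel r (x - y)) :=
    ((continuous_polyKernel hr).comp (continuous_const.sub continuous_id)).measurable.ennreal_ofReal
  set f : E d → ℝ≥0∞ := fun y => ∫⁻ s in Ioo 0 (r ^ 4 / 2), φ s y
  have hf : Measurable f := Measurable.lintegral_prod_left' (f := Function.uncurry φ) hφ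
  -- Cauchy–Schwarz on the cylinder, of measure at most `ω r^{d+4}`: the square root of `N² r^{d+2}
  -- · ω r^{d+4}` is `N ω^{1/2} r^{d+3}`.
  have hS : ∀ z, ∫⁻ y in Metric.ball z r, f y ≤
      N * (ω ^ (1 / 2 : ℝ) * ENNReal.ofReal (r ^ (d + 3))) := by
    intro z
    calc ∫⁻ y in Metric.ball z r, f y
        = ∫⁻ s in Ioo 0 (r ^ 4 / 2), ∫⁻ y in Metric.ball z r, φ s y :=
          lintegral_lintegral_swap (hφ.comp measurable_swap).aemeasurable
      _ ≤ ∫⁻ s in Ioo 0 (r ^ 4), ∫⁻ y in Metric.ball z r, φ s y :=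
          lintegral_mono_set (Ioo_subset_Ioo_right (by linarith [pow_pos hr 4]))
      _ = ∫⁻ p, Function.uncurry φ p
            ∂((volume.restrict (Ioo 0 (r ^ 4))).prod (volume.restrict (Metric.ball z r))) :=
          (lintegral_prod _ hφ.aemeasurable).symm
      _ ≤ (∫⁻ p, Function.uncurry φ p ^ 2
            ∂((volume.restrict (Ioo 0 (r ^ 4))).prod (volume.restrict (Metric.ball z r)))) ^
              (1 / 2 : ℝ) *
          (((volume.restrict (Ioo 0 (r ^ 4))).prod (volume.restrict (Metric.ball z r))) univ) ^
              (1 / 2 : ℝ) := lintegral_le_sqrt_mul_sqrt _ hφ.aemeasurable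
      _ ≤ (N ^ 2 * ENNReal.ofReal (r ^ (d + 2))) ^ (1 / 2 : ℝ) *
          (ENNReal.ofReal (r ^ 4) * (ENNReal.ofReal (r ^ d) * ω)) ^ (1 / 2 : ℝ) := by
          gcongr
          · rw [lintegral_prod _ (hφ.pow_const 2).aemeasurable]
            exact hN z
          · rw [← univ_prod_univ, Measure.prod_prod, Measure.restrict_apply_univ,
              Measure.restrict_apply_univ, Real.volume_Ioo, sub_zero, volume_ball_eq z hr]
      _ = N * (ω ^ (1 / 2 : ℝ) * ENNReal.ofReal (r ^ (d + 3))) := by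
          rw [← ENNReal.mul_rpow_of_nonneg _ _ (by norm_num)]
          have e1 : N ^ 2 * ENNReal.ofReal (r ^ (d + 2)) *
              (ENNReal.ofReal (r ^ 4) * (ENNReal.ofReal (r ^ d) * ω)) =
              N ^ 2 * (ω * ENNReal.ofReal (r ^ (d + 3)) ^ 2) := by
            have : ENNReal.ofReal (r ^ (d + 3)) ^ 2 = ENNReal.ofReal (r ^ (d + 2)) *
                (ENNReal.ofReal (r ^ 4) * ENNReal.ofReal (r ^ d)) := by
              rw [← ENNReal.ofReal_pow (by positivity), ← ENNReal.ofReal_mul (by positivity),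
                ← ENNReal.ofReal_mul (by positivity)]
              congr 1
              ring
            rw [this]; ring
          have e2 : ∀ u : ℝ≥0∞, (u ^ 2) ^ (1 / 2 : ℝ) = u := fun u => by
            rw [← ENNReal.rpow_natCast, ← ENNReal.rpow_mul]; norm_num
          rw [e1, ENNReal.mul_rpow_of_nonneg _ _ (by norm_num),
            ENNReal.mul_rpow_of_nonneg _ _ (by norm_num), e2, e2]
  have hJ : ENNReal.ofReal (r ^ 4 / 2) * a ≤
      ∫⁻ y, ENNReal.ofReal (polyKernel r (x - y)) * f y := by
    calc ENNReal.ofReal (r ^ 4 / 2) * a = ∫⁻ _ in Ioo 0 (r ^ 4 / 2), a := by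
          rw [setLIntegral_const, Real.volume_Ioo, sub_zero, mul_comm]
      _ ≤ ∫⁻ s in Ioo 0 (r ^ 4 / 2), ∫⁻ y, ENNReal.ofReal (polyKernel r (x - y)) * φ s y :=
          setLIntegral_mono' measurableSet_Ioo ha
      _ = ∫⁻ y, ∫⁻ s in Ioo 0 (r ^ 4 / 2), ENNReal.ofReal (polyKernel r (x - y)) * φ s y :=
          lintegral_lintegral_swap ((hPm.comp measurable_snd).mul hφ).aemeasurable
      _ = _ := by
          congr 1
          ext1 y
          rw [lintegral_const_mul' _ _ ENNReal.ofReal_ne_top]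
  have hmain := (mul_le_mul_left hJ _).trans (lintegral_polyKernel_mul_le hr x hf hS)
  -- The left side carries `r⁴ · r^d` and the right side `r^{d+3}`, so exactly the weight `r =
  -- t^{1/4}` of `weightedGrad` survives.
  have hcancel : ENNReal.ofReal (r ^ (d + 3)) * (ENNReal.ofReal r * a * ω) ≤
      ENNReal.ofReal (r ^ (d + 3)) * (2 * (2 ^ (d + 1) * (polyMass d * ω ^ (1 / 2 : ℝ))) * N) := by
    calc _ = 2 * (ENNReal.ofReal (r ^ 4 / 2) * a * (ENNReal.ofReal (r ^ d) * ω)) := by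
          have : ENNReal.ofReal (r ^ (d + 3)) * ENNReal.ofReal r =
              2 * (ENNReal.ofReal (r ^ 4 / 2) * ENNReal.ofReal (r ^ d)) := by
            rw [← ENNReal.ofReal_ofNat 2, ← ENNReal.ofReal_mul (by positivity),
              ← ENNReal.ofReal_mul (by positivity), ← ENNReal.ofReal_mul (by positivity)]
            congr 1
            ring
          calc _ = ENNReal.ofReal (r ^ (d + 3)) * ENNReal.ofReal r * (a * ω) := by ring
            _ = _ := by rw [this]; ring
      _ ≤ 2 * (2 ^ (d + 1) * (polyMass d *
            (N * (ω ^ (1 / 2 : ℝ) * ENNReal.ofReal (r ^ (d + 3)))))) := by gcongr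
      _ = _ := by ring
  rw [ENNReal.mul_le_mul_iff_right (ENNReal.ofReal_pos.2 (by positivity)).ne'
    ENNReal.ofReal_ne_top] at hcancel
  rw [lowerConst, ← ENNReal.mul_div_right_comm]
  exact (ENNReal.le_div_iff_mul_le (Or.inl hω0) (Or.inl hωt)).2 hcancel

end

section

variable {d : ℕ}

/-! ### The square-mean seminorm controls the pointwise seminorm -/

/-- Polynomial decay of the kernel, uniformly over a parabolic time interval. -/
lemma exists_kernel_le_polyKernel (d : ℕ) : ∃ C : ℝ, 0 < C ∧ ∀ r : ℝ, 0 < r → ∀ w : E d,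
    (∀ t ∈ Icc (r ^ 4 / 2) (r ^ 4), |green d t w| ≤ C * polyKernel r w) ∧
    ‖fderiv ℝ (green d (r ^ 4)) w‖ ≤ C * (r⁻¹ * polyKernel r w) := by
  obtain ⟨C₀, c, hC₀, hc, h⟩ := exists_norm_fderiv_green_one_le d
  obtain ⟨C₁, hC₁, h₁⟩ := exists_weight_le_pow (d := d) hc (d + 1)
  refine ⟨2 ^ d * (C₀ * C₁), by positivity, fun r hr w => ⟨fun t ht => ?_, ?_⟩⟩
  · have ht0 : 0 < t := lt_of_lt_of_le (by positivity) ht.1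
    set l := t ^ (1 / 4 : ℝ)
    have hl : 0 < l := Real.rpow_pos_of_pos ht0 _
    have hl4 : l ^ 4 = t := rpow_quarter_pow_four ht0.le
    have hlr : l ≤ r := by
      refine le_of_pow_le_pow_left₀ (n := 4) (by norm_num) hr.le ?_
      rw [hl4]; exact ht.2
    have hrl : r ≤ 2 * l := by
      refine le_of_pow_le_pow_left₀ (n := 4) (by norm_num) (by positivity) ?_
      rw [mul_pow, hl4]; nlinarith [ht.1]
    have h2 : |green d 1 (l⁻¹ • w)| ≤ C₀ * C₁ * ((1 + ‖w‖ / r) ^ (d + 1))⁻¹ := by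
      refine ((h (l⁻¹ • w)).1.trans (mul_le_mul_of_nonneg_left (h₁ _) hC₀.le)).trans ?_
      rw [norm_smul, Real.norm_of_nonneg (by positivity), mul_assoc]
      have : ‖w‖ / r ≤ l⁻¹ * ‖w‖ := by
        rw [div_eq_inv_mul]; gcongr
      gcongr
    have h3 : (l ^ d)⁻¹ ≤ 2 ^ d * (r ^ d)⁻¹ := by
      rw [inv_le_comm₀ (by positivity) (by positivity), mul_inv, inv_inv, ← inv_pow, ← mul_pow]
      exact pow_le_pow_left₀ (by positivity) (by linarith) d
    rw [← hl4, green_pow_four hl, abs_mul, abs_of_pos (by positivity)]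
    calc (l ^ d)⁻¹ * |green d 1 (l⁻¹ • w)|
        ≤ (2 ^ d * (r ^ d)⁻¹) * (C₀ * C₁ * ((1 + ‖w‖ / r) ^ (d + 1))⁻¹) := by gcongr
      _ = _ := by rw [polyKernel]; ring
  · rw [fderiv_green_pow_four hr, norm_smul, Real.norm_of_nonneg (by positivity)]
    have h2 : ‖fderiv ℝ (green d 1) (r⁻¹ • w)‖ ≤ C₀ * C₁ * ((1 + ‖w‖ / r) ^ (d + 1))⁻¹ := by
      refine ((h (r⁻¹ • w)).2.trans (mul_le_mul_of_nonneg_left (h₁ _) hC₀.le)).trans ?_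
      rw [norm_smul, Real.norm_of_nonneg (by positivity), mul_assoc, div_eq_inv_mul]
    calc (r ^ (d + 1))⁻¹ * ‖fderiv ℝ (green d 1) (r⁻¹ • w)‖
        ≤ (r ^ (d + 1))⁻¹ * (C₀ * C₁ * ((1 + ‖w‖ / r) ^ (d + 1))⁻¹) := by gcongr
      _ = 1 * (C₀ * C₁) * (r⁻¹ * polyKernel r w) := by rw [polyKernel, pow_succ r]; field_simp
      _ ≤ _ := by
          have := polyKernel_nonneg hr w
          gcongr
          exact one_le_pow₀ (by norm_num)

/-- The square means over cylinders of radius `r` control the gradient at time `r⁴`. -/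
lemma exists_enorm_fderiv_extension_le (d : ℕ) : ∃ C : ℝ≥0, 0 < C ∧
    ∀ k : E d → ℝ, WeightIntegrable k → ∀ r : ℝ, 0 < r → ∀ N : ℝ≥0∞,
      (∀ z, energy (extension k) z r ≤ N ^ 2) →
      ∀ x, ENNReal.ofReal r * ‖fderiv ℝ (extension k (r ^ 4)) x‖ₑ ≤ C * N := by
  obtain ⟨C, hC, hker⟩ := exists_kernel_le_polyKernel d
  refine ⟨(lowerConst d * ENNReal.ofReal C).toNNReal + 1, by positivity,
    fun k hk r hr N hN x => ?_⟩
  set S : Set (ℝ × E d) := Ioi 0 ×ˢ univ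
  have hSm : MeasurableSet S := measurableSet_Ioi.prod MeasurableSet.univ
  -- The gradient is set to zero for nonpositive times, where continuity is not available, to obtain
  -- a globally measurable function.
  set ψ : ℝ → E d → ℝ≥0∞ := fun s y => S.indicator
    (fun p : ℝ × E d => ‖fderiv ℝ (extension k p.1) p.2‖ₑ) (s, y)
  have hψ : Measurable (Function.uncurry ψ) := by
    have h := (continuous_enorm.comp_continuousOn hk.continuousOn_fderiv_extension)
    have h' := h.measurable_piecewise (g := (0 : ℝ × E d → ℝ≥0∞))
      continuous_zero.continuousOn hSm
    rw [piecewise_eq_indicator] at h'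
    exact h'
  have hψ' : ∀ s y, 0 < s → ψ s y = ‖fderiv ℝ (extension k s) y‖ₑ := fun s y hs =>
    indicator_of_mem (show (s, y) ∈ S from ⟨hs, mem_univ y⟩) _
  have key := ofReal_mul_le_of_le_lintegral
    (φ := fun s y => ENNReal.ofReal C * ψ s y) (measurable_const.mul hψ) hr x
    (a := ‖fderiv ℝ (extension k (r ^ 4)) x‖ₑ) (N := ENNReal.ofReal C * N) ?_ ?_
  · refine key.trans ?_
    rw [← mul_assoc]
    gcongr
    rw [ENNReal.coe_add, ENNReal.coe_toNNReal
      (ENNReal.mul_ne_top lowerConst_ne_top ENNReal.ofReal_ne_top)]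
    exact le_self_add
  · intro s hs
    have hst : 0 < r ^ 4 - s := by linarith [hs.2, pow_pos hr 4]
    -- The remaining time `r⁴ - s` lies between `r⁴/2` and `r⁴`, so one kernel bound serves all `s`.
    have h1 := hk.fderiv_extension_add hst hs.1 x
    rw [sub_add_cancel] at h1
    rw [h1]
    refine (enorm_integral_le_lintegral_enorm _).trans ?_
    rw [← lintegral_sub_left_eq_self _ x]
    refine lintegral_mono fun y => ?_
    rw [sub_sub_cancel, enorm_smul, hψ' s y hs.1, ← mul_assoc]
    refine mul_le_mul_left ?_ _
    rw [← ofReal_norm, Real.norm_eq_abs, ← ENNReal.ofReal_mul (polyKernel_nonneg hr _), mul_comm]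
    exact ENNReal.ofReal_le_ofReal ((hker r hr (x - y)).1 _
      ⟨by linarith [hs.2], by linarith [hs.1]⟩)
  · intro z
    have h1 := hN z
    rw [energy, ENNReal.div_le_iff_le_mul (Or.inl (ENNReal.ofReal_pos.2 (by positivity)).ne')
      (Or.inl ENNReal.ofReal_ne_top)] at h1
    calc _ = ENNReal.ofReal C ^ 2 * ∫⁻ s in Ioo 0 (r ^ 4), ∫⁻ y in Metric.ball z r,
          ‖gradient (extension k s) y‖ₑ ^ 2 := by
          rw [← lintegral_const_mul' _ _ (by simp)]
          refine setLIntegral_congr_fun measurableSet_Ioo fun s hs => ?_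
          rw [← lintegral_const_mul' _ _ (by simp)]
          refine lintegral_congr fun y => ?_
          rw [hψ' s y hs.1, enorm_gradient, mul_pow]
      _ ≤ ENNReal.ofReal C ^ 2 * (N ^ 2 * ENNReal.ofReal (r ^ (d + 2))) := by gcongr
      _ = _ := by ring

lemma weightedGrad_le {h : ℝ → E d → ℝ} {t : ℝ} (ht : 0 < t) {N : ℝ≥0∞}
    (hN : ∀ x, ENNReal.ofReal (t ^ (1 / 4 : ℝ)) * ‖fderiv ℝ (h t) x‖ₑ ≤ N) :
    weightedGrad h t ≤ N := by
  have hpos : 0 < ENNReal.ofReal (t ^ (1 / 4 : ℝ)) :=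
    ENNReal.ofReal_pos.2 (Real.rpow_pos_of_pos ht _)
  rw [weightedGrad, eLpNorm_exponent_top, mul_comm]
  refine (ENNReal.le_div_iff_mul_le (Or.inl hpos.ne') (Or.inl ENNReal.ofReal_ne_top)).1 ?_
  refine essSup_le_of_ae_le _ (Filter.Eventually.of_forall fun x => ?_)
  show ‖gradient (h t) x‖ₑ ≤ N / ENNReal.ofReal (t ^ (1 / 4 : ℝ))
  rw [enorm_gradient]
  refine (ENNReal.le_div_iff_mul_le (Or.inl hpos.ne') (Or.inl ENNReal.ofReal_ne_top)).2 ?_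
  rw [mul_comm]
  exact hN x

/-- The two seminorms are equivalent. -/
theorem exists_norm_equiv (hd : 1 ≤ d) : ∃ c₁ c₂ : ℝ≥0, 0 < c₁ ∧ 0 < c₂ ∧
    ∀ k : E d → ℝ, HasExtension k →
      ((c₁ : ℝ≥0∞) * normB k ≤ normB0 k ∧ normB0 k ≤ (c₂ : ℝ≥0∞) * normB k) ∧
      ∀ R : ℝ, 0 < R →
        (c₁ : ℝ≥0∞) * normBLoc R k ≤ normB0Loc R k ∧
          normB0Loc R k ≤ (c₂ : ℝ≥0∞) * normBLoc R k := by
  obtain ⟨C, hC, hlow⟩ := exists_enorm_fderiv_extension_le d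
  have hsq : ∀ S : ℝ≥0∞, (S ^ (1 / 2 : ℝ)) ^ 2 = S := fun S => by
    rw [← ENNReal.rpow_natCast, ← ENNReal.rpow_mul]; norm_num
  have hmain : ∀ k : E d → ℝ, HasExtension k → ∀ t, 0 < t → ∀ S : ℝ≥0∞,
      (∀ z, energy (extension k) z (t ^ (1 / 4 : ℝ)) ≤ S) →
      weightedGrad (extension k) t ≤ C * S ^ (1 / 2 : ℝ) := by
    intro k hk t ht S hS
    refine weightedGrad_le ht fun x => ?_
    have := hlow k (hk.weightIntegrable hd) (t ^ (1 / 4 : ℝ)) (Real.rpow_pos_of_pos ht _)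
      (S ^ (1 / 2 : ℝ)) (fun z => (hS z).trans (hsq S).ge) x
    rwa [rpow_quarter_pow_four ht.le] at this
  have hinv : ∀ a b : ℝ≥0∞, a ≤ C * b → ((C⁻¹ : ℝ≥0) : ℝ≥0∞) * a ≤ b := by
    intro a b hab
    calc ((C⁻¹ : ℝ≥0) : ℝ≥0∞) * a ≤ ((C⁻¹ : ℝ≥0) : ℝ≥0∞) * (C * b) := by gcongr
      _ = b := by
          rw [← mul_assoc, ← ENNReal.coe_mul, inv_mul_cancel₀ hC.ne', ENNReal.coe_one, one_mul]
  have hup : ((upperConst d).toNNReal : ℝ≥0∞) = upperConst d :=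
    ENNReal.coe_toNNReal upperConst_ne_top
  refine ⟨C⁻¹, (upperConst d).toNNReal, by positivity,
    ENNReal.toNNReal_pos upperConst_pos.ne' upperConst_ne_top, fun k hk => ⟨⟨?_, ?_⟩,
      fun R hR => ⟨?_, ?_⟩⟩⟩
  · refine hinv _ _ (iSup₂_le fun t ht => hmain k hk t ht _ fun z => ?_)
    exact le_iSup_of_le z (le_iSup₂_of_le (f := fun r (_ : 0 < r) => energy (extension k) z r)
      (t ^ (1 / 4 : ℝ)) (Real.rpow_pos_of_pos ht _) le_rfl)
  · rw [hup]; exact normX0_le _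
  · refine hinv _ _ (iSup₂_le fun t ht => hmain k hk t ht.1 _ fun z => ?_)
    refine le_iSup_of_le z (le_iSup₂_of_le
      (f := fun r (_ : 0 < r ∧ r ≤ R) => energy (extension k) z r)
      (t ^ (1 / 4 : ℝ)) ⟨Real.rpow_pos_of_pos ht.1 _, ?_⟩ le_rfl)
    refine le_of_pow_le_pow_left₀ (n := 4) (by norm_num) hR.le ?_
    rw [rpow_quarter_pow_four ht.1.le]
    exact ht.2
  · rw [hup]; exact normX0Loc_le R _

end

section

variable {d : ℕ}

/-! ### Functions of bounded mean oscillation -/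

lemma setLIntegral_oscillation_le (k : E d → ℝ) (x : E d) {r : ℝ} (hr : 0 < r) :
    ∫⁻ y in Metric.ball x r, ‖k y - ⨍ z in Metric.ball x r, k z‖ₑ ≤
      normBMO k * volume (Metric.ball x r) := by
  refine (ENNReal.div_le_iff_le_mul (Or.inl (Metric.measure_ball_pos _ _ hr).ne')
    (Or.inl measure_ball_lt_top.ne)).1 ?_
  exact le_iSup_of_le x (le_iSup₂_of_le (f := fun r (_ : 0 < r) =>
    (∫⁻ y in Metric.ball x r, ‖k y - ⨍ z in Metric.ball x r, k z‖ₑ) / volume (Metric.ball x r))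
    r hr le_rfl)

/-- The difference of the means is averaged over the smaller ball against `k`; `2^d` is the volume
ratio of the balls. -/
lemma enorm_average_sub_average_double_le {k : E d → ℝ} (hk : LocallyIntegrable k) (x : E d)
    {r : ℝ} (hr : 0 < r) :
    ‖(⨍ z in Metric.ball x (2 * r), k z) - ⨍ z in Metric.ball x r, k z‖ₑ ≤
      ENNReal.ofReal (1 + 2 ^ d) * normBMO k := by
  obtain ⟨a, ha⟩ : ∃ a, a = ⨍ z in Metric.ball x r, k z := ⟨_, rfl⟩
  obtain ⟨b, hb⟩ : ∃ b, b = ⨍ z in Metric.ball x (2 * r), k z := ⟨_, rfl⟩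
  have hvol : volume (Metric.ball x (2 * r)) =
      ENNReal.ofReal (2 ^ d) * volume (Metric.ball x r) := by
    rw [volume_ball_eq x hr, volume_ball_eq x (by positivity : 0 < 2 * r), mul_pow,
      ENNReal.ofReal_mul (by positivity), mul_assoc]
  have h1 := setLIntegral_oscillation_le k x hr
  have h2 := setLIntegral_oscillation_le k x (by positivity : 0 < 2 * r)
  rw [← ha] at h1 ⊢
  rw [← hb] at h2 ⊢
  have hm : AEMeasurable (fun y => ‖k y - a‖ₑ) (volume.restrict (Metric.ball x r)) :=
    (hk.aestronglyMeasurable.aemeasurable.sub_const a).enorm.restrict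
  refine (ENNReal.mul_le_mul_iff_left (Metric.measure_ball_pos volume x hr).ne'
    measure_ball_lt_top.ne).1 ?_
  calc ‖b - a‖ₑ * volume (Metric.ball x r) = ∫⁻ _ in Metric.ball x r, ‖b - a‖ₑ := by
        rw [setLIntegral_const]
    _ ≤ ∫⁻ y in Metric.ball x r, (‖k y - a‖ₑ + ‖k y - b‖ₑ) := by
        refine lintegral_mono fun y => ?_
        have h : b - a = (k y - a) - (k y - b) := by ring
        rw [h]
        exact enorm_sub_le
    _ = (∫⁻ y in Metric.ball x r, ‖k y - a‖ₑ) + ∫⁻ y in Metric.ball x r, ‖k y - b‖ₑ :=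
        lintegral_add_left' hm _
    _ ≤ normBMO k * volume (Metric.ball x r) +
          normBMO k * volume (Metric.ball x (2 * r)) := by
        refine add_le_add h1 (le_trans ?_ h2)
        exact lintegral_mono_set (Metric.ball_subset_ball (by linarith))
    _ = _ := by
        rw [hvol, ENNReal.ofReal_add zero_le_one (by positivity), ENNReal.ofReal_one]
        ring

/-- Telescoping over doublings: means drift at most linearly in `j`, that is, logarithmically in the
radius. -/
lemma enorm_average_sub_average_two_pow_le {k : E d → ℝ} (hk : LocallyIntegrable k) (x : E d)
    {r : ℝ} (hr : 0 < r) (j : ℕ) :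
    ‖(⨍ z in Metric.ball x (2 ^ j * r), k z) - ⨍ z in Metric.ball x r, k z‖ₑ ≤
      ENNReal.ofReal (j * (1 + 2 ^ d)) * normBMO k := by
  induction j with
  | zero => simp
  | succ j ih =>
    have h := enorm_average_sub_average_double_le hk x (r := 2 ^ j * r) (by positivity)
    rw [← mul_assoc, ← pow_succ'] at h
    rw [← sub_add_sub_cancel _ (⨍ z in Metric.ball x (2 ^ j * r), k z)]
    refine (enorm_add_le _ _).trans ((add_le_add h ih).trans (le_of_eq ?_))
    rw [← add_mul, ← ENNReal.ofReal_add (by positivity) (by positivity)]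
    congr 2
    push_cast
    ring

lemma setLIntegral_two_pow_oscillation_le {k : E d → ℝ} (hk : LocallyIntegrable k) (x : E d)
    {r : ℝ} (hr : 0 < r) (j : ℕ) :
    ∫⁻ y in Metric.ball x (2 ^ j * r), ‖k y - ⨍ z in Metric.ball x r, k z‖ₑ ≤
      ENNReal.ofReal (1 + j * (1 + 2 ^ d)) * normBMO k *
        volume (Metric.ball x (2 ^ j * r)) := by
  have h1 := setLIntegral_oscillation_le k x (by positivity : 0 < 2 ^ j * r)
  have h2 := enorm_average_sub_average_two_pow_le hk x hr j
  obtain ⟨a, ha⟩ : ∃ a, a = ⨍ z in Metric.ball x r, k z := ⟨_, rfl⟩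
  obtain ⟨b, hb⟩ : ∃ b, b = ⨍ z in Metric.ball x (2 ^ j * r), k z := ⟨_, rfl⟩
  rw [← hb] at h1 h2
  rw [← ha] at h2 ⊢
  calc _ ≤ ∫⁻ y in Metric.ball x (2 ^ j * r), (‖k y - b‖ₑ + ‖b - a‖ₑ) := by
        refine lintegral_mono fun y => ?_
        rw [← sub_add_sub_cancel (k y) b a]
        exact enorm_add_le _ _
    _ = (∫⁻ y in Metric.ball x (2 ^ j * r), ‖k y - b‖ₑ) +
          ‖b - a‖ₑ * volume (Metric.ball x (2 ^ j * r)) := by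
        rw [lintegral_add_right _ measurable_const, setLIntegral_const]
    _ ≤ normBMO k * volume (Metric.ball x (2 ^ j * r)) +
          ENNReal.ofReal (j * (1 + 2 ^ d)) * normBMO k *
            volume (Metric.ball x (2 ^ j * r)) := by gcongr
    _ = _ := by
        rw [ENNReal.ofReal_add zero_le_one (by positivity), ENNReal.ofReal_one]
        ring

lemma exists_polyKernel_le_two_pow {r : ℝ} (hr : 0 < r) (x y : E d) :
    ∃ j : ℕ, y ∈ Metric.ball x (2 ^ j * r) ∧
      polyKernel r (x - y) ≤ 2 ^ (d + 1) * ((r ^ d)⁻¹ * ((2 ^ j) ^ (d + 1))⁻¹) := by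
  have hex : ∃ j : ℕ, ‖x - y‖ / r < 2 ^ j := pow_unbounded_of_one_lt _ one_lt_two
  classical
  -- Minimality of `j` makes `2^j` at most twice `1 + ‖x - y‖ / r`; the case `j = 0` is the ball
  -- `B_r(x)` itself.
  refine ⟨Nat.find hex, ?_, ?_⟩
  · rw [Metric.mem_ball, dist_comm, dist_eq_norm, ← div_lt_iff₀ hr]
    exact Nat.find_spec hex
  · have h : (2 : ℝ) ^ Nat.find hex ≤ 2 * (1 + ‖x - y‖ / r) := by
      have h0 : 0 ≤ ‖x - y‖ / r := by positivity
      rcases Nat.eq_zero_or_pos (Nat.find hex) with hj | hj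
      · rw [hj, pow_zero]; linarith
      · have h1 := Nat.find_min hex (Nat.sub_lt hj one_pos)
        rw [not_lt] at h1
        rw [← Nat.sub_add_cancel hj, pow_succ]
        linarith
    rw [polyKernel, ← mul_assoc, mul_comm (2 ^ (d + 1)), mul_assoc]
    gcongr
    rw [← div_eq_mul_inv, inv_le_iff_one_le_mul₀ (by positivity), div_mul_eq_mul_div,
      one_le_div (by positivity), ← mul_pow]
    gcongr

/-- The sum over dyadic balls that controls the tails of functions of bounded mean oscillation. -/
def oscConst (d : ℕ) : ℝ≥0∞ :=
  (∑' j : ℕ, ENNReal.ofReal (2 ^ (d + 1) * ((1 + j * (1 + 2 ^ d)) * (1 / 2) ^ j))) *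
    volume (Metric.ball (0 : E d) 1)

lemma oscConst_ne_top : oscConst d ≠ ∞ := by
  refine ENNReal.mul_ne_top ?_ measure_ball_lt_top.ne
  have h0 : Summable fun j : ℕ => (1 / 2 : ℝ) ^ j := summable_geometric_two
  have h1 : Summable fun j : ℕ => (j : ℝ) ^ 1 * (1 / 2 : ℝ) ^ j :=
    summable_pow_mul_geometric_of_norm_lt_one 1 (by norm_num)
  have h : Summable fun j : ℕ => (2 : ℝ) ^ (d + 1) * ((1 + j * (1 + 2 ^ d)) * (1 / 2) ^ j) := by
    refine ((h0.add (h1.mul_left (1 + 2 ^ d))).mul_left (2 ^ (d + 1))).congr fun j => ?_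
    ring
  rw [← ENNReal.ofReal_tsum_of_nonneg (fun j => by positivity) h]
  exact ENNReal.ofReal_ne_top

/-- The weighted oscillation around the mean over a ball is controlled by the `BMO` seminorm. -/
lemma lintegral_polyKernel_mul_oscillation_le {k : E d → ℝ} (hk : LocallyIntegrable k) (x : E d)
    {r : ℝ} (hr : 0 < r) :
    ∫⁻ y, ENNReal.ofReal (polyKernel r (x - y)) * ‖k y - ⨍ z in Metric.ball x r, k z‖ₑ ≤
      oscConst d * normBMO k := by
  have hosc := setLIntegral_two_pow_oscillation_le hk x hr
  obtain ⟨a, ha⟩ : ∃ a, a = ⨍ z in Metric.ball x r, k z := ⟨_, rfl⟩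
  rw [← ha] at hosc ⊢
  obtain ⟨c, hc⟩ : ∃ c : ℕ → ℝ, ∀ j, c j = 2 ^ (d + 1) * ((r ^ d)⁻¹ * ((2 ^ j) ^ (d + 1))⁻¹) :=
    ⟨_, fun _ => rfl⟩
  have hm : AEMeasurable (fun y => ‖k y - a‖ₑ) :=
    (hk.aestronglyMeasurable.aemeasurable.sub_const a).enorm
  calc _ ≤ ∫⁻ y, ∑' j : ℕ, ENNReal.ofReal (c j) *
          (Metric.ball x (2 ^ j * r)).indicator (fun y => ‖k y - a‖ₑ) y := by
        refine lintegral_mono fun y => ?_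
        obtain ⟨j, hj, hle⟩ := exists_polyKernel_le_two_pow hr x y
        refine le_trans ?_ (ENNReal.le_tsum j)
        rw [indicator_of_mem hj, hc]
        gcongr
    _ = ∑' j : ℕ, ENNReal.ofReal (c j) * ∫⁻ y in Metric.ball x (2 ^ j * r), ‖k y - a‖ₑ := by
        rw [lintegral_tsum fun j => (hm.indicator measurableSet_ball).const_mul _]
        refine tsum_congr fun j => ?_
        rw [lintegral_const_mul' _ _ ENNReal.ofReal_ne_top,
          lintegral_indicator measurableSet_ball]
    _ ≤ ∑' j : ℕ, ENNReal.ofReal (2 ^ (d + 1) * ((1 + j * (1 + 2 ^ d)) * (1 / 2) ^ j)) *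
          (volume (Metric.ball (0 : E d) 1) * normBMO k) := by
        refine ENNReal.tsum_le_tsum fun j => ?_
        refine (mul_le_mul_right (hosc j) _).trans (le_of_eq ?_)
        rw [volume_ball_eq x (by positivity : 0 < 2 ^ j * r)]
        -- The decay `2^{-j(d+1)}` against the volume `2^{jd}` leaves `2^{-j}`, which is summable
        -- against the linear drift of the means.
        have h : (2 : ℝ) ^ (d + 1) * ((1 + j * (1 + 2 ^ d)) * (1 / 2) ^ j) =
            c j * (1 + j * (1 + 2 ^ d)) * (2 ^ j * r) ^ d := by
          rw [hc, one_div, inv_pow, mul_pow, pow_succ (2 ^ j : ℝ)]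
          field_simp
        rw [h, ENNReal.ofReal_mul (by rw [hc]; positivity), ENNReal.ofReal_mul
          (by rw [hc]; positivity)]
        ring
    _ = _ := by rw [ENNReal.tsum_mul_right, oscConst, mul_assoc]

/-- The oscillation about the mean over the unit ball is integrable against `polyKernel 1`, which
dominates a multiple of every weight; the subtracted mean is restored by integrability of the
weight. -/
lemma weightIntegrable_of_memBMO {k : E d → ℝ} (hk : MemBMO k) : WeightIntegrable k := by
  intro c hc
  obtain ⟨C, hC, h⟩ := exists_weight_le_pow (d := d) hc (d + 1)
  have hosc := lintegral_polyKernel_mul_oscillation_le hk.1 0 one_pos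
  obtain ⟨a, ha⟩ : ∃ a, a = ⨍ z in Metric.ball (0 : E d) 1, k z := ⟨_, rfl⟩
  rw [← ha] at hosc
  have hi : Integrable fun y => weight c y * (k y - a) := by
    refine ⟨(continuous_weight c).aestronglyMeasurable.mul
      (hk.1.aestronglyMeasurable.sub aestronglyMeasurable_const), ?_⟩
    refine lt_of_le_of_lt (b := ENNReal.ofReal C * (oscConst d * normBMO k)) ?_
      (ENNReal.mul_lt_top ENNReal.ofReal_lt_top
        (ENNReal.mul_lt_top oscConst_ne_top.lt_top hk.2))
    refine le_trans ?_ (mul_le_mul_right hosc _)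
    rw [← lintegral_const_mul' _ _ ENNReal.ofReal_ne_top]
    refine lintegral_mono fun y => ?_
    rw [enorm_mul, ← mul_assoc, ← ENNReal.ofReal_mul hC.le]
    refine mul_le_mul_left ?_ _
    rw [← ofReal_norm, Real.norm_of_nonneg (weight_pos c y).le]
    refine ENNReal.ofReal_le_ofReal ?_
    simpa [polyKernel] using h y
  refine (hi.add ((integrable_weight hc).mul_const a)).congr
    (Filter.Eventually.of_forall fun y => ?_)
  simp only [Pi.add_apply]
  ring

/-- The gradient of the extension does not change if a constant is subtracted. -/
lemma WeightIntegrable.fderiv_extension_eq_integral_sub {k : E d → ℝ} (hk : WeightIntegrable k)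
    {t : ℝ} (ht : 0 < t) (x : E d) (a : ℝ) :
    fderiv ℝ (extension k t) x = ∫ y, (k y - a) • fderiv ℝ (green d t) (x - y) := by
  obtain ⟨B, hB, hle⟩ := hk.exists_bound (a := t) (b := t) ht ‖x‖
  have h1 : Integrable fun y => k y • fderiv ℝ (green d t) (x - y) :=
    hB.mono' (hk.aestronglyMeasurable_smul_fderiv ht x)
      (Filter.Eventually.of_forall fun y => hle t ⟨le_rfl, le_rfl⟩ x le_rfl y)
  have h2 : Integrable fun y => a • fderiv ℝ (green d t) (x - y) :=
    ((integrable_fderiv_green ht).comp_sub_left x).smul a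
  simp only [sub_smul]
  rw [integral_sub h1 h2, integral_smul, integral_sub_left_eq_self (fderiv ℝ (green d t)),
    integral_fderiv_green ht, smul_zero, sub_zero, hk.fderiv_extension ht]

/-! ### Bounds by the `BMO` seminorm and the inclusions. -/

/-- Subtracting the mean over `B_r(x)` with `r = t^{1/4}` matches the scale of the kernel: `r
|∇G(t)|` is bounded by a multiple of `polyKernel r`, and the weighted oscillation estimate applies.
-/
lemma exists_normB_le_normBMO (d : ℕ) : ∃ C : ℝ≥0, ∀ k : E d → ℝ, MemBMO k →
    normB k ≤ C * normBMO k := by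
  obtain ⟨C, hC, hker⟩ := exists_kernel_le_polyKernel d
  refine ⟨(ENNReal.ofReal C * oscConst d).toNNReal, fun k hk => ?_⟩
  rw [ENNReal.coe_toNNReal (ENNReal.mul_ne_top ENNReal.ofReal_ne_top oscConst_ne_top)]
  refine iSup₂_le fun t ht => weightedGrad_le ht fun x => ?_
  obtain ⟨r, hr⟩ : ∃ r, r = t ^ (1 / 4 : ℝ) := ⟨_, rfl⟩
  have hr0 : 0 < r := hr ▸ Real.rpow_pos_of_pos ht _
  have hrt : r ^ 4 = t := by rw [hr, rpow_quarter_pow_four ht.le]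
  have hosc := lintegral_polyKernel_mul_oscillation_le hk.1 x hr0
  rw [← hr, (weightIntegrable_of_memBMO hk).fderiv_extension_eq_integral_sub ht x
    (⨍ z in Metric.ball x r, k z), mul_assoc]
  obtain ⟨a, ha⟩ : ∃ a, a = ⨍ z in Metric.ball x r, k z := ⟨_, rfl⟩
  rw [← ha] at hosc ⊢
  refine (mul_le_mul_right (enorm_integral_le_lintegral_enorm _) _).trans ?_
  refine le_trans ?_ (mul_le_mul_right hosc _)
  rw [← lintegral_const_mul' _ _ ENNReal.ofReal_ne_top,
    ← lintegral_const_mul' _ _ ENNReal.ofReal_ne_top]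
  refine lintegral_mono fun y => ?_
  rw [enorm_smul, mul_comm ‖k y - a‖ₑ, ← mul_assoc, ← mul_assoc, ← ofReal_norm (fderiv _ _ _),
    ← ENNReal.ofReal_mul hr0.le, ← ENNReal.ofReal_mul hC.le]
  refine mul_le_mul_left (ENNReal.ofReal_le_ofReal ?_) _
  have h := (hker r hr0 (x - y)).2
  rw [hrt] at h
  calc r * ‖fderiv ℝ (green d t) (x - y)‖ ≤ r * (C * (r⁻¹ * polyKernel r (x - y))) := by gcongr
    _ = C * polyKernel r (x - y) := by field_simp

lemma exists_normB0_le_normBMO (d : ℕ) : ∃ c : ℝ≥0, 0 < c ∧ ∀ k : E d → ℝ,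
    LocallyIntegrable k → normB0 k ≤ c * normBMO k := by
  obtain ⟨C, hC⟩ := exists_normB_le_normBMO d
  -- The summand `1` makes the constant positive, so that the bound is trivially true when the `BMO`
  -- seminorm is infinite.
  refine ⟨(upperConst d).toNNReal * C + 1, by positivity, fun k hk => ?_⟩
  rcases eq_or_ne (normBMO k) ∞ with h | h
  · rw [h, ENNReal.mul_top (by positivity)]
    exact le_top
  · calc normB0 k ≤ upperConst d * normB k := normX0_le _
      _ ≤ upperConst d * (C * normBMO k) := by gcongr; exact hC k ⟨hk, h.lt_top⟩
      _ ≤ _ := by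
          rw [← mul_assoc, ENNReal.coe_add, ENNReal.coe_mul,
            ENNReal.coe_toNNReal upperConst_ne_top]
          gcongr
          exact le_self_add

theorem MemBMO.memB0 {k : E d → ℝ} (hk : MemBMO k) : MemB0 k := by
  have hw := weightIntegrable_of_memBMO hk
  obtain ⟨c, -, hc⟩ := exists_normB0_le_normBMO d
  refine ⟨hw.hasExtension, fun t ht x => (hw.hasFDerivAt_extension ht x).differentiableAt, ?_,
    (hc k hk.1).trans_lt (ENNReal.mul_lt_top ENNReal.coe_lt_top hk.2)⟩
  have h : ContinuousOn (fun p : ℝ × E d => ‖gradient (extension k p.1) p.2‖ ^ 2)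
      (Ioi 0 ×ˢ univ) := by
    simp only [gradient, LinearIsometryEquiv.norm_map]
    exact hw.continuousOn_fderiv_extension.norm.pow 2
  exact h.locallyIntegrableOn (measurableSet_Ioi.prod MeasurableSet.univ)

theorem memBMO_of_memLp_top {k : E d → ℝ} (hk : MemLp k ∞ volume) : MemBMO k := by
  refine ⟨hk.locallyIntegrable le_top, lt_of_le_of_lt (b := eLpNorm k ∞ volume +
    eLpNorm k ∞ volume) ?_ (ENNReal.add_lt_top.2 ⟨hk.2, hk.2⟩)⟩
  refine iSup_le fun x => iSup_le fun r => iSup_le fun hr => ?_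
  have hpos : volume (Metric.ball x r) ≠ 0 := (Metric.measure_ball_pos _ _ hr).ne'
  have hae : ∀ᵐ y, ‖k y‖ₑ ≤ eLpNorm k ∞ volume := by
    rw [eLpNorm_exponent_top]
    exact ae_le_eLpNormEssSup
  have havg : ‖⨍ z in Metric.ball x r, k z‖ₑ ≤ eLpNorm k ∞ volume := by
    refine (enorm_integral_le_lintegral_enorm _).trans ?_
    refine (laverage_mono_ae (ae_restrict_of_ae hae)).trans ?_
    rw [setLAverage_const hpos measure_ball_lt_top.ne]
  rw [ENNReal.div_le_iff_le_mul (Or.inl hpos) (Or.inl measure_ball_lt_top.ne),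
    ← setLIntegral_const]
  refine lintegral_mono_ae (ae_restrict_of_ae ?_)
  filter_upwards [hae] with y hy
  exact enorm_sub_le.trans (add_le_add hy havg)

end

end Bicaloric

end

theorem proposition2p2 (d : ℕ) (hd : 1 ≤ d) :
    (d ≤ 3 → ∃ c₁ c₂ : ℝ≥0, 0 < c₁ ∧ 0 < c₂ ∧
      ∀ k : Bicaloric.E d → ℝ, Bicaloric.HasExtension k →
        ((c₁ : ℝ≥0∞) * Bicaloric.normB k ≤ Bicaloric.normB0 k ∧
          Bicaloric.normB0 k ≤ (c₂ : ℝ≥0∞) * Bicaloric.normB k) ∧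
        ∀ R : ℝ, 0 < R →
          (c₁ : ℝ≥0∞) * Bicaloric.normBLoc R k ≤ Bicaloric.normB0Loc R k ∧
            Bicaloric.normB0Loc R k ≤ (c₂ : ℝ≥0∞) * Bicaloric.normBLoc R k) ∧
    (∃ c₃ : ℝ≥0, 0 < c₃ ∧
      ∀ k : Bicaloric.E d → ℝ, LocallyIntegrable k →
        Bicaloric.normB0 k ≤ (c₃ : ℝ≥0∞) * Bicaloric.normBMO k) ∧
    (∀ k : Bicaloric.E d → ℝ, Bicaloric.MemBMO k → Bicaloric.MemB0 k) ∧
    (∀ k : Bicaloric.E d → ℝ, MemLp k ∞ volume → Bicaloric.MemB0 k) :=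
  ⟨fun _ => Bicaloric.exists_norm_equiv hd, Bicaloric.exists_normB0_le_normBMO d,
    fun _ hk => hk.memB0, fun _ hk => (Bicaloric.memBMO_of_memLp_top hk).memB0⟩
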